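/- Let $d\in\mathbb N$, $T,m>0$, $\gamma=\frac{T}{\pi m}$, and let $\bar{\mathcal L}=-\partial_t^4+\gamma^2\partial_t^2$ be the operator on $\mathrm L^2([0,\pi],\mathbb R^d)$ with domain $$\mathcal D(\bar{\mathcal L})=\Bigl\{x\in \mathrm H^4([0,\pi],\mathbb R^d)\ \Big|\ x(0)=x(\pi)=0,\ \tfrac{T}{\pi\gamma}\,\partial_t^2x(0)=\partial_tx(0),\ \tfrac{T}{\pi\gamma}\,\partial_t^2x(\pi)=-\partial_tx(\pi)\Bigr\}.$$ The operator $-\bar{\mathcal L}$ is self-adjoint, positive definite and has discrete spectrum; let $P_\mu$ denote the orthogonal projection onto $\ker(-\bar{\mathcal L}-\mu)$ and put $\|x\|_{\mathcal H_\alpha}^2=\|(-\bar{\mathcal L})^{\alpha}x\|_{\mathrm L^2}^2=\sum_{\mu}\mu^{2\alpha}\|P_\mu x\|_{\mathrm L^2}^2$. For $\alpha\ge0$ let $\mathcal H_\alpha=\mathcal D((-\bar{\mathcal L})^\alpha)=\{x\in \mathrm L^2: \|x\|_{\mathcal H_\alpha}<\infty\}$; for $\alpha<0$ let $\mathcal H_\alpha$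 be the completion of $\mathrm L^2([0,\pi],\mathbb R^d)$ under $\|\cdot\|_{\mathcal H_\alpha}$. For $s\ge0$ let $\mathrm H^s=\mathrm H^s([0,\pi],\mathbb R^d)$ be the space of restrictions to $[0,\pi]$ of elements of the $2\pi$-periodic Sobolev space $\{F\in \mathrm L^2([0,2\pi],\mathbb R^d):\sum_{n\in\mathbb Z}(1+n^2)^s|\hat F(n)|^2<\infty\}$, with the quotient norm. For $s<0$ let $\mathrm H^s$ be the dual space of $\mathrm H^{-s}$, where $y\in\mathrm L^2$ is regarded as the element $f\mapsto\int_0^\pi\langle y(t),f(t)\rangle\,dt$ of $\mathrm H^s$. Let $\mathrm C_0$ be the set of continuous functions $[0,\pi]\to\mathbb R^d$ that vanish at $0$ and $\pi$. Then the following identities hold, with equivalence of norms. 1. For every $\alpha\in(-\frac18,\frac18)$, $\mathcal H_\alpha=\mathrm H^{4\alpha}$. 2. For every $\alpha\in(\frac18,\frac12]$, $\mathcal H_\alpha=\mathrm H^{4\alpha}\cap \mathrm C_0$ (with the norm of $\mathrm H^{4\alpha}$). 3. For every $\alpha\in[-\frac12,-\frac18)$, $\mathcal H_\alpha=\mathrm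 H^{4\alpha}/\!\sim$ (with the quotient norm), where $\sim$ identifies distributions that differ only by a linear combination $v\,\delta_0+w\,\delta_\pi$, $v,w\in\mathbb R^d$. For $\alpha<0$ the identity means that the natural map of $\mathrm L^2$ into the right-hand side extends to an isomorphism of topological vector spaces from $\mathcal H_\alpha$ onto the right-hand side. -/

import Mathlib

open MeasureTheory Set
open scoped ENNReal

noncomputable section

namespace Interp

/-- `ℝ^d` with the Euclidean norm. -/
abbrev E (d : ℕ) : Type := EuclideanSpace ℝ (Fin d)

/-- Lebesgue measure on `[0, ℓ]`. -/
abbrev leb (ℓ : ℝ) : Measure ℝ := volume.restrict (Icc 0 ℓ)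

/-- The Hilbert space `L²([0, ℓ], ℝ^d)`. -/
abbrev L2 (d : ℕ) (ℓ : ℝ) : Type := Lp (E d) 2 (leb ℓ)

lemma integrable_L2 {d : ℕ} {ℓ : ℝ} (f : L2 d ℓ) : Integrable f (leb ℓ) :=
  (Lp.memLp f).integrable one_le_two

lemma intervalIntegrable_L2 {d : ℕ} {ℓ : ℝ} (f : L2 d ℓ) {t : ℝ} (ht : t ∈ Icc 0 ℓ) :
    IntervalIntegrable f volume 0 t := by
  rw [intervalIntegrable_iff_integrableOn_Icc_of_le ht.1]
  exact IntegrableOn.mono_set (integrable_L2 f) (Icc_subset_Icc le_rfl ht.2)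

/-! ### The fourth order operator on `[0, π]` -/

/-- The operator `-∂⁴ + γ² ∂²` on `L²([0, π], ℝ^d)`, `γ = T / (π m)`, given by its graph:
`IsLbar T m d x y` says that `x` is in the domain and is mapped to `y`. The class `x` lies in `H⁴`
if it has a `C³` representative `u` whose third derivative is absolutely continuous on `[0, π]`
with square integrable derivative `g`. -/
def IsLbar (T m : ℝ) (d : ℕ) (x y : L2 d Real.pi) : Prop :=
  ∃ (u : ℝ → E d) (g : L2 d Real.pi),
    ContDiff ℝ 3 u ∧
    (∀ t ∈ Icc 0 Real.pi, iteratedDeriv 3 u t = iteratedDeriv 3 u 0 + ∫ s in (0 : ℝ)..t, g s) ∧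
    (x =ᵐ[leb Real.pi] u) ∧
    u 0 = 0 ∧ u Real.pi = 0 ∧
    (T / (Real.pi * (T / (Real.pi * m)))) • iteratedDeriv 2 u 0 = iteratedDeriv 1 u 0 ∧
    (T / (Real.pi * (T / (Real.pi * m)))) • iteratedDeriv 2 u Real.pi
      = - iteratedDeriv 1 u Real.pi ∧
    (y =ᵐ[leb Real.pi] fun t => - g t + (T / (Real.pi * m)) ^ 2 • iteratedDeriv 2 u t)

lemma IsLbar.zero (T m : ℝ) (d : ℕ) : IsLbar T m d 0 0 := by
  have h0 : ∀ k, iteratedDeriv k (fun _ : ℝ => (0 : E d)) = 0 := by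
    intro k
    ext1 t
    simp
  have hz := Lp.coeFn_zero (E d) 2 (leb Real.pi)
  refine ⟨fun _ => 0, 0, contDiff_const, ?_, hz, rfl, rfl, by simp, by simp, ?_⟩
  · intro t ht
    have : ∫ s in (0 : ℝ)..t, (0 : L2 d Real.pi) s = 0 := by
      rw [intervalIntegral.integral_of_le ht.1]
      refine integral_eq_zero_of_ae ?_
      exact ae_mono (Measure.restrict_mono
        (Ioc_subset_Icc_self.trans (Icc_subset_Icc le_rfl ht.2)) le_rfl) hz
    rw [this, h0]
    simp
  · filter_upwards [hz] with t ht
    rw [h0, ht]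
    simp

lemma IsLbar.add {T m : ℝ} {d : ℕ} {x y x' y' : L2 d Real.pi} (h : IsLbar T m d x y)
    (h' : IsLbar T m d x' y') : IsLbar T m d (x + x') (y + y') := by
  obtain ⟨u, g, hu, hg, hx, h1, h2, h3, h4, hy⟩ := h
  obtain ⟨u', g', hu', hg', hx', h1', h2', h3', h4', hy'⟩ := h'
  have hd : ∀ k : ℕ, k ≤ 3 → ∀ t,
      iteratedDeriv k (u + u') t = iteratedDeriv k u t + iteratedDeriv k u' t := by
    intro k hk t
    have hk' : (k : WithTop ℕ∞) ≤ 3 := by exact_mod_cast hk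
    exact iteratedDeriv_add (hu.contDiffAt.of_le hk') (hu'.contDiffAt.of_le hk')
  refine ⟨u + u', g + g', hu.add hu', ?_, ?_, by simp [h1, h1'], by simp [h2, h2'], ?_, ?_, ?_⟩
  · intro t ht
    have : ∫ s in (0 : ℝ)..t, (g + g' : L2 d Real.pi) s
        = (∫ s in (0 : ℝ)..t, g s) + ∫ s in (0 : ℝ)..t, g' s := by
      rw [← intervalIntegral.integral_add (intervalIntegrable_L2 g ht)
        (intervalIntegrable_L2 g' ht)]
      rw [intervalIntegral.integral_of_le ht.1, intervalIntegral.integral_of_le ht.1]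
      refine integral_congr_ae ?_
      exact ae_mono (Measure.restrict_mono
        (Ioc_subset_Icc_self.trans (Icc_subset_Icc le_rfl ht.2)) le_rfl) (Lp.coeFn_add g g')
    rw [this, hd 3 le_rfl, hd 3 le_rfl, hg t ht, hg' t ht]
    abel
  · filter_upwards [hx, hx', Lp.coeFn_add x x'] with t a b c
    rw [c, Pi.add_apply, Pi.add_apply, a, b]
  · rw [hd 2 (by norm_num), hd 1 (by norm_num), smul_add, h3, h3']
  · rw [hd 2 (by norm_num), hd 1 (by norm_num), smul_add, h4, h4']
    abel
  · filter_upwards [hy, hy', Lp.coeFn_add y y', Lp.coeFn_add g g'] with t a b c e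
    rw [c, e, hd 2 (by norm_num), Pi.add_apply, Pi.add_apply, a, b, smul_add]
    abel

lemma IsLbar.smul {T m : ℝ} {d : ℕ} {x y : L2 d Real.pi} (c : ℝ) (h : IsLbar T m d x y) :
    IsLbar T m d (c • x) (c • y) := by
  obtain ⟨u, g, hu, hg, hx, h1, h2, h3, h4, hy⟩ := h
  have hd : ∀ k : ℕ, k ≤ 3 → ∀ t, iteratedDeriv k (c • u) t = c • iteratedDeriv k u t := by
    intro k hk t
    have hk' : (k : WithTop ℕ∞) ≤ 3 := by exact_mod_cast hk
    exact iteratedDeriv_const_smul (hu.contDiffAt.of_le hk') c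
  refine ⟨c • u, c • g, hu.const_smul c, ?_, ?_, by simp [h1], by simp [h2], ?_, ?_, ?_⟩
  · intro t ht
    have : ∫ s in (0 : ℝ)..t, (c • g : L2 d Real.pi) s = c • ∫ s in (0 : ℝ)..t, g s := by
      rw [← intervalIntegral.integral_smul]
      rw [intervalIntegral.integral_of_le ht.1, intervalIntegral.integral_of_le ht.1]
      refine integral_congr_ae ?_
      exact ae_mono (Measure.restrict_mono
        (Ioc_subset_Icc_self.trans (Icc_subset_Icc le_rfl ht.2)) le_rfl) (Lp.coeFn_smul c g)
    rw [this, hd 3 le_rfl, hd 3 le_rfl, hg t ht, smul_add]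
  · filter_upwards [hx, Lp.coeFn_smul c x] with t a b
    rw [b, Pi.smul_apply, Pi.smul_apply, a]
  · rw [hd 2 (by norm_num), hd 1 (by norm_num), smul_comm, h3]
  · rw [hd 2 (by norm_num), hd 1 (by norm_num), smul_comm, h4, smul_neg]
  · filter_upwards [hy, Lp.coeFn_smul c y, Lp.coeFn_smul c g] with t a b e
    rw [b, e, hd 2 (by norm_num), Pi.smul_apply, Pi.smul_apply, a, smul_add, smul_neg, smul_comm]

/-- The eigenspace `ker (-L̄ - μ)`. -/
def eigenspace (T m : ℝ) (d : ℕ) (μ : ℝ) : Submodule ℝ (L2 d Real.pi) where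
  carrier := {x | IsLbar T m d x (-(μ • x))}
  zero_mem' := by simpa using IsLbar.zero T m d
  add_mem' {x x'} h h' := by
    have := IsLbar.add h h'
    simpa only [mem_ofPred_eq, smul_add, neg_add] using this
  smul_mem' c x h := by
    have := IsLbar.smul c h
    simpa only [mem_ofPred_eq, smul_neg, smul_comm c μ x] using this

/-- The orthogonal projection of `L²` onto the (closed) eigenspace `ker (-L̄ - μ)`. -/
def eigenproj (T m : ℝ) (d : ℕ) (μ : ℝ) : L2 d Real.pi →L[ℝ] L2 d Real.pi :=
  (eigenspace T m d μ).topologicalClosure.starProjection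

/-- The spectral components `μ^α P_μ x` of `(-L̄)^α x`; they vanish unless `μ` is an eigenvalue
of the positive definite operator `-L̄`. -/
def powComponents (T m : ℝ) (d : ℕ) (α : ℝ) :
    L2 d Real.pi →ₗ[ℝ] PreLp (fun _ : ℝ => L2 d Real.pi) where
  toFun x := fun μ => (μ ^ α) • eigenproj T m d μ x
  map_add' x y := by
    funext μ
    change _ = (μ ^ α) • eigenproj T m d μ x + (μ ^ α) • eigenproj T m d μ y
    rw [map_add, smul_add]
  map_smul' c x := by
    funext μ
    change _ = c • (μ ^ α) • eigenproj T m d μ x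
    rw [map_smul, smul_comm]

/-- `{x ∈ L² | ∑_μ μ^{2α} ‖P_μ x‖² < ∞}`. -/
def powSubmodule (T m : ℝ) (d : ℕ) (α : ℝ) : Submodule ℝ (L2 d Real.pi) :=
  (lpSubmodule ℝ (fun _ : ℝ => L2 d Real.pi) 2).comap (powComponents T m d α)

/-- The domain `D((-L̄)^α) ⊆ L²`, with the norm `‖(-L̄)^α x‖ = (∑_μ μ^{2α} ‖P_μ x‖²)^{1/2}`. -/
def PowDomain (T m : ℝ) (d : ℕ) (α : ℝ) : Type := ↥(powSubmodule T m d α)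

namespace PowDomain

variable {T m : ℝ} {d : ℕ} {α : ℝ}

instance : AddCommGroup (PowDomain T m d α) :=
  inferInstanceAs (AddCommGroup ↥(powSubmodule T m d α))

instance : Module ℝ (PowDomain T m d α) :=
  inferInstanceAs (Module ℝ ↥(powSubmodule T m d α))

/-- `x ↦ (-L̄)^α x`, decomposed into its spectral components. -/
def pow : PowDomain T m d α →ₗ[ℝ] lp (fun _ : ℝ => L2 d Real.pi) 2 where
  toFun x := ⟨powComponents T m d α x.1, x.2⟩
  map_add' x y := Subtype.ext ((powComponents T m d α).map_add x.1 y.1)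
  map_smul' c x := Subtype.ext ((powComponents T m d α).map_smul c x.1)

instance : SeminormedAddCommGroup (PowDomain T m d α) :=
  SeminormedAddCommGroup.induced _ _ (pow (T := T) (m := m) (d := d) (α := α))

instance : NormedSpace ℝ (PowDomain T m d α) :=
  NormedSpace.induced ℝ _ _ (pow (T := T) (m := m) (d := d) (α := α))

/-- The element of `L²`. -/
def toL2 (x : PowDomain T m d α) : L2 d Real.pi := x.1

end PowDomain

/-- The space `H_α` for `α < 0`: the completion of `L²` (which is then `PowDomain T m d α`) under
the norm `‖(-L̄)^α x‖`. -/
abbrev InterpNeg (T m : ℝ) (d : ℕ) (α : ℝ) : Type :=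
  UniformSpace.Completion (PowDomain T m d α)

/-! ### Fractional Sobolev spaces -/

/-- The Fourier coefficient `(∫ cos(nt) F(t) dt, ∫ sin(nt) F(t) dt)` on `[0, 2π]`. -/
def trigCoeff (d : ℕ) (n : ℤ) : L2 d (2 * Real.pi) →ₗ[ℝ] WithLp 2 (E d × E d) where
  toFun F := WithLp.toLp 2
    (∫ t, Real.cos (n * t) • F t ∂(leb (2 * Real.pi)),
      ∫ t, Real.sin (n * t) • F t ∂(leb (2 * Real.pi)))
  map_add' F G := by
    have key : ∀ φ : ℝ → ℝ, Continuous φ → (∀ t, ‖φ t‖ ≤ 1) →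
        ∫ t, φ t • (F + G : L2 d (2 * Real.pi)) t ∂(leb (2 * Real.pi))
          = (∫ t, φ t • F t ∂(leb (2 * Real.pi))) + ∫ t, φ t • G t ∂(leb (2 * Real.pi)) := by
      intro φ hφ hb
      have hi : ∀ K : L2 d (2 * Real.pi), Integrable (fun t => φ t • K t) (leb (2 * Real.pi)) :=
        fun K => (integrable_L2 K).bdd_smul 1 hφ.aestronglyMeasurable (ae_of_all _ hb)
      rw [← integral_add (hi F) (hi G)]
      refine integral_congr_ae ?_
      filter_upwards [Lp.coeFn_add F G] with t ht
      rw [ht, Pi.add_apply, smul_add]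
    rw [key (fun t => Real.cos (n * t)) (by fun_prop) (fun t => Real.abs_cos_le_one _),
      key (fun t => Real.sin (n * t)) (by fun_prop) (fun t => Real.abs_sin_le_one _)]
    rfl
  map_smul' c F := by
    have key : ∀ φ : ℝ → ℝ,
        ∫ t, φ t • (c • F : L2 d (2 * Real.pi)) t ∂(leb (2 * Real.pi))
          = c • ∫ t, φ t • F t ∂(leb (2 * Real.pi)) := by
      intro φ
      rw [← integral_smul]
      refine integral_congr_ae ?_
      filter_upwards [Lp.coeFn_smul c F] with t ht
      rw [ht, Pi.smul_apply, smul_comm]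
    rw [key (fun t => Real.cos (n * t)), key (fun t => Real.sin (n * t))]
    rfl

/-- The weighted coefficients `(2π)^{-1/2} (1 + n²)^{s/2} F̂(n)`, `n ∈ ℤ`. -/
def weightedCoeff (d : ℕ) (s : ℝ) :
    L2 d (2 * Real.pi) →ₗ[ℝ] PreLp (fun _ : ℤ => WithLp 2 (E d × E d)) where
  toFun F := fun n => ((1 + (n : ℝ) ^ 2) ^ (s / 2) / √(2 * Real.pi)) • trigCoeff d n F
  map_add' F G := by
    funext n
    change _ = ((1 + (n : ℝ) ^ 2) ^ (s / 2) / √(2 * Real.pi)) • trigCoeff d n F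
      + ((1 + (n : ℝ) ^ 2) ^ (s / 2) / √(2 * Real.pi)) • trigCoeff d n G
    rw [map_add, smul_add]
  map_smul' c F := by
    funext n
    change _ = c • ((1 + (n : ℝ) ^ 2) ^ (s / 2) / √(2 * Real.pi)) • trigCoeff d n F
    rw [map_smul, smul_comm]

def perSubmodule (d : ℕ) (s : ℝ) : Submodule ℝ (L2 d (2 * Real.pi)) :=
  (lpSubmodule ℝ (fun _ : ℤ => WithLp 2 (E d × E d)) 2).comap (weightedCoeff d s)

/-- The `2π`-periodic Sobolev space of order `s ≥ 0`, that is, the domain of `(1 - Δ)^{s/2}` for the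
periodic Laplacian on `[0, 2π]`, with the norm
`((2π)⁻¹ ∑_{n ∈ ℤ} (1 + n²)^s ‖F̂(n)‖²)^{1/2}`. -/
def PerSobolev (d : ℕ) (s : ℝ) : Type := ↥(perSubmodule d s)

/-- Restriction of functions from `[0, 2π]` to `[0, π]`. -/
def restr (d : ℕ) : L2 d (2 * Real.pi) →ₗ[ℝ] L2 d Real.pi :=
  have hle : leb Real.pi ≤ leb (2 * Real.pi) :=
    Measure.restrict_mono (Icc_subset_Icc le_rfl (by linarith [Real.pi_pos])) le_rfl
  { toFun := fun F => ((Lp.memLp F).mono_measure hle).toLp F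
    map_add' := fun F G => by
      ext1
      filter_upwards [((Lp.memLp (F + G)).mono_measure hle).coeFn_toLp,
        ((Lp.memLp F).mono_measure hle).coeFn_toLp, ((Lp.memLp G).mono_measure hle).coeFn_toLp,
        Lp.coeFn_add (((Lp.memLp F).mono_measure hle).toLp F)
          (((Lp.memLp G).mono_measure hle).toLp G),
        ae_mono hle (Lp.coeFn_add F G)] with t a b c e f
      rw [a, e, f, Pi.add_apply, Pi.add_apply, b, c]
    map_smul' := fun k F => by
      ext1
      filter_upwards [((Lp.memLp (k • F)).mono_measure hle).coeFn_toLp,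
        ((Lp.memLp F).mono_measure hle).coeFn_toLp,
        Lp.coeFn_smul k (((Lp.memLp F).mono_measure hle).toLp F),
        ae_mono hle (Lp.coeFn_smul k F)] with t a b e f
      rw [a, RingHom.id_apply, e, f, Pi.smul_apply, Pi.smul_apply, b] }

namespace PerSobolev

variable {d : ℕ} {s : ℝ}

instance : AddCommGroup (PerSobolev d s) := inferInstanceAs (AddCommGroup ↥(perSubmodule d s))

instance : Module ℝ (PerSobolev d s) := inferInstanceAs (Module ℝ ↥(perSubmodule d s))

def coeffs : PerSobolev d s →ₗ[ℝ] lp (fun _ : ℤ => WithLp 2 (E d × E d)) 2 where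
  toFun x := ⟨weightedCoeff d s x.1, x.2⟩
  map_add' x y := Subtype.ext ((weightedCoeff d s).map_add x.1 y.1)
  map_smul' c x := Subtype.ext ((weightedCoeff d s).map_smul c x.1)

instance : SeminormedAddCommGroup (PerSobolev d s) :=
  SeminormedAddCommGroup.induced _ _ (coeffs (d := d) (s := s))

instance : NormedSpace ℝ (PerSobolev d s) :=
  NormedSpace.induced ℝ _ _ (coeffs (d := d) (s := s))

/-- The restriction map `r` from the periodic Sobolev space to `L²([0, π], ℝ^d)`. -/
def r (d : ℕ) (s : ℝ) : PerSobolev d s →ₗ[ℝ] L2 d Real.pi :=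
  restr d ∘ₗ (perSubmodule d s).subtype

end PerSobolev

/-- The Sobolev space `H^s([0, π], ℝ^d)`, `s ≥ 0`: the restrictions to `[0, π]` of elements of the
periodic Sobolev space of order `s` on `[0, 2π]`, with the quotient norm (the infimum of the norms
of all extensions). -/
def Sobolev (d : ℕ) (s : ℝ) : Type := ↥(LinearMap.range (PerSobolev.r d s))

namespace Sobolev

variable {d : ℕ} {s : ℝ}

instance : AddCommGroup (Sobolev d s) :=
  inferInstanceAs (AddCommGroup ↥(LinearMap.range (PerSobolev.r d s)))

instance : Module ℝ (Sobolev d s) :=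
  inferInstanceAs (Module ℝ ↥(LinearMap.range (PerSobolev.r d s)))

/-- The identification of `H^s([0, π])` with the quotient of the periodic space by the kernel of
the restriction map. -/
def toQuotient : Sobolev d s ≃ₗ[ℝ] PerSobolev d s ⧸ LinearMap.ker (PerSobolev.r d s) :=
  (LinearMap.quotKerEquivRange (PerSobolev.r d s)).symm

instance : SeminormedAddCommGroup (Sobolev d s) :=
  SeminormedAddCommGroup.induced _ _ (toQuotient (d := d) (s := s))

instance : NormedSpace ℝ (Sobolev d s) :=
  NormedSpace.induced ℝ _ _ (toQuotient (d := d) (s := s)).toLinearMap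

/-- The element of `L²([0, π], ℝ^d)`. -/
def toL2 (f : Sobolev d s) : L2 d Real.pi := f.1

lemma toL2_zero : toL2 (0 : Sobolev d s) = 0 := rfl

lemma toL2_add (f g : Sobolev d s) : toL2 (f + g) = toL2 f + toL2 g := rfl

lemma toL2_smul (c : ℝ) (f : Sobolev d s) : toL2 (c • f) = c • toL2 f := rfl

end Sobolev

/-- `H^s ∩ C₀`: the elements of `H^s([0, π], ℝ^d)` with a representative that is continuous on
`[0, π]` and vanishes at `0` and `π`. -/
def sobolevC0 (d : ℕ) (s : ℝ) : Submodule ℝ (Sobolev d s) where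
  carrier := {f | ∃ u : ℝ → E d, ContinuousOn u (Icc 0 Real.pi) ∧ u 0 = 0 ∧ u Real.pi = 0 ∧
    f.toL2 =ᵐ[leb Real.pi] u}
  zero_mem' := ⟨0, continuousOn_const, rfl, rfl, by
    rw [Sobolev.toL2_zero]
    exact Lp.coeFn_zero (E d) 2 (leb Real.pi)⟩
  add_mem' {f g} hf hg := by
    obtain ⟨u, hu, h0, h1, h⟩ := hf
    obtain ⟨v, hv, k0, k1, k⟩ := hg
    refine ⟨u + v, hu.add hv, by simp [h0, k0], by simp [h1, k1], ?_⟩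
    rw [Sobolev.toL2_add]
    filter_upwards [Lp.coeFn_add f.toL2 g.toL2, h, k] with t a b c
    rw [a, Pi.add_apply, Pi.add_apply, b, c]
  smul_mem' c f hf := by
    obtain ⟨u, hu, h0, h1, h⟩ := hf
    refine ⟨c • u, hu.const_smul c, by simp [h0], by simp [h1], ?_⟩
    rw [Sobolev.toL2_smul]
    filter_upwards [Lp.coeFn_smul c f.toL2, h] with t a b
    rw [a, Pi.smul_apply, Pi.smul_apply, b]

/-- The Sobolev space `H^s([0, π], ℝ^d)` of distributions of order `s < 0`: the dual space of
`H^{-s}([0, π], ℝ^d)`. -/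
abbrev SobolevNeg (d : ℕ) (s : ℝ) : Type := StrongDual ℝ (Sobolev d (-s))

/-- The distribution `φ` is the function `y ∈ L²`, that is, `φ f = ∫ ⟨y, f⟩ dt`. -/
def SobolevNeg.IsFunction {d : ℕ} {s : ℝ} (φ : SobolevNeg d s) (y : L2 d Real.pi) : Prop :=
  ∀ f : Sobolev d (-s), φ f = inner ℝ y f.toL2

/-- The linear combinations `v δ_0 + w δ_π`, `v, w ∈ ℝ^d`, as distributions in `H^s([0, π], ℝ^d)`,
`s < -1/2`. -/
def diracs (d : ℕ) (s : ℝ) : Submodule ℝ (SobolevNeg d s) where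
  carrier := {φ | ∃ v w : E d, ∀ (f : Sobolev d (-s)) (u : ℝ → E d),
    ContinuousOn u (Icc 0 Real.pi) → f.toL2 =ᵐ[leb Real.pi] u →
      φ f = inner ℝ v (u 0) + inner ℝ w (u Real.pi)}
  zero_mem' := ⟨0, 0, fun f u _ _ => by simp⟩
  add_mem' {φ ψ} hφ hψ := by
    obtain ⟨v, w, h⟩ := hφ
    obtain ⟨v', w', h'⟩ := hψ
    refine ⟨v + v', w + w', fun f u hu hf => ?_⟩
    rw [add_apply, h f u hu hf, h' f u hu hf, inner_add_left, inner_add_left]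
    ring
  smul_mem' c φ hφ := by
    obtain ⟨v, w, h⟩ := hφ
    refine ⟨c • v, c • w, fun f u hu hf => ?_⟩
    rw [smul_apply, h f u hu hf, real_inner_smul_left, real_inner_smul_left,
      smul_eq_mul]
    ring

end Interp

end

noncomputable section

namespace Interp

/-! Everything is measured by weighted sine coefficients: each space in the theorem turns out to be
the space of sequences `x_n` with `∑ (n+1)^(8α) ‖x_n‖² < ∞`, where `x_n` are the coefficients of `x`
in the sine basis of `L²([0, π])`.

Operator side. Let `K` be the inverse of the Dirichlet Laplacian and `z = -u''` for `u` in the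
domain. Integration by parts against the two affine functions that equal `1` at one end and `0` at
the other turns `u'(0)` and `-u'(π)` into bounded functionals of `z`. With the boundary conditions
this gives `(-L̄)⁻¹ = K Q⁻¹ K`, where `Q = 1 + γ² K + m⁻¹ (A A* + B B*)` is bounded with `Q ≥ 1`
(`isLbar_iff`). Hence the forms of `(-L̄)⁻¹` and `K²` are comparable. The Heinz inequality
(`energy_rpow_le`) carries this over to powers `θ ∈ [0, 1]`, and duality (`energy_inv_le`) to their
inverses, so that `‖(-L̄)^α x‖` is equivalent to the sine norm of order `4α` for `|α| ≤ 1/2`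
(`powEnergy_equiv`). The bound `1/2` is where the form domain, and not the operator domain, is
reached; beyond it the two boundary conditions on `u''` would be felt.

Sobolev side. A periodic extension splits into an even and an odd part, so a Sobolev function is a
cosine series plus a sine series of the same order `s`, and odd extension shows that sine series of
order `s` are Sobolev functions. What remains is to rewrite cosine series as sine series. The
conversion matrix, with entries of size `n / |n² - k²|`, is isometric on `ℓ²`; the version weighted
by `(n/k)^σ` differs from it by a kernel dominated by a homogeneous one of degree `-1`, which the
Schur test bounds for `-3/2 < σ < 1/2` (`exists_weighted_sinCos`). For `s < 1/2` one takes `σ = s`.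
For `1/2 < s ≤ 2` the vanishing of the boundary values gives a linear relation that multiplies the
matrix by `(k/n)²`, so `σ = s - 2` is admissible. This is why the boundary values matter exactly
above `s = 1/2`.

Negative orders follow by duality in the sequence space. Above order `1/2`, a bounded projection of
the Sobolev space onto its functions vanishing at the boundary identifies the dual of the latter
with distributions modulo the two Dirac masses (`SobolevNeg.exists_quotient_equiv`). -/

lemma hasSum_norm_sq {ι : Type*} {G : ι → Type*} [∀ i, NormedAddCommGroup (G i)]
    (x : lp G 2) : HasSum (fun i => ‖x i‖ ^ 2) (‖x‖ ^ 2) := by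
  have := lp.hasSum_norm (by norm_num : 0 < (2 : ℝ≥0∞).toReal) x
  simpa using this

lemma tsum_ofReal_norm_sq {ι : Type*} {G : ι → Type*} [∀ i, NormedAddCommGroup (G i)]
    (x : lp G 2) :
    ∑' i, ENNReal.ofReal (‖x i‖ ^ 2) = ENNReal.ofReal (‖x‖ ^ 2) := by
  rw [← (hasSum_norm_sq x).tsum_eq, ENNReal.ofReal_tsum_of_nonneg (fun i => by positivity)
    (hasSum_norm_sq x).summable]

/-! ### Quadratic forms of diagonal operators: Heinz inequality and inversion. -/

section Energy

variable {ι κ : Type*} {G : ι → Type*} {G' : κ → Type*}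
  [∀ i, NormedAddCommGroup (G i)] [∀ i, InnerProductSpace ℝ (G i)]
  [∀ i, NormedAddCommGroup (G' i)] [∀ i, InnerProductSpace ℝ (G' i)]
  {H : Type*} [NormedAddCommGroup H] [InnerProductSpace ℝ H]

lemma memℓp_two_smul {w : ι → ℝ} {C : ℝ} (hw : ∀ i, |w i| ≤ C) (x : lp G 2) :
    Memℓp (fun i => w i • x i) 2 := by
  have hx := (memℓp_gen_iff (by norm_num : 0 < (2 : ℝ≥0∞).toReal)).1 (lp.memℓp x)
  refine memℓp_gen ?_
  refine Summable.of_nonneg_of_le (fun i => by positivity) (fun i => ?_) (hx.mul_left (C ^ 2))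
  simp only [ENNReal.toReal_ofNat, Real.rpow_ofNat, norm_smul, mul_pow, Real.norm_eq_abs]
  gcongr
  exact hw i

/-- Multiplication by a bounded sequence of scalars. -/
def diag (G : ι → Type*) [∀ i, NormedAddCommGroup (G i)] [∀ i, InnerProductSpace ℝ (G i)]
    (w : ι → ℝ) (C : ℝ) (hw : ∀ i, |w i| ≤ C) : lp G 2 →L[ℝ] lp G 2 :=
  LinearMap.mkContinuous
    { toFun := fun x => ⟨fun i => w i • x i, memℓp_two_smul hw x⟩
      map_add' := fun x y => by
        ext i
        change w i • (x i + y i) = w i • x i + w i • y i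
        rw [smul_add]
      map_smul' := fun c x => by
        ext i
        change w i • (c • x i) = c • w i • x i
        rw [smul_comm] } |C| (fun x => by
    refine (sq_le_sq₀ (norm_nonneg _) (by positivity)).1 ?_
    have h1 := hasSum_norm_sq (G := G) ⟨fun i => w i • x i, memℓp_two_smul hw x⟩
    have h2 := (hasSum_norm_sq x).mul_left (C ^ 2)
    rw [mul_pow, sq_abs]
    refine hasSum_le (fun i => ?_) h1 h2
    simp only [norm_smul, mul_pow, Real.norm_eq_abs]
    gcongr
    exact hw i)

@[simp] lemma diag_apply {w : ι → ℝ} {C : ℝ} (hw : ∀ i, |w i| ≤ C) (x : lp G 2) (i : ι) :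
    diag G w C hw x i = w i • x i := rfl

/-- The quadratic form `∑ w_i ‖x_i‖²` in the coordinates given by `U`. -/
def energy (U : H ≃ₗᵢ[ℝ] lp G 2) (w : ι → ℝ) (x : H) : ℝ≥0∞ :=
  ∑' i, ENNReal.ofReal (w i * ‖U x i‖ ^ 2)

lemma energy_one (U : H ≃ₗᵢ[ℝ] lp G 2) (x : H) :
    energy U (fun _ => 1) x = ENNReal.ofReal (‖x‖ ^ 2) := by
  rw [energy, ← U.norm_map x, ← tsum_ofReal_norm_sq]
  simp

/-- For fixed `a`, the minimum of the right side over `b` is the left side, attained at `b = t / (t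
+ u) • a`. Resolvent-type weights `u / (t + u)` thus have a variational description, which makes
them monotone under form inequalities. -/
lemma ratio_le_split {u t : ℝ} (hu : 0 ≤ u) (ht : 0 < t) {W : Type*} [NormedAddCommGroup W]
    (a b : W) : u / (t + u) * ‖a‖ ^ 2 ≤ ‖a - b‖ ^ 2 + t⁻¹ * (u * ‖b‖ ^ 2) := by
  have h1 : ‖a‖ ≤ ‖a - b‖ + ‖b‖ := by simpa using norm_add_le (a - b) b
  have h2 : ‖a‖ ^ 2 ≤ (‖a - b‖ + ‖b‖) ^ 2 := by gcongr
  have h3 : u / (t + u) * ‖a‖ ^ 2 ≤ u / (t + u) * (‖a - b‖ + ‖b‖) ^ 2 := by gcongr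
  refine h3.trans ?_
  set p := ‖a - b‖
  set q := ‖b‖
  rw [div_mul_eq_mul_div, div_le_iff₀ (by positivity)]
  have : (p ^ 2 + t⁻¹ * (u * q ^ 2)) * (t + u) - u * (p + q) ^ 2 = t⁻¹ * (t * p - u * q) ^ 2 := by
    field_simp
    ring
  have h4 : 0 ≤ t⁻¹ * (t * p - u * q) ^ 2 := by positivity
  linarith

lemma tsum_split_eq (U : H ≃ₗᵢ[ℝ] lp G 2) {u : ι → ℝ} (hu : ∀ i, 0 ≤ u i) {t : ℝ} (ht : 0 < t)
    (x z : H) :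
    ∑' i, ENNReal.ofReal (‖U x i - U z i‖ ^ 2 + t⁻¹ * (u i * ‖U z i‖ ^ 2))
      = ENNReal.ofReal (‖x - z‖ ^ 2) + ENNReal.ofReal t⁻¹ * energy U u z := by
  rw [← energy_one U, energy, energy, ← ENNReal.tsum_mul_left, ← ENNReal.tsum_add]
  refine tsum_congr fun i => ?_
  have := hu i
  rw [ENNReal.ofReal_add (by positivity) (by positivity), ENNReal.ofReal_mul (by positivity),
    map_sub, one_mul]
  rfl

/-- The vector `z` that is optimal for `U` is only a competitor for `V`: the form inequality at `z`
bounds the minimum for `V` by `C` times the minimum for `U`. The hypothesis `1 ≤ C` absorbs the term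
`‖x - z‖²`. -/
lemma energy_resolvent_le (U : H ≃ₗᵢ[ℝ] lp G 2) (V : H ≃ₗᵢ[ℝ] lp G' 2) {u : ι → ℝ} {v : κ → ℝ}
    (hu : ∀ i, 0 ≤ u i) (hv : ∀ i, 0 ≤ v i) {C : ℝ} (hC : 1 ≤ C)
    (h : ∀ z, energy V v z ≤ ENNReal.ofReal C * energy U u z) {t : ℝ} (ht : 0 < t) (x : H) :
    energy V (fun i => v i / (t + v i)) x
      ≤ ENNReal.ofReal C * energy U (fun i => u i / (t + u i)) x := by
  have hw : ∀ i, |t / (t + u i)| ≤ 1 := fun i => by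
    have := hu i
    rw [abs_of_nonneg (by positivity), div_le_one (by positivity)]
    linarith
  set z : H := U.symm (diag G (fun i => t / (t + u i)) 1 hw (U x)) with hz
  have hUz : ∀ i, U z i = (t / (t + u i)) • U x i := fun i => by
    rw [hz, U.apply_symm_apply, diag_apply]
  calc energy V (fun i => v i / (t + v i)) x
      ≤ ∑' i, ENNReal.ofReal (‖V x i - V z i‖ ^ 2 + t⁻¹ * (v i * ‖V z i‖ ^ 2)) :=
        ENNReal.tsum_le_tsum fun i => ENNReal.ofReal_le_ofReal (ratio_le_split (hv i) ht _ _)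
    _ = ENNReal.ofReal (‖x - z‖ ^ 2) + ENNReal.ofReal t⁻¹ * energy V v z :=
      tsum_split_eq V hv ht x z
    _ ≤ ENNReal.ofReal C * ENNReal.ofReal (‖x - z‖ ^ 2)
          + ENNReal.ofReal t⁻¹ * (ENNReal.ofReal C * energy U u z) := by
        gcongr
        · exact le_mul_of_one_le_left zero_le (by simpa using ENNReal.ofReal_le_ofReal hC)
        · exact h z
    _ = ENNReal.ofReal C * (ENNReal.ofReal (‖x - z‖ ^ 2) + ENNReal.ofReal t⁻¹ * energy U u z) := by
        ring
    _ = ENNReal.ofReal C * energy U (fun i => u i / (t + u i)) x := by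
        rw [← tsum_split_eq U hu ht, energy]
        congr 1
        refine tsum_congr fun i => ?_
        have := hu i
        have h1 : U x i - U z i = (u i / (t + u i)) • U x i := by
          rw [hUz]
          nth_rewrite 1 [← one_smul ℝ (U x i)]
          rw [← sub_smul]
          congr 1
          field_simp
          ring
        rw [h1, hUz, norm_smul, norm_smul, Real.norm_of_nonneg (by positivity),
          Real.norm_of_nonneg (by positivity)]
        congr 1
        field_simp
        ring

/-- The integral representation of `a ^ θ` as a superposition of the weights `a / (t + a)`, which
reduces fractional powers to `energy_resolvent_le`. -/
lemma lintegral_rpowIntegrand {θ : ℝ} (hθ : θ ∈ Ioo 0 1) {a b : ℝ} (ha : 0 ≤ a) (hb : 0 ≤ b) :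
    ∫⁻ t in Ioi (0 : ℝ), ENNReal.ofReal (t ^ (θ - 1)) * ENNReal.ofReal (a / (t + a) * b)
      = ENNReal.ofReal (∫ t in Ioi 0, Real.rpowIntegrand₀₁ θ t 1)
        * ENNReal.ofReal (a ^ θ * b) := by
  have hc := Real.integral_rpowIntegrand₀₁_one_pos hθ
  have e : ∀ t ∈ Ioi (0 : ℝ), ENNReal.ofReal (t ^ (θ - 1)) * ENNReal.ofReal (a / (t + a) * b)
      = ENNReal.ofReal (Real.rpowIntegrand₀₁ θ t a * b) := fun t ht => by
    have ht' : 0 < t := ht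
    rw [← ENNReal.ofReal_mul (by positivity), Real.rpowIntegrand₀₁_eq_pow_div hθ ht'.le ha]
    congr 1
    ring
  rw [setLIntegral_congr_fun measurableSet_Ioi e, ← ofReal_integral_eq_lintegral_ofReal
    ((Real.integrableOn_rpowIntegrand₀₁_Ioi hθ ha).mul_const b), integral_mul_const,
    ← ENNReal.ofReal_mul hc.le, Real.rpow_eq_const_mul_integral hθ ha]
  · congr 1
    field_simp
  · filter_upwards [ae_restrict_mem measurableSet_Ioi] with t ht
    exact mul_nonneg (Real.rpowIntegrand₀₁_nonneg hθ.1 (le_of_lt ht) ha) hb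

/-- A form inequality between positive diagonalisable operators passes to fractional powers. -/
theorem energy_rpow_le (U : H ≃ₗᵢ[ℝ] lp G 2) (V : H ≃ₗᵢ[ℝ] lp G' 2) {u : ι → ℝ} {v : κ → ℝ}
    (hu : ∀ i, 0 ≤ u i) (hv : ∀ i, 0 ≤ v i) {C : ℝ} (hC : 1 ≤ C)
    (h : ∀ z, energy V v z ≤ ENNReal.ofReal C * energy U u z) {θ : ℝ} (hθ : θ ∈ Icc 0 1) (x : H) :
    energy V (fun i => v i ^ θ) x ≤ ENNReal.ofReal C * energy U (fun i => u i ^ θ) x := by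
  rcases hθ.1.eq_or_lt with rfl | h0
  · simp only [Real.rpow_zero, energy_one]
    exact le_mul_of_one_le_left zero_le (by simpa using ENNReal.ofReal_le_ofReal hC)
  rcases hθ.2.eq_or_lt with rfl | h1
  · simpa using h x
  have hθ' : θ ∈ Ioo 0 1 := ⟨h0, h1⟩
  have hmeas : ∀ a b : ℝ, Measurable fun t : ℝ =>
      ENNReal.ofReal (t ^ (θ - 1)) * ENNReal.ofReal (a / (t + a) * b) := fun a b => by fun_prop
  set c := ENNReal.ofReal (∫ t in Ioi 0, Real.rpowIntegrand₀₁ θ t 1) with hc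
  have hc0 : c ≠ 0 := by
    simpa [hc] using Real.integral_rpowIntegrand₀₁_one_pos hθ'
  -- The index set may be uncountable, so sum and integral are not exchanged here; bounding finite
  -- partial sums is enough for this direction.
  have hle : c * energy V (fun i => v i ^ θ) x
      ≤ ∫⁻ t in Ioi (0 : ℝ), ENNReal.ofReal (t ^ (θ - 1))
        * energy V (fun i => v i / (t + v i)) x := by
    rw [energy, ← ENNReal.tsum_mul_left, ENNReal.tsum_eq_iSup_sum]
    refine iSup_le fun F => ?_
    rw [Finset.sum_congr rfl fun i _ =>
      (lintegral_rpowIntegrand hθ' (hv i) (sq_nonneg ‖V x i‖)).symm,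
      ← lintegral_finsetSum _ fun i _ => hmeas _ _]
    refine lintegral_mono fun t => ?_
    rw [← Finset.mul_sum]
    gcongr
    exact ENNReal.sum_le_tsum F
  -- Here a genuine exchange of sum and integral is needed. It is legitimate because only countably
  -- many coordinates of `x` are nonzero.
  have hsupp : (Function.support fun i => ‖U x i‖ ^ 2).Countable :=
    (hasSum_norm_sq (U x)).summable.countable_support
  have hge : ∫⁻ t in Ioi (0 : ℝ), ENNReal.ofReal (t ^ (θ - 1))
        * energy U (fun i => u i / (t + u i)) x = c * energy U (fun i => u i ^ θ) x := by
    set S := Function.support fun i => ‖U x i‖ ^ 2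
    have hS : ∀ w : ι → ℝ, energy U w x = ∑' i : S, ENNReal.ofReal (w i * ‖U x i‖ ^ 2) := by
      intro w
      refine (tsum_subtype_eq_of_support_subset (f := fun i => ENNReal.ofReal (w i * ‖U x i‖ ^ 2))
        fun i hi => ?_).symm
      intro h0
      simp only [Function.mem_support] at hi
      rw [show ‖U x i‖ ^ 2 = 0 from h0] at hi
      simp at hi
    have : Countable S := hsupp.to_subtype
    simp only [hS, ← ENNReal.tsum_mul_left]
    rw [lintegral_tsum fun i => (hmeas _ _).aemeasurable]
    exact tsum_congr fun i => lintegral_rpowIntegrand hθ' (hu i) (sq_nonneg _)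
  have hfin : c * energy V (fun i => v i ^ θ) x
      ≤ c * (ENNReal.ofReal C * energy U (fun i => u i ^ θ) x) := by
    refine hle.trans ?_
    rw [mul_left_comm, ← hge, ← lintegral_const_mul' _ _ ENNReal.ofReal_ne_top]
    refine setLIntegral_mono' measurableSet_Ioi fun t ht => ?_
    rw [mul_left_comm]
    gcongr
    exact energy_resolvent_le U V hu hv hC h ht x
  exact (ENNReal.mul_le_mul_iff_right hc0 ENNReal.ofReal_ne_top).1 hfin

lemma energy_ne_top {U : H ≃ₗᵢ[ℝ] lp G 2} {w : ι → ℝ} (hw : ∀ i, 0 ≤ w i) {x : H}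
    (h : energy U w x ≠ ⊤) : Summable (fun i => w i * ‖U x i‖ ^ 2) ∧
      energy U w x = ENNReal.ofReal (∑' i, w i * ‖U x i‖ ^ 2) := by
  have hs : Summable (fun i => w i * ‖U x i‖ ^ 2) := by
    have := ENNReal.summable_toReal h
    refine this.congr fun i => ENNReal.toReal_ofReal ?_
    have := hw i
    positivity
  refine ⟨hs, (ENNReal.ofReal_tsum_of_nonneg (fun i => ?_) hs).symm⟩
  have := hw i
  positivity

/-- Form inequalities are reversed when the weights are inverted. -/
theorem energy_inv_le (U : H ≃ₗᵢ[ℝ] lp G 2) (V : H ≃ₗᵢ[ℝ] lp G' 2) {u : ι → ℝ} {v : κ → ℝ}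
    (hu : ∀ i, 0 < u i) (hv : ∀ i, 0 < v i) {C : ℝ} (hC : 0 < C)
    (h : ∀ z, energy U u z ≤ ENNReal.ofReal C * energy V v z) (x : H) :
    energy V (fun i => (v i)⁻¹) x ≤ ENNReal.ofReal C * energy U (fun i => (u i)⁻¹) x := by
  classical
  rcases eq_or_ne (ENNReal.ofReal C * energy U (fun i => (u i)⁻¹) x) ⊤ with htop | htop
  · rw [htop]
    exact le_top
  rw [energy, ENNReal.tsum_eq_iSup_sum]
  refine iSup_le fun F => ?_
  set S : ℝ := ∑ i ∈ F, (v i)⁻¹ * ‖V x i‖ ^ 2 with hS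
  have hS0 : 0 ≤ S := Finset.sum_nonneg fun i _ => by have := hv i; positivity
  -- The truncation of `V⁻¹ (v⁻¹ V x)` to `F`. Its energy with weights `v` and its inner product
  -- with `x` are both equal to `S`.
  set w : H := ∑ i ∈ F, V.symm (lp.single 2 i ((v i)⁻¹ • V x i)) with hw
  have hVw : ∀ i, V w i = if i ∈ F then (v i)⁻¹ • V x i else 0 := fun i => by
    rw [hw, map_sum]
    simp only [LinearIsometryEquiv.apply_symm_apply]
    rw [lp.coeFn_sum, Finset.sum_apply]
    simp only [lp.single_apply]
    simp
  have hEw : energy V v w = ENNReal.ofReal S := by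
    rw [energy, tsum_eq_sum (s := F), hS, ENNReal.ofReal_sum_of_nonneg]
    · refine Finset.sum_congr rfl fun i hi => ?_
      have := hv i
      rw [hVw, if_pos hi, norm_smul, Real.norm_of_nonneg (by positivity)]
      congr 1
      field_simp
    · intro i _
      have := hv i
      positivity
    · intro i hi
      rw [hVw, if_neg hi]
      simp
  have hin : inner ℝ x w = S := by
    rw [hw, inner_sum, hS]
    refine Finset.sum_congr rfl fun i _ => ?_
    rw [← V.inner_map_map, V.apply_symm_apply, lp.inner_single_right, inner_smul_right,
      real_inner_self_eq_norm_sq]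
  have hUw : energy U u w ≠ ⊤ := ne_top_of_le_ne_top
    (by rw [hEw]; exact ENNReal.mul_ne_top ENNReal.ofReal_ne_top ENNReal.ofReal_ne_top) (h w)
  have hUx : energy U (fun i => (u i)⁻¹) x ≠ ⊤ := fun hcon => htop (by
    rw [hcon, ENNReal.mul_top (by simpa using hC)])
  obtain ⟨s1, e1⟩ := energy_ne_top (fun i => (inv_pos.2 (hu i)).le) hUx
  obtain ⟨s2, e2⟩ := energy_ne_top (fun i => (hu i).le) hUw
  -- Weighted arithmetic-geometric mean inequality in the `U` coordinates. The last term is at most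
  -- `S` by the hypothesis applied to `w`, so `2 S ≤ C * (...) + S` and one `S` cancels.
  have hle : 2 * inner ℝ (U x) (U w)
      ≤ C * ∑' i, (u i)⁻¹ * ‖U x i‖ ^ 2 + C⁻¹ * ∑' i, u i * ‖U w i‖ ^ 2 := by
    have t1 : HasSum (fun i => 2 * inner ℝ (U x i) (U w i)) (2 * inner ℝ (U x) (U w)) :=
      HasSum.mul_left 2 (lp.hasSum_inner (𝕜 := ℝ) (U x) (U w))
    have t2 := (s1.hasSum.mul_left C).add (s2.hasSum.mul_left C⁻¹)
    refine hasSum_le (fun i => ?_) t1 t2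
    have h1 := real_inner_le_norm (U x i) (U w i)
    have hui := hu i
    have h2 : C * ((u i)⁻¹ * ‖U x i‖ ^ 2) + C⁻¹ * (u i * ‖U w i‖ ^ 2) - 2 * (‖U x i‖ * ‖U w i‖)
        = C⁻¹ * (u i)⁻¹ * (C * ‖U x i‖ - u i * ‖U w i‖) ^ 2 := by
      field_simp
      ring
    have h3 : 0 ≤ C⁻¹ * (u i)⁻¹ * (C * ‖U x i‖ - u i * ‖U w i‖) ^ 2 := by positivity
    linarith
  rw [U.inner_map_map, hin] at hle
  have hSw : ∑' i, u i * ‖U w i‖ ^ 2 ≤ C * S := by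
    have := h w
    rw [e2, hEw, ← ENNReal.ofReal_mul hC.le] at this
    exact (ENNReal.ofReal_le_ofReal_iff (by positivity)).1 this
  have hSw' : C⁻¹ * ∑' i, u i * ‖U w i‖ ^ 2 ≤ S := by
    rw [inv_mul_le_iff₀ hC]
    exact hSw
  rw [e1, ← ENNReal.ofReal_mul hC.le,
    ← ENNReal.ofReal_sum_of_nonneg fun i _ => by have := hv i; positivity]
  exact ENNReal.ofReal_le_ofReal (by linarith)

end Energy

/-! ### Expansions in complete orthonormal systems on `[0, π]`. -/

lemma integral_leb {F : Type*} [NormedAddCommGroup F] [NormedSpace ℝ F] {ℓ : ℝ} (hℓ : 0 ≤ ℓ)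
    (f : ℝ → F) : ∫ t, f t ∂(leb ℓ) = ∫ t in (0 : ℝ)..ℓ, f t := by
  rw [intervalIntegral.integral_of_le hℓ, integral_Icc_eq_integral_Ioc]

lemma memLp_of_continuous {F : Type*} [NormedAddCommGroup F] {ψ : ℝ → F} (hψ : Continuous ψ)
    (ℓ : ℝ) : MemLp ψ 2 (leb ℓ) := by
  obtain ⟨C, hC⟩ := isCompact_Icc.exists_bound_of_continuousOn (s := Icc 0 ℓ) hψ.continuousOn
  refine MemLp.of_bound hψ.aestronglyMeasurable C ?_
  filter_upwards [ae_restrict_mem measurableSet_Icc] with t ht using hC t ht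

lemma memLp_smul_const {d : ℕ} {ℓ : ℝ} {ψ : ℝ → ℝ} (hψ : MemLp ψ 2 (leb ℓ)) (v : E d) :
    MemLp (fun t => ψ t • v) 2 (leb ℓ) :=
  (ContinuousLinearMap.toSpanSingleton ℝ v).comp_memLp' hψ

/-- The function `t ↦ ψ(t) v` in `L²([0, π], ℝ^d)`, as a function of `v`. -/
def tens (d : ℕ) {ψ : ℝ → ℝ} (hψ : MemLp ψ 2 (leb Real.pi)) : E d →L[ℝ] L2 d Real.pi :=
  LinearMap.toContinuousLinearMap
    { toFun := fun v => (memLp_smul_const hψ v).toLp _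
      map_add' := fun v w => by
        rw [← MemLp.toLp_add]
        congr 1
        ext1 t
        simp
      map_smul' := fun c v => by
        rw [RingHom.id_apply, ← MemLp.toLp_const_smul]
        congr 1
        ext1 t
        simp [smul_comm c] }

lemma coeFn_tens {d : ℕ} {ψ : ℝ → ℝ} (hψ : MemLp ψ 2 (leb Real.pi)) (v : E d) :
    tens d hψ v =ᵐ[leb Real.pi] fun t => ψ t • v :=
  (memLp_smul_const hψ v).coeFn_toLp

lemma integrable_smul {d : ℕ} {ℓ : ℝ} {ψ : ℝ → ℝ} (hψ : MemLp ψ 2 (leb ℓ)) {f : ℝ → E d}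
    (hf : MemLp f 2 (leb ℓ)) : Integrable (fun t => ψ t • f t) (leb ℓ) := by
  have := hf.smul (r := 1) hψ
  exact memLp_one_iff_integrable.1 this

lemma inner_tens {d : ℕ} {ψ : ℝ → ℝ} (hψ : MemLp ψ 2 (leb Real.pi)) (v : E d)
    (x : L2 d Real.pi) :
    inner ℝ (tens d hψ v) x = inner ℝ v (∫ t, ψ t • x t ∂(leb Real.pi)) := by
  rw [L2.inner_def, ← integral_inner (integrable_smul hψ (Lp.memLp x))]
  refine integral_congr_ae ?_
  filter_upwards [coeFn_tens hψ v] with t ht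
  rw [ht, real_inner_smul_left, real_inner_smul_right]

lemma adjoint_tens {d : ℕ} {ψ : ℝ → ℝ} (hψ : MemLp ψ 2 (leb Real.pi)) (x : L2 d Real.pi) :
    (tens d hψ).adjoint x = ∫ t, ψ t • x t ∂(leb Real.pi) := by
  refine ext_inner_left ℝ fun v => ?_
  rw [ContinuousLinearMap.adjoint_inner_right, inner_tens]

lemma integral_smul_tens {d : ℕ} {ψ φ : ℝ → ℝ} (hφ : MemLp φ 2 (leb Real.pi)) (v : E d) :
    ∫ t, ψ t • tens d hφ v t ∂(leb Real.pi) = (∫ t, ψ t * φ t ∂(leb Real.pi)) • v := by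
  rw [← integral_smul_const]
  refine integral_congr_ae ?_
  filter_upwards [coeFn_tens hφ v] with t ht
  rw [ht, smul_smul]

/-- A complete orthonormal system of continuous functions on `[0, π]`, bounded by `1`. -/
structure IsCompleteOrtho (φ : ℕ → ℝ → ℝ) : Prop where
  cont : ∀ n, Continuous (φ n)
  bound : ∀ n t, |φ n t| ≤ 1
  ortho : ∀ n k, ∫ t, φ n t * φ k t ∂(leb Real.pi) = if n = k then 1 else 0
  complete : ∀ {d : ℕ} (f : L2 d Real.pi), (∀ n, ∫ t, φ n t • f t ∂(leb Real.pi) = 0) → f = 0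

namespace IsCompleteOrtho

variable {φ : ℕ → ℝ → ℝ} {d : ℕ}

lemma memLp (h : IsCompleteOrtho φ) (n : ℕ) : MemLp (φ n) 2 (leb Real.pi) :=
  memLp_of_continuous (h.cont n) _

lemma inner_tens_tens (h : IsCompleteOrtho φ) (n k : ℕ) (v w : E d) :
    inner ℝ (tens d (h.memLp n) v) (tens d (h.memLp k) w) = if n = k then inner ℝ v w else 0 := by
  rw [inner_tens, integral_smul_tens, h.ortho]
  split_ifs <;> simp

/-- The isometric embedding of `ℝ^d` onto the `n`-th component. -/
def comp (h : IsCompleteOrtho φ) (d : ℕ) (n : ℕ) : E d →ₗᵢ[ℝ] L2 d Real.pi :=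
  (tens d (h.memLp n)).toLinearMap.isometryOfInner fun v w => by
    simpa using h.inner_tens_tens n n v w

lemma isHilbertSum (h : IsCompleteOrtho φ) (d : ℕ) :
    IsHilbertSum ℝ (fun _ : ℕ => E d) (h.comp d) := by
  refine IsHilbertSum.mk ?_ ?_
  · intro n k hnk v w
    have := h.inner_tens_tens n k v w
    rw [if_neg hnk] at this
    exact this
  · rw [Submodule.topologicalClosure_eq_top_iff.2]
    rw [Submodule.eq_bot_iff]
    intro x hx
    refine h.complete x fun n => ?_
    refine ext_inner_left ℝ fun v => ?_
    rw [← inner_tens (h.memLp n), inner_zero_right]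
    exact (Submodule.mem_orthogonal _ _).1 hx _ (Submodule.mem_iSup_of_mem n ⟨v, rfl⟩)

/-- The expansion of `L²` functions with respect to a complete orthonormal system. -/
def iso (h : IsCompleteOrtho φ) (d : ℕ) : L2 d Real.pi ≃ₗᵢ[ℝ] lp (fun _ : ℕ => E d) 2 :=
  (h.isHilbertSum d).linearIsometryEquiv

lemma iso_symm_single (h : IsCompleteOrtho φ) (n : ℕ) (v : E d) :
    (h.iso d).symm (lp.single 2 n v) = tens d (h.memLp n) v :=
  (h.isHilbertSum d).linearIsometryEquiv_symm_apply_single v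

lemma iso_apply (h : IsCompleteOrtho φ) (x : L2 d Real.pi) (n : ℕ) :
    h.iso d x n = ∫ t, φ n t • x t ∂(leb Real.pi) := by
  refine ext_inner_left ℝ fun v => ?_
  rw [← inner_tens (h.memLp n), ← h.iso_symm_single, ← (h.iso d).inner_map_map,
    LinearIsometryEquiv.apply_symm_apply, lp.inner_single_left]

lemma hasSum_tens (h : IsCompleteOrtho φ) (x : L2 d Real.pi) :
    HasSum (fun n => tens d (h.memLp n) (h.iso d x n)) x := by
  have := (h.isHilbertSum d).hasSum_linearIsometryEquiv_symm (h.iso d x)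
  rwa [show (h.isHilbertSum d).linearIsometryEquiv.symm (h.iso d x) = x from
    (h.iso d).symm_apply_apply x] at this

/-- Integration against `ψ` is the adjoint of the bounded map `tens d hψ`, so it may be applied term
by term to the `L²`-convergent expansion. -/
lemma hasSum_integral_smul (h : IsCompleteOrtho φ) {ψ : ℝ → ℝ} (hψ : MemLp ψ 2 (leb Real.pi))
    (x : L2 d Real.pi) : HasSum (fun n => (∫ t, ψ t * φ n t ∂(leb Real.pi)) • h.iso d x n)
      (∫ t, ψ t • x t ∂(leb Real.pi)) := by
  have := (h.hasSum_tens x).mapL (tens d hψ).adjoint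
  simpa only [adjoint_tens, integral_smul_tens] using this

lemma ext (h : IsCompleteOrtho φ) {x y : L2 d Real.pi} (hxy : ∀ n, h.iso d x n = h.iso d y n) :
    x = y :=
  (h.iso d).injective (lp.ext (funext hxy))

lemma hasSum_norm_sq_iso (h : IsCompleteOrtho φ) (x : L2 d Real.pi) :
    HasSum (fun n => ‖h.iso d x n‖ ^ 2) (‖x‖ ^ 2) := by
  rw [← (h.iso d).norm_map x]
  exact hasSum_norm_sq _

lemma hasSum_inner_iso (h : IsCompleteOrtho φ) (x y : L2 d Real.pi) :
    HasSum (fun n => inner ℝ (h.iso d x n) (h.iso d y n)) (inner ℝ x y) := by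
  rw [← (h.iso d).inner_map_map x]
  exact lp.hasSum_inner (𝕜 := ℝ) _ _

lemma summable_smul (h : IsCompleteOrtho φ) {a : ℕ → E d} (ha : Summable fun n => ‖a n‖) (t : ℝ) :
    Summable fun n => φ n t • a n := by
  refine Summable.of_norm_bounded ha fun n => ?_
  rw [norm_smul]
  exact mul_le_of_le_one_left (norm_nonneg _) (h.bound n t)

lemma continuous_tsum (h : IsCompleteOrtho φ) {a : ℕ → E d} (ha : Summable fun n => ‖a n‖) :
    Continuous fun t => ∑' n, φ n t • a n := by
  refine _root_.continuous_tsum (fun n => (h.cont n).smul continuous_const) ha fun n t => ?_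
  rw [norm_smul]
  exact mul_le_of_le_one_left (norm_nonneg _) (h.bound n t)

/-- An `L²` function with absolutely summable coefficients is represented by the sum of its
series. -/
lemma ae_eq_tsum (h : IsCompleteOrtho φ) {x : L2 d Real.pi} (hx : Summable fun n => ‖h.iso d x n‖) :
    x =ᵐ[leb Real.pi] fun t => ∑' n, φ n t • h.iso d x n := by
  set u : ℝ → E d := fun t => ∑' n, φ n t • h.iso d x n with hu
  have huc : Continuous u := h.continuous_tsum hx
  have hm : MemLp u 2 (leb Real.pi) := memLp_of_continuous huc _
  have : x = hm.toLp u := by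
    refine h.ext fun n => ?_
    rw [h.iso_apply (hm.toLp u)]
    have e1 : ∫ t, φ n t • hm.toLp u t ∂(leb Real.pi) = ∫ t, φ n t • u t ∂(leb Real.pi) := by
      refine integral_congr_ae ?_
      filter_upwards [hm.coeFn_toLp] with t ht
      rw [ht]
    have hb : ∀ k t, ‖φ n t • φ k t • h.iso d x k‖ ≤ ‖h.iso d x k‖ := fun k t => by
      rw [norm_smul, norm_smul, ← mul_assoc]
      refine mul_le_of_le_one_left (norm_nonneg _) ?_
      exact mul_le_one₀ (h.bound n t) (norm_nonneg _) (h.bound k t)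
    have hc : ∀ k, Continuous fun t => φ n t • φ k t • h.iso d x k := fun k =>
      (h.cont n).smul ((h.cont k).smul continuous_const)
    have e2 : HasSum (fun k => ∫ t, φ n t • φ k t • h.iso d x k ∂(leb Real.pi))
        (∫ t, ∑' k, φ n t • φ k t • h.iso d x k ∂(leb Real.pi)) := by
      refine hasSum_integral_of_summable_integral_norm (fun k => ?_) ?_
      · exact (memLp_of_continuous (hc k) _).integrable one_le_two
      · refine Summable.of_nonneg_of_le (fun k => integral_nonneg fun t => norm_nonneg _)
          (fun k => ?_) (hx.mul_left ((leb Real.pi).real univ))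
        refine (integral_mono_of_nonneg (ae_of_all _ fun t => norm_nonneg _)
          (integrable_const ‖h.iso d x k‖) (ae_of_all _ (hb k))).trans ?_
        rw [integral_const, smul_eq_mul]
    have e3 : ∀ t, ∑' k, φ n t • φ k t • h.iso d x k = φ n t • u t := fun t =>
      (h.summable_smul hx t).tsum_const_smul _
    simp only [e3] at e2
    rw [e1, ← e2.tsum_eq, tsum_eq_single n]
    · simp only [smul_smul, integral_smul_const, h.ortho, if_true, one_smul]
    · intro k hk
      simp only [smul_smul, integral_smul_const, h.ortho, if_neg hk.symm, zero_smul]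
  rw [this]
  exact hm.coeFn_toLp

end IsCompleteOrtho

/-! ### The sine and cosine bases. -/

lemma integral_cos_int (j : ℤ) :
    ∫ t in (0 : ℝ)..Real.pi, Real.cos (j * t) = if j = 0 then Real.pi else 0 := by
  split_ifs with h
  · simp [h]
  · have hj : (j : ℝ) ≠ 0 := by exact_mod_cast h
    rw [intervalIntegral.integral_comp_mul_left (fun t => Real.cos t) hj]
    simp [Real.sin_int_mul_pi]

lemma integral_sin_int {j : ℤ} (h : j ≠ 0) :
    ∫ t in (0 : ℝ)..Real.pi, Real.sin (j * t) = (1 - (-1) ^ j) / j := by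
  have hj : (j : ℝ) ≠ 0 := by exact_mod_cast h
  rw [intervalIntegral.integral_comp_mul_left (fun t => Real.sin t) hj]
  simp [Real.cos_int_mul_pi]
  field_simp

lemma integral_cos_mul_cos (n k : ℤ) :
    ∫ t, Real.cos (n * t) * Real.cos (k * t) ∂(leb Real.pi)
      = ((if n - k = 0 then Real.pi else 0) + if n + k = 0 then Real.pi else 0) / 2 := by
  rw [integral_leb Real.pi_pos.le, ← integral_cos_int, ← integral_cos_int,
    ← intervalIntegral.integral_add (by apply Continuous.intervalIntegrable; fun_prop)
      (by apply Continuous.intervalIntegrable; fun_prop), ← intervalIntegral.integral_div]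
  congr 1
  ext t
  push_cast
  rw [sub_mul, add_mul, Real.cos_sub, Real.cos_add]
  ring

lemma integral_sin_mul_sin (n k : ℤ) :
    ∫ t, Real.sin (n * t) * Real.sin (k * t) ∂(leb Real.pi)
      = ((if n - k = 0 then Real.pi else 0) - if n + k = 0 then Real.pi else 0) / 2 := by
  rw [integral_leb Real.pi_pos.le, ← integral_cos_int, ← integral_cos_int,
    ← intervalIntegral.integral_sub (by apply Continuous.intervalIntegrable; fun_prop)
      (by apply Continuous.intervalIntegrable; fun_prop), ← intervalIntegral.integral_div]
  congr 1
  ext t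
  push_cast
  rw [sub_mul, add_mul, Real.cos_sub, Real.cos_add]
  ring

lemma integral_sin_mul_cos {n k : ℤ} (h : n ^ 2 ≠ k ^ 2) :
    ∫ t, Real.sin (n * t) * Real.cos (k * t) ∂(leb Real.pi)
      = n * (1 - (-1) ^ (n + k)) / (n ^ 2 - k ^ 2) := by
  have h1 : n - k ≠ 0 := fun h0 => h (by rw [sub_eq_zero.1 h0])
  have h2 : n + k ≠ 0 := fun h0 => h (by rw [eq_neg_of_add_eq_zero_left h0]; ring)
  have h1' : (n - k : ℝ) ≠ 0 := by exact_mod_cast h1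
  have h2' : (n + k : ℝ) ≠ 0 := by exact_mod_cast h2
  have h3' : (n ^ 2 - k ^ 2 : ℝ) ≠ 0 := by
    rw [sq_sub_sq]
    exact mul_ne_zero h2' h1'
  have e : ((-1 : ℝ)) ^ (n - k) = (-1) ^ (n + k) := by
    rw [show n - k = n + k + -2 * k by ring, zpow_add₀ (by norm_num), zpow_mul]
    norm_num
  have : ∫ t in (0 : ℝ)..Real.pi, Real.sin (n * t) * Real.cos (k * t)
      = ((∫ t in (0 : ℝ)..Real.pi, Real.sin ((n + k : ℤ) * t))
        + ∫ t in (0 : ℝ)..Real.pi, Real.sin ((n - k : ℤ) * t)) / 2 := by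
    rw [← intervalIntegral.integral_add (by apply Continuous.intervalIntegrable; fun_prop)
      (by apply Continuous.intervalIntegrable; fun_prop), ← intervalIntegral.integral_div]
    congr 1
    ext t
    push_cast
    rw [sub_mul, add_mul, Real.sin_sub, Real.sin_add]
    ring
  rw [integral_leb Real.pi_pos.le, this, integral_sin_int h2, integral_sin_int h1, e]
  push_cast
  field_simp
  ring

lemma integral_sin_mul_cos_self (n : ℤ) :
    ∫ t, Real.sin (n * t) * Real.cos (n * t) ∂(leb Real.pi) = 0 := by
  rcases eq_or_ne n 0 with rfl | hn
  · simp
  have : ∫ t in (0 : ℝ)..Real.pi, Real.sin (n * t) * Real.cos (n * t)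
      = (∫ t in (0 : ℝ)..Real.pi, Real.sin ((2 * n : ℤ) * t)) / 2 := by
    rw [← intervalIntegral.integral_div]
    congr 1
    ext t
    push_cast
    rw [mul_assoc, Real.sin_two_mul]
    ring
  rw [integral_leb Real.pi_pos.le, this, integral_sin_int (by omega), zpow_mul]
  norm_num

/-- An integrable function on `[0, π]` all of whose cosine coefficients vanish is zero. -/
lemma ae_eq_zero_of_cos {d : ℕ} {f : ℝ → E d} (hf : Integrable f (leb Real.pi))
    (h : ∀ n : ℤ, ∫ t, Real.cos (n * t) • f t ∂(leb Real.pi) = 0) : f =ᵐ[leb Real.pi] 0 := by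
  have hint : ∀ ψ : ℝ → ℝ, Continuous ψ → Integrable (fun t => ψ t • f t) (leb Real.pi) := by
    intro ψ hψ
    obtain ⟨C, hC⟩ := isCompact_Icc.exists_bound_of_continuousOn (s := Icc 0 Real.pi)
      hψ.continuousOn
    refine hf.bdd_smul C hψ.aestronglyMeasurable ?_
    filter_upwards [ae_restrict_mem measurableSet_Icc] with t ht using hC t ht
  -- The product formula for cosines trades a factor `cos t` for shifts of `n`; this puts all
  -- polynomials in `cos t` within reach.
  have hpow : ∀ (j : ℕ) (n : ℤ),
      ∫ t, (Real.cos t ^ j * Real.cos (n * t)) • f t ∂(leb Real.pi) = 0 := by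
    intro j
    induction j with
    | zero => simpa using h
    | succ j ih =>
      intro n
      have e : ∀ t, (Real.cos t ^ (j + 1) * Real.cos (n * t)) • f t
          = (2⁻¹ : ℝ) • ((Real.cos t ^ j * Real.cos ((n + 1 : ℤ) * t)) • f t
            + (Real.cos t ^ j * Real.cos ((n - 1 : ℤ) * t)) • f t) := fun t => by
        rw [← add_smul, smul_smul]
        congr 1
        push_cast
        rw [sub_mul, add_mul, Real.cos_sub, Real.cos_add]
        ring_nf
      simp only [e]
      rw [integral_smul, integral_add (hint _ (by fun_prop)) (hint _ (by fun_prop)), ih, ih]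
      simp
  have hpoly : ∀ p : Polynomial ℝ, ∫ t, p.eval (Real.cos t) • f t ∂(leb Real.pi) = 0 := by
    intro p
    simp only [Polynomial.eval_eq_sum_range, Finset.sum_smul]
    rw [integral_finsetSum _ fun i _ => hint _ (by fun_prop)]
    refine Finset.sum_eq_zero fun i _ => ?_
    have := hpow i 0
    simp only [Int.cast_zero, zero_mul, Real.cos_zero, mul_one] at this
    simp only [mul_smul]
    rw [integral_smul, this, smul_zero]
  have hcont : ∀ g : ℝ → ℝ, Continuous g → ∫ t, g t • f t ∂(leb Real.pi) = 0 := by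
    intro g hg
    rw [← norm_le_zero_iff]
    refine le_of_forall_pos_le_add fun ε hε => ?_
    set M := ∫ t, ‖f t‖ ∂(leb Real.pi) with hM
    have hM0 : 0 ≤ M := integral_nonneg fun t => norm_nonneg _
    -- Since `cos` is injective on `[0, π]`, every continuous `g` is a continuous function of `cos
    -- t`, and Weierstrass approximation applies.
    obtain ⟨p, hp⟩ := exists_polynomial_near_of_continuousOn (-1) 1 (fun x => g (Real.arccos x))
      (hg.comp Real.continuous_arccos).continuousOn (ε / (M + 1)) (by positivity)
    have e : ∫ t, g t • f t ∂(leb Real.pi)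
        = ∫ t, (g t - p.eval (Real.cos t)) • f t ∂(leb Real.pi) := by
      simp only [sub_smul]
      rw [integral_sub (hint _ hg) (hint _ (by fun_prop)), hpoly, sub_zero]
    rw [e, zero_add]
    calc ‖∫ t, (g t - p.eval (Real.cos t)) • f t ∂(leb Real.pi)‖
        ≤ ∫ t, ε / (M + 1) * ‖f t‖ ∂(leb Real.pi) := by
          refine norm_integral_le_of_norm_le (hf.norm.const_mul _) ?_
          filter_upwards [ae_restrict_mem measurableSet_Icc] with t ht
          have := hp (Real.cos t) ⟨Real.neg_one_le_cos t, Real.cos_le_one t⟩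
          rw [Real.arccos_cos ht.1 ht.2] at this
          rw [norm_smul, Real.norm_eq_abs, abs_sub_comm]
          gcongr
      _ = ε * (M / (M + 1)) := by
          rw [integral_const_mul]
          ring
      _ ≤ ε := mul_le_of_le_one_right hε.le (by rw [div_le_one (by positivity)]; linarith)
  exact ae_eq_zero_of_integral_contDiff_smul_eq_zero hf.locallyIntegrable
    fun g hg _ => hcont g hg.continuous

/-- The normalized sines on `[0, π]`. -/
def sinFun (n : ℕ) (t : ℝ) : ℝ := √(2 / Real.pi) * Real.sin (((n + 1 : ℕ) : ℤ) * t)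

/-- The normalized cosines on `[0, π]`. -/
def cosFun (n : ℕ) (t : ℝ) : ℝ :=
  √((if n = 0 then 1 else 2) / Real.pi) * Real.cos ((n : ℤ) * t)

lemma abs_sqrt_mul_le_one {a b : ℝ} (ha : a ≤ 2) (hb : |b| ≤ 1) :
    |√(a / Real.pi) * b| ≤ 1 := by
  rw [abs_mul, abs_of_nonneg (Real.sqrt_nonneg _)]
  refine mul_le_one₀ ?_ (abs_nonneg b) hb
  rw [Real.sqrt_le_one, div_le_one Real.pi_pos]
  linarith [Real.two_le_pi]

lemma isCompleteOrtho_cosFun : IsCompleteOrtho cosFun where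
  cont n := by unfold cosFun; fun_prop
  bound n t := abs_sqrt_mul_le_one (by split_ifs <;> norm_num) (Real.abs_cos_le_one _)
  ortho n k := by
    have e : ∀ t, cosFun n t * cosFun k t
        = √((if n = 0 then 1 else 2) / Real.pi) * √((if k = 0 then 1 else 2) / Real.pi)
          * (Real.cos ((n : ℤ) * t) * Real.cos ((k : ℤ) * t)) := fun t => by
      unfold cosFun
      ring
    simp only [e]
    rw [integral_const_mul, integral_cos_mul_cos]
    have hpi := Real.pi_pos
    rcases eq_or_ne n k with rfl | hnk
    · rw [Real.mul_self_sqrt (by split_ifs <;> positivity)]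
      rcases eq_or_ne n 0 with rfl | hn
      · simp
      · rw [if_neg hn, if_pos (by simp), if_neg (by omega), if_pos rfl]
        field_simp
        ring
    · rw [if_neg (show ¬ ((n : ℤ) - k = 0) by omega), if_neg (show ¬ ((n : ℤ) + k = 0) by omega),
        if_neg hnk]
      simp
  complete {d} f h := by
    refine Lp.eq_zero_iff_ae_eq_zero.2 (ae_eq_zero_of_cos (integrable_L2 f) fun n => ?_)
    have key : ∀ n : ℕ, ∫ t, Real.cos ((n : ℤ) * t) • f t ∂(leb Real.pi) = 0 := by
      intro n
      have := h n
      simp only [cosFun, mul_smul] at this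
      rw [integral_smul] at this
      refine (smul_eq_zero.1 this).resolve_left ?_
      have := Real.pi_pos
      split_ifs <;> positivity
    obtain ⟨k, rfl | rfl⟩ := n.eq_nat_or_neg
    · exact key k
    · simpa using key k

lemma isCompleteOrtho_sinFun : IsCompleteOrtho sinFun where
  cont n := by unfold sinFun; fun_prop
  bound n t := abs_sqrt_mul_le_one le_rfl (Real.abs_sin_le_one _)
  ortho n k := by
    have e : ∀ t, sinFun n t * sinFun k t
        = 2 / Real.pi * (Real.sin (((n + 1 : ℕ) : ℤ) * t) * Real.sin (((k + 1 : ℕ) : ℤ) * t)) :=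
      fun t => by
      rw [← Real.mul_self_sqrt (show 0 ≤ 2 / Real.pi by have := Real.pi_pos; positivity)]
      unfold sinFun
      ring
    simp only [e]
    rw [integral_const_mul, integral_sin_mul_sin]
    have hpi := Real.pi_pos
    rcases eq_or_ne n k with rfl | hnk
    · rw [if_pos (by simp), if_neg (by omega), if_pos rfl]
      field_simp
      ring
    · rw [if_neg (by omega), if_neg (by omega), if_neg hnk]
      simp
  complete {d} f h := by
    have hs : Integrable (fun t => Real.sin t • f t) (leb Real.pi) :=
      integrable_smul (memLp_of_continuous Real.continuous_sin _) (Lp.memLp f)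
    have hint : ∀ ψ : ℝ → ℝ, Continuous ψ → Integrable (fun t => ψ t • f t) (leb Real.pi) :=
      fun ψ hψ => integrable_smul (memLp_of_continuous hψ _) (Lp.memLp f)
    have key : ∀ n : ℤ, ∫ t, Real.sin (n * t) • f t ∂(leb Real.pi) = 0 := by
      have key1 : ∀ n : ℕ, ∫ t, Real.sin (((n + 1 : ℕ) : ℤ) * t) • f t ∂(leb Real.pi) = 0 := by
        intro n
        have := h n
        simp only [sinFun, mul_smul] at this
        rw [integral_smul] at this
        refine (smul_eq_zero.1 this).resolve_left ?_
        have := Real.pi_pos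
        positivity
      have key2 : ∀ n : ℕ, ∫ t, Real.sin ((n : ℤ) * t) • f t ∂(leb Real.pi) = 0 := by
        rintro (_ | n)
        · simp
        · exact key1 n
      intro n
      obtain ⟨k, rfl | rfl⟩ := n.eq_nat_or_neg
      · exact key2 k
      · have := key2 k
        simp only [Int.cast_neg, neg_mul, Real.sin_neg, neg_smul]
        rw [integral_neg, this, neg_zero]
    -- Completeness of the sines is reduced to that of the cosines: `sin t • f t` has vanishing
    -- cosine coefficients, and `sin` is positive inside the interval.
    have hzero := ae_eq_zero_of_cos hs fun n => by
      have e : ∀ t, Real.cos (n * t) • Real.sin t • f t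
          = (2⁻¹ : ℝ) • (Real.sin ((n + 1 : ℤ) * t) • f t - Real.sin ((n - 1 : ℤ) * t) • f t) :=
        fun t => by
        rw [← sub_smul, smul_smul, smul_smul]
        congr 1
        push_cast
        rw [sub_mul, add_mul, Real.sin_sub, Real.sin_add]
        ring_nf
      simp only [e]
      rw [integral_smul, integral_sub (hint _ (by fun_prop)) (hint _ (by fun_prop)), key, key]
      simp
    refine Lp.eq_zero_iff_ae_eq_zero.2 ?_
    have h0 : ∀ᵐ t ∂(leb Real.pi), t ≠ 0 := ae_restrict_of_ae (Measure.ae_ne volume 0)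
    have h1 : ∀ᵐ t ∂(leb Real.pi), t ≠ Real.pi := ae_restrict_of_ae (Measure.ae_ne volume _)
    filter_upwards [hzero, h0, h1, ae_restrict_mem measurableSet_Icc] with t ht t0 t1 t2
    refine (smul_eq_zero.1 ht).resolve_left (Real.sin_pos_of_pos_of_lt_pi ?_ ?_).ne'
    · exact lt_of_le_of_ne t2.1 (Ne.symm t0)
    · exact lt_of_le_of_ne t2.2 t1

/-- Sine expansion. -/
def sinIso (d : ℕ) : L2 d Real.pi ≃ₗᵢ[ℝ] lp (fun _ : ℕ => E d) 2 := isCompleteOrtho_sinFun.iso d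

/-- Cosine expansion. -/
def cosIso (d : ℕ) : L2 d Real.pi ≃ₗᵢ[ℝ] lp (fun _ : ℕ => E d) 2 := isCompleteOrtho_cosFun.iso d

/-! ### The inverse Dirichlet Laplacian. -/

lemma summable_mul_of_sq {a b : ℕ → ℝ} (ha : Summable fun n => a n ^ 2)
    (hb : Summable fun n => b n ^ 2) (ha0 : ∀ n, 0 ≤ a n) (hb0 : ∀ n, 0 ≤ b n) :
    Summable fun n => a n * b n := by
  refine Summable.of_nonneg_of_le (fun n => mul_nonneg (ha0 n) (hb0 n)) (fun n => ?_) (ha.add hb)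
  nlinarith [sq_nonneg (a n - b n), mul_nonneg (ha0 n) (hb0 n)]

lemma summable_inv_sq : Summable fun n : ℕ => (((n : ℝ) + 1)⁻¹) ^ 2 := by
  have := (summable_nat_add_iff 1).2 (Real.summable_nat_pow_inv.2 (by norm_num : 1 < 2))
  simpa using this

lemma summable_inv_mul {d : ℕ} (x : L2 d Real.pi) :
    Summable fun n : ℕ => ((n : ℝ) + 1)⁻¹ * ‖sinIso d x n‖ :=
  summable_mul_of_sq summable_inv_sq (isCompleteOrtho_sinFun.hasSum_norm_sq_iso x).summable
    (fun n => by positivity) (fun n => norm_nonneg _)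

lemma eqOn_of_hasDerivAt {d : ℕ} {f g f' g' : ℝ → E d} {ℓ : ℝ}
    (hf : ∀ t ∈ Icc 0 ℓ, HasDerivAt f (f' t) t) (hg : ∀ t ∈ Icc 0 ℓ, HasDerivAt g (g' t) t)
    (h : ∀ t ∈ Icc 0 ℓ, f' t = g' t) (h0 : f 0 = g 0) : ∀ t ∈ Icc 0 ℓ, f t = g t := by
  intro t ht
  have := constant_of_has_deriv_right_zero (f := fun t => f t - g t) (a := 0) (b := ℓ)
    (fun s hs => ((hf s hs).continuousAt.sub (hg s hs).continuousAt).continuousWithinAt)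
    (fun s hs => by
      have hs' := Ico_subset_Icc_self hs
      have := ((hf s hs').sub (hg s hs')).hasDerivWithinAt (s := Ici s)
      rwa [h s hs', sub_self] at this) t ht
  simpa [h0, sub_eq_zero] using this

lemma abs_inv_sq_le_one (n : ℕ) : |(((n : ℝ) + 1) ^ 2)⁻¹| ≤ 1 := by
  rw [abs_of_nonneg (by positivity)]
  refine inv_le_one_of_one_le₀ (one_le_pow₀ ?_)
  linarith [n.cast_nonneg (α := ℝ)]

/-- The inverse of the Dirichlet Laplacian `-∂²` on `[0, π]`. -/
def invLap (d : ℕ) : L2 d Real.pi →L[ℝ] L2 d Real.pi :=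
  (sinIso d).symm.toContinuousLinearEquiv.toContinuousLinearMap ∘L
    (diag (fun _ : ℕ => E d) (fun n => (((n : ℝ) + 1) ^ 2)⁻¹) 1 abs_inv_sq_le_one) ∘L
    (sinIso d).toContinuousLinearEquiv.toContinuousLinearMap

lemma sinIso_invLap {d : ℕ} (x : L2 d Real.pi) (n : ℕ) :
    sinIso d (invLap d x) n = (((n : ℝ) + 1) ^ 2)⁻¹ • sinIso d x n := by
  change sinIso d ((sinIso d).symm (diag _ _ _ abs_inv_sq_le_one (sinIso d x))) n = _
  rw [LinearIsometryEquiv.apply_symm_apply, diag_apply]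

lemma invLap_symmetric {d : ℕ} (x y : L2 d Real.pi) :
    inner ℝ (invLap d x) y = inner ℝ x (invLap d y) := by
  refine (isCompleteOrtho_sinFun.hasSum_inner_iso _ _).unique ?_
  convert isCompleteOrtho_sinFun.hasSum_inner_iso x (invLap d y) using 2 with n
  have h1 := sinIso_invLap x n
  have h2 := sinIso_invLap y n
  rw [sinIso] at h1 h2
  rw [h1, h2, real_inner_smul_left, real_inner_smul_right]

lemma inner_invLap_nonneg {d : ℕ} (x : L2 d Real.pi) : 0 ≤ inner ℝ (invLap d x) x := by
  refine (isCompleteOrtho_sinFun.hasSum_inner_iso (invLap d x) x).nonneg fun n => ?_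
  have h1 := sinIso_invLap x n
  rw [sinIso] at h1
  rw [h1, real_inner_smul_left, real_inner_self_eq_norm_sq]
  positivity

/-- Pairing with the indicator of `[0, t]` integrates the sine series term by term, although the
series converges only in `L²`. -/
lemma integral_Icc_L2 {d : ℕ} (w : L2 d Real.pi) {t : ℝ} (ht : t ∈ Icc 0 Real.pi) :
    HasSum (fun n : ℕ => (√(2 / Real.pi) * ((1 - Real.cos (((n : ℝ) + 1) * t)) / ((n : ℝ) + 1)))
      • sinIso d w n) (∫ s in (0 : ℝ)..t, w s) := by
  have hψ : MemLp (indicator (Icc 0 t) fun _ => (1 : ℝ)) 2 (leb Real.pi) :=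
    (memLp_const 1).indicator measurableSet_Icc
  have hsub : Icc 0 t ⊆ Icc 0 Real.pi := Icc_subset_Icc le_rfl ht.2
  have key : ∀ {F : Type} [NormedAddCommGroup F] [NormedSpace ℝ F] (f : ℝ → F),
      ∫ s, (indicator (Icc 0 t) fun _ => (1 : ℝ)) s • f s ∂(leb Real.pi)
        = ∫ s in (0 : ℝ)..t, f s := by
    intro F _ _ f
    have : ∀ s, (indicator (Icc 0 t) fun _ => (1 : ℝ)) s • f s = indicator (Icc 0 t) f s := by
      intro s
      by_cases hs : s ∈ Icc 0 t <;> simp [hs]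
    simp only [this]
    rw [integral_indicator measurableSet_Icc, leb, Measure.restrict_restrict measurableSet_Icc,
      inter_eq_left.2 hsub, integral_Icc_eq_integral_Ioc, intervalIntegral.integral_of_le ht.1]
  have := isCompleteOrtho_sinFun.hasSum_integral_smul hψ w
  rw [key] at this
  have hfun : (fun n : ℕ => (√(2 / Real.pi) * ((1 - Real.cos (((n : ℝ) + 1) * t)) / ((n : ℝ) + 1)))
      • sinIso d w n) = fun n => (∫ t_1, (Icc 0 t).indicator (fun x => 1) t_1 * sinFun n t_1
        ∂leb Real.pi) • isCompleteOrtho_sinFun.iso d w n := by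
    funext n
    refine congrArg₂ _ ?_ rfl
    have h2 := key (F := ℝ) (sinFun n)
    simp only [smul_eq_mul] at h2
    rw [h2]
    unfold sinFun
    rw [intervalIntegral.integral_const_mul,
      intervalIntegral.integral_comp_mul_left (fun t => Real.sin t) (by positivity)]
    push_cast
    simp only [mul_zero, integral_sin, Real.cos_zero, smul_eq_mul]
    field_simp
  rwa [hfun]

/-- The solution of `-U'' = w` with Dirichlet boundary conditions represents `invLap w`. -/
lemma exists_invLap_rep {d : ℕ} (w : L2 d Real.pi) : ∃ U U' : ℝ → E d,
    (∀ t, HasDerivAt U (U' t) t) ∧ U 0 = 0 ∧ U Real.pi = 0 ∧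
    (∀ t ∈ Icc 0 Real.pi, U' t = U' 0 - ∫ s in (0 : ℝ)..t, w s) ∧
    invLap d w =ᵐ[leb Real.pi] U := by
  set a : ℕ → E d := fun n => sinIso d w n with ha
  have hs1 : Summable fun n : ℕ => ((n : ℝ) + 1)⁻¹ * ‖a n‖ := summable_inv_mul w
  have hs2 : Summable fun n => ‖sinIso d (invLap d w) n‖ := by
    refine Summable.of_nonneg_of_le (fun n => norm_nonneg _) (fun n => ?_) hs1
    rw [sinIso_invLap, norm_smul, Real.norm_of_nonneg (by positivity)]
    gcongr
    rw [sq]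
    exact le_mul_of_one_le_left (by positivity) (by linarith [n.cast_nonneg (α := ℝ)])
  set C : ℕ → ℝ → ℝ := fun n t => √(2 / Real.pi) * (Real.cos (((n : ℝ) + 1) * t) * ((n : ℝ) + 1)⁻¹)
    with hC
  have hbound : ∀ n t, ‖C n t • a n‖ ≤ ((n : ℝ) + 1)⁻¹ * ‖a n‖ := fun n t => by
    rw [norm_smul]
    gcongr
    rw [hC]
    simp only [norm_mul, ← mul_assoc]
    rw [← norm_mul]
    have := abs_sqrt_mul_le_one (a := 2) le_rfl (Real.abs_cos_le_one (((n : ℝ) + 1) * t))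
    rw [Real.norm_eq_abs, Real.norm_of_nonneg (by positivity)]
    exact mul_le_of_le_one_left (by positivity) this
  have hsumC : ∀ t, Summable fun n => C n t • a n := fun t =>
    Summable.of_norm_bounded hs1 fun n => hbound n t
  -- One differentiation costs a factor `n + 1` out of `(n + 1)²`; the remaining series converges
  -- absolutely by Cauchy-Schwarz. The second derivative is reached only in integrated form.
  have hderiv : ∀ t, HasDerivAt (fun t => ∑' n, sinFun n t • sinIso d (invLap d w) n)
      (∑' n, C n t • a n) t := by
    intro t
    refine hasDerivAt_tsum hs1 (fun n y => ?_) hbound (y₀ := 0) ?_ t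
    · rw [sinIso_invLap]
      have h1 : HasDerivAt (sinFun n) (√(2 / Real.pi) * (Real.cos (((n : ℝ) + 1) * y)
          * ((n : ℝ) + 1))) y := by
        unfold sinFun
        push_cast
        refine HasDerivAt.const_mul _ ?_
        have := ((hasDerivAt_id y).const_mul ((n : ℝ) + 1)).sin
        simpa using this
      have h2 := h1.smul_const ((((n : ℝ) + 1) ^ 2)⁻¹ • a n)
      convert h2 using 1
      rw [smul_smul, hC]
      congr 1
      field_simp
    · exact isCompleteOrtho_sinFun.summable_smul hs2 0
  refine ⟨_, _, hderiv, ?_, ?_, fun t ht => ?_, isCompleteOrtho_sinFun.ae_eq_tsum hs2⟩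
  · simp [sinFun]
  · simp only [sinFun, Real.sin_int_mul_pi, mul_zero, zero_smul, tsum_zero]
  · rw [eq_sub_iff_add_eq, ← (integral_Icc_L2 w ht).tsum_eq,
      ← (hsumC t).tsum_add (integral_Icc_L2 w ht).summable]
    refine tsum_congr fun n => ?_
    rw [← add_smul]
    congr 1
    simp only [hC, mul_zero, Real.cos_zero]
    field_simp
    ring

/-- Uniqueness for the Dirichlet problem: `V` and the series solution differ by a linear function
vanishing at `0`, and its value at `π` forces it to be zero. This is how `invLap` is recognised
without computing coefficients. -/
lemma invLap_ae_eq {d : ℕ} {w : L2 d Real.pi} {V V' : ℝ → E d}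
    (hV : ∀ t ∈ Icc 0 Real.pi, HasDerivAt V (V' t) t) (h0 : V 0 = 0) (hpi : V Real.pi = 0)
    (h : ∀ t ∈ Icc 0 Real.pi, V' t = V' 0 - ∫ s in (0 : ℝ)..t, w s) :
    invLap d w =ᵐ[leb Real.pi] V := by
  obtain ⟨U, U', hU, U0, Upi, hU', hrep⟩ := exists_invLap_rep w
  have hd : ∀ t ∈ Icc 0 Real.pi, HasDerivAt (fun t => V t + t • (U' 0 - V' 0))
      (V' t + (U' 0 - V' 0)) t := fun t ht => by
    have := (hV t ht).add ((hasDerivAt_id t).smul_const (U' 0 - V' 0))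
    rwa [one_smul] at this
  have heq := eqOn_of_hasDerivAt (fun t _ => hU t) hd
    (fun t ht => by rw [hU' t ht, h t ht]; abel) (by simp [h0, U0])
  have hc : U' 0 - V' 0 = 0 := by
    have := heq Real.pi ⟨Real.pi_pos.le, le_rfl⟩
    rw [Upi, hpi, zero_add] at this
    exact (smul_eq_zero.1 this.symm).resolve_left Real.pi_pos.ne'
  filter_upwards [hrep, ae_restrict_mem measurableSet_Icc] with t ht hmem
  rw [ht, heq t hmem, hc]
  simp

/-! ### The fourth order operator and its inverse. -/

lemma memLp_left : MemLp (fun t : ℝ => (Real.pi - t) / Real.pi) 2 (leb Real.pi) :=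
  memLp_of_continuous (by fun_prop) _

lemma memLp_right : MemLp (fun t : ℝ => t / Real.pi) 2 (leb Real.pi) :=
  memLp_of_continuous (by fun_prop) _

/-- The affine functions with given value at `0` that vanish at `π`. -/
def affL (d : ℕ) : E d →L[ℝ] L2 d Real.pi := tens d memLp_left

/-- The affine functions with given value at `π` that vanish at `0`. -/
def affR (d : ℕ) : E d →L[ℝ] L2 d Real.pi := tens d memLp_right

/-- The form of the operator relative to the Dirichlet Laplacian. -/
def relForm (d : ℕ) (γ b : ℝ) : L2 d Real.pi →L[ℝ] L2 d Real.pi :=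
  1 + γ ^ 2 • invLap d + b • (affL d ∘L (affL d).adjoint + affR d ∘L (affR d).adjoint)

lemma relForm_apply (d : ℕ) (γ b : ℝ) (z : L2 d Real.pi) :
    relForm d γ b z = z + γ ^ 2 • invLap d z
      + b • (affL d ((affL d).adjoint z) + affR d ((affR d).adjoint z)) := rfl

lemma inner_comp_adjoint {V W : Type*} [NormedAddCommGroup V] [InnerProductSpace ℝ V]
    [CompleteSpace V] [NormedAddCommGroup W] [InnerProductSpace ℝ W] [CompleteSpace W]
    (A : V →L[ℝ] W) (x y : W) :
    inner ℝ (A (A.adjoint x)) y = inner ℝ x (A (A.adjoint y)) := by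
  rw [← ContinuousLinearMap.adjoint_inner_right, ContinuousLinearMap.adjoint_inner_left]

lemma relForm_symmetric {d : ℕ} {γ b : ℝ} (x y : L2 d Real.pi) :
    inner ℝ (relForm d γ b x) y = inner ℝ x (relForm d γ b y) := by
  simp only [relForm_apply, inner_add_left, inner_add_right, real_inner_smul_left,
    real_inner_smul_right, invLap_symmetric, inner_comp_adjoint]

lemma norm_sq_le_inner_relForm {d : ℕ} {γ b : ℝ} (hb : 0 ≤ b) (x : L2 d Real.pi) :
    ‖x‖ ^ 2 ≤ inner ℝ (relForm d γ b x) x := by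
  simp only [relForm_apply, inner_add_left, real_inner_smul_left]
  rw [← ContinuousLinearMap.adjoint_inner_right (affL d),
    ← ContinuousLinearMap.adjoint_inner_right (affR d), real_inner_self_eq_norm_sq,
    real_inner_self_eq_norm_sq, real_inner_self_eq_norm_sq]
  have := inner_invLap_nonneg x
  have h1 : 0 ≤ γ ^ 2 * inner ℝ (invLap d x) x := by positivity
  have h2 : 0 ≤ b * (‖(affL d).adjoint x‖ ^ 2 + ‖(affR d).adjoint x‖ ^ 2) := by positivity
  linarith

/-- Lax-Milgram: the form is bounded below by `‖x‖²`, because the perturbations of the identity are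
nonnegative. -/
lemma isUnit_relForm {d : ℕ} {γ b : ℝ} (hb : 0 ≤ b) : IsUnit (relForm d γ b) := by
  refine ContinuousLinearMap.isUnit_of_forall_le_norm_inner_map (𝕜 := ℝ) _ (c := 1) one_pos
    fun x => ?_
  simpa using (norm_sq_le_inner_relForm hb x).trans (le_abs_self _)

/-- The inverse of `relForm`. -/
def relInv (d : ℕ) (γ b : ℝ) : L2 d Real.pi →L[ℝ] L2 d Real.pi := Ring.inverse (relForm d γ b)

lemma relForm_relInv {d : ℕ} {γ b : ℝ} (hb : 0 ≤ b) (x : L2 d Real.pi) :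
    relForm d γ b (relInv d γ b x) = x := by
  have h : relForm d γ b * relInv d γ b = 1 := Ring.mul_inverse_cancel _ (isUnit_relForm hb)
  rw [← mul_apply_eq_comp, h, one_apply_eq_self]

lemma relInv_relForm {d : ℕ} {γ b : ℝ} (hb : 0 ≤ b) (x : L2 d Real.pi) :
    relInv d γ b (relForm d γ b x) = x := by
  have h : relInv d γ b * relForm d γ b = 1 := Ring.inverse_mul_cancel _ (isUnit_relForm hb)
  rw [← mul_apply_eq_comp, h, one_apply_eq_self]

/-- The inverse of the fourth order operator. -/
def green (d : ℕ) (γ b : ℝ) : L2 d Real.pi →L[ℝ] L2 d Real.pi :=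
  invLap d ∘L relInv d γ b ∘L invLap d

lemma green_apply {d : ℕ} {γ b : ℝ} (x : L2 d Real.pi) :
    green d γ b x = invLap d (relInv d γ b (invLap d x)) := rfl

lemma green_symmetric {d : ℕ} {γ b : ℝ} (hb : 0 ≤ b) (x y : L2 d Real.pi) :
    inner ℝ (green d γ b x) y = inner ℝ x (green d γ b y) := by
  simp only [green_apply]
  rw [invLap_symmetric, ← invLap_symmetric x, ← relForm_relInv hb (invLap d y),
    ← relForm_symmetric, relForm_relInv hb, relForm_relInv hb]

/-- With `q = K x` the left side is `⟨q, Q⁻¹ q⟩`, and `Q ≥ 1` makes `Q⁻¹` a contraction. -/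
lemma inner_green_le {d : ℕ} {γ b : ℝ} (hb : 0 ≤ b) (x : L2 d Real.pi) :
    inner ℝ (green d γ b x) x ≤ ‖invLap d x‖ ^ 2 := by
  rw [green_apply, invLap_symmetric]
  set q := invLap d x
  have h1 := norm_sq_le_inner_relForm (γ := γ) hb (relInv d γ b q)
  rw [relForm_relInv hb] at h1
  have h2 := real_inner_le_norm q (relInv d γ b q)
  have h3 := real_inner_le_norm (relInv d γ b q) q
  have h4 : ‖relInv d γ b q‖ ≤ ‖q‖ := by
    by_contra! hlt
    nlinarith [norm_nonneg q]
  nlinarith [norm_nonneg q]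

/-- With `q = K x`, boundedness of `Q` gives `‖q‖ ≤ ‖Q‖ ‖Q⁻¹ q‖`, while `Q ≥ 1` gives `‖Q⁻¹ q‖² ≤
⟨q, Q⁻¹ q⟩`. Together with `inner_green_le` this is the two-sided form comparison of `(-L̄)⁻¹` with
`K²`. -/
lemma le_inner_green {d : ℕ} {γ b : ℝ} (hb : 0 ≤ b) (x : L2 d Real.pi) :
    ‖invLap d x‖ ^ 2 ≤ (‖relForm d γ b‖ + 1) ^ 2 * inner ℝ (green d γ b x) x := by
  rw [green_apply, invLap_symmetric]
  set q := invLap d x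
  have h1 := norm_sq_le_inner_relForm (γ := γ) hb (relInv d γ b q)
  rw [relForm_relInv hb, real_inner_comm] at h1
  have h2 := (relForm d γ b).le_opNorm (relInv d γ b q)
  rw [relForm_relInv hb] at h2
  calc ‖q‖ ^ 2 ≤ ((‖relForm d γ b‖ + 1) * ‖relInv d γ b q‖) ^ 2 := by
        gcongr
        refine h2.trans ?_
        gcongr
        linarith
    _ = (‖relForm d γ b‖ + 1) ^ 2 * ‖relInv d γ b q‖ ^ 2 := by ring
    _ ≤ _ := by gcongr

lemma invLap_injective (d : ℕ) : Function.Injective (invLap d) := by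
  intro x y hxy
  refine isCompleteOrtho_sinFun.ext fun n => ?_
  have h1 := sinIso_invLap x n
  have h2 := sinIso_invLap y n
  rw [hxy, h2] at h1
  exact (smul_right_injective _ (by positivity) h1).symm

lemma hasDerivAt_iteratedDeriv {d : ℕ} {u : ℝ → E d} (hu : ContDiff ℝ 3 u) {k : ℕ} (hk : k < 3)
    (t : ℝ) : HasDerivAt (iteratedDeriv k u) (iteratedDeriv (k + 1) u t) t := by
  have h1 : Differentiable ℝ (iteratedDeriv k u) :=
    hu.differentiable_iteratedDeriv k (by exact_mod_cast hk)
  rw [iteratedDeriv_succ]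
  exact (h1 t).hasDerivAt

lemma continuous_iteratedDeriv' {d : ℕ} {u : ℝ → E d} (hu : ContDiff ℝ 3 u) {k : ℕ} (hk : k ≤ 3) :
    Continuous (iteratedDeriv k u) :=
  hu.continuous_iteratedDeriv k (by exact_mod_cast hk)

lemma integral_L2_congr {d : ℕ} {z : L2 d Real.pi} {f : ℝ → E d} (h : z =ᵐ[leb Real.pi] f) {t : ℝ}
    (ht : t ∈ Icc 0 Real.pi) : ∫ s in (0 : ℝ)..t, z s = ∫ s in (0 : ℝ)..t, f s := by
  rw [intervalIntegral.integral_of_le ht.1, intervalIntegral.integral_of_le ht.1]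
  exact integral_congr_ae (ae_mono (Measure.restrict_mono
    (Ioc_subset_Icc_self.trans (Icc_subset_Icc le_rfl ht.2)) le_rfl) h)

section SecondDerivative

variable {d : ℕ} {u u1 u2 : ℝ → E d}

lemma invLap_neg_deriv2 (h1 : ∀ t, HasDerivAt u (u1 t) t)
    (h2 : ∀ t, HasDerivAt u1 (u2 t) t) (hc : Continuous u2) (h0 : u 0 = 0) (hpi : u Real.pi = 0)
    {z : L2 d Real.pi} (hz : z =ᵐ[leb Real.pi] fun t => -u2 t) :
    invLap d z =ᵐ[leb Real.pi] u := by
  refine invLap_ae_eq (fun t _ => h1 t) h0 hpi fun t ht => ?_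
  rw [integral_L2_congr hz ht, intervalIntegral.integral_neg,
    intervalIntegral.integral_eq_sub_of_hasDerivAt (fun s _ => h2 s) (hc.intervalIntegrable _ _)]
  abel

/-- Two integrations by parts against an affine function leave only the boundary slope. Thus `u'(0)`
is a bounded functional of `u''`, which is what lets the boundary conditions enter through the
finite-rank part of `relForm`. -/
lemma adjoint_affL_neg_deriv2 (h1 : ∀ t, HasDerivAt u (u1 t) t)
    (h2 : ∀ t, HasDerivAt u1 (u2 t) t) (hc : Continuous u2) (h0 : u 0 = 0) (hpi : u Real.pi = 0)
    {z : L2 d Real.pi} (hz : z =ᵐ[leb Real.pi] fun t => -u2 t) :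
    (affL d).adjoint z = u1 0 := by
  have hpi' := Real.pi_pos.ne'
  rw [affL, adjoint_tens]
  have e : ∫ t, ((Real.pi - t) / Real.pi) • z t ∂(leb Real.pi)
      = ∫ t, -(((Real.pi - t) / Real.pi) • u2 t) ∂(leb Real.pi) := by
    refine integral_congr_ae ?_
    filter_upwards [hz] with t ht
    rw [ht, smul_neg]
  have hd : ∀ t, HasDerivAt (fun t => ((Real.pi - t) / Real.pi) • u1 t + (1 / Real.pi) • u t)
      (((Real.pi - t) / Real.pi) • u2 t) t := fun t => by
    have e1 : HasDerivAt (fun t : ℝ => (Real.pi - t) / Real.pi) (-1 / Real.pi) t :=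
      ((hasDerivAt_id t).const_sub Real.pi).div_const Real.pi
    refine ((e1.smul (h2 t)).add ((h1 t).const_smul (1 / Real.pi))).congr_deriv ?_
    rw [add_assoc, ← add_smul]
    ring_nf
    simp
  rw [e, integral_leb Real.pi_pos.le, intervalIntegral.integral_neg,
    intervalIntegral.integral_eq_sub_of_hasDerivAt (fun s _ => hd s)
      (Continuous.intervalIntegrable (by fun_prop) _ _)]
  simp [h0, hpi]

lemma adjoint_affR_neg_deriv2 (h1 : ∀ t, HasDerivAt u (u1 t) t)
    (h2 : ∀ t, HasDerivAt u1 (u2 t) t) (hc : Continuous u2) (h0 : u 0 = 0) (hpi : u Real.pi = 0)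
    {z : L2 d Real.pi} (hz : z =ᵐ[leb Real.pi] fun t => -u2 t) :
    (affR d).adjoint z = -u1 Real.pi := by
  have hpi' := Real.pi_pos.ne'
  rw [affR, adjoint_tens]
  have e : ∫ t, (t / Real.pi) • z t ∂(leb Real.pi)
      = ∫ t, -((t / Real.pi) • u2 t) ∂(leb Real.pi) := by
    refine integral_congr_ae ?_
    filter_upwards [hz] with t ht
    rw [ht, smul_neg]
  have hd : ∀ t, HasDerivAt (fun t => (t / Real.pi) • u1 t - (1 / Real.pi) • u t)
      ((t / Real.pi) • u2 t) t := fun t => by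
    have e1 : HasDerivAt (fun t : ℝ => t / Real.pi) (1 / Real.pi) t :=
      (hasDerivAt_id t).div_const Real.pi
    refine ((e1.smul (h2 t)).sub ((h1 t).const_smul (1 / Real.pi))).congr_deriv ?_
    abel
  rw [e, integral_leb Real.pi_pos.le, intervalIntegral.integral_neg,
    intervalIntegral.integral_eq_sub_of_hasDerivAt (fun s _ => hd s)
      (Continuous.intervalIntegrable (by fun_prop) _ _)]
  simp [h0, hpi, hpi']

end SecondDerivative

lemma coeFn_aff {d : ℕ} (v w : E d) : (affL d v + affR d w : L2 d Real.pi)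
    =ᵐ[leb Real.pi] fun t => ((Real.pi - t) / Real.pi) • v + (t / Real.pi) • w := by
  filter_upwards [Lp.coeFn_add (affL d v) (affR d w), coeFn_tens memLp_left v,
    coeFn_tens memLp_right w] with t a b c
  rw [a, Pi.add_apply, affL, affR, b, c]

lemma mass_coefficient {T m : ℝ} (hT : 0 < T) (hm : 0 < m) :
    T / (Real.pi * (T / (Real.pi * m))) = m := by
  have := Real.pi_pos
  field_simp

/-- Put `z = -u''` and `g = u''''`. Then `K g` equals `z` plus the affine interpolation of the
boundary values of `u''`; by the boundary conditions these are `m⁻¹` times the slopes `u'(0)` and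
`-u'(π)`, that is, functionals of `z`. Substituting `g = -y - γ² z` gives `Q z = K (-y)`, while `x =
K z`. -/
lemma green_of_isLbar {T m : ℝ} (hT : 0 < T) (hm : 0 < m) {d : ℕ} {x y : L2 d Real.pi}
    (h : IsLbar T m d x y) : x = green d (T / (Real.pi * m)) m⁻¹ (-y) := by
  obtain ⟨u, g, hu, hg, hx, h0, hpi, hb0, hbpi, hy⟩ := h
  rw [mass_coefficient hT hm] at hb0 hbpi
  have hpi0 := Real.pi_pos.ne'
  have hb : 0 ≤ m⁻¹ := by positivity
  set γ := T / (Real.pi * m)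
  have hd : ∀ k < 3, ∀ t, HasDerivAt (iteratedDeriv k u) (iteratedDeriv (k + 1) u t) t :=
    fun k hk t => hasDerivAt_iteratedDeriv hu hk t
  have hd0 : ∀ t, HasDerivAt u (iteratedDeriv 1 u t) t := by
    simpa [iteratedDeriv_zero] using hd 0 (by norm_num)
  have hc2 : Continuous (iteratedDeriv 2 u) := continuous_iteratedDeriv' hu (by norm_num)
  have hm2 : MemLp (fun t => -iteratedDeriv 2 u t) 2 (leb Real.pi) :=
    memLp_of_continuous hc2.neg _
  set z : L2 d Real.pi := hm2.toLp _ with hz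
  have hzu : z =ᵐ[leb Real.pi] fun t => -iteratedDeriv 2 u t := hm2.coeFn_toLp
  have hxz : x = invLap d z :=
    Lp.ext (hx.trans (invLap_neg_deriv2 hd0 (hd 1 (by norm_num)) hc2 h0 hpi hzu).symm)
  have hL := adjoint_affL_neg_deriv2 hd0 (hd 1 (by norm_num)) hc2 h0 hpi hzu
  have hR := adjoint_affR_neg_deriv2 hd0 (hd 1 (by norm_num)) hc2 h0 hpi hzu
  set p := iteratedDeriv 2 u 0
  set q := iteratedDeriv 2 u Real.pi
  have hKg : invLap d g =ᵐ[leb Real.pi] fun t => -iteratedDeriv 2 u t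
      + (((Real.pi - t) / Real.pi) • p + (t / Real.pi) • q) := by
    refine invLap_ae_eq (V' := fun t => -iteratedDeriv 3 u t
      + ((-1 / Real.pi) • p + (1 / Real.pi) • q)) (fun t _ => ?_) ?_ ?_ fun t ht => ?_
    · refine (hd 2 (by norm_num) t).neg.add (HasDerivAt.add ?_ ?_)
      · exact (((hasDerivAt_id t).const_sub Real.pi).div_const Real.pi).smul_const p
      · exact ((hasDerivAt_id t).div_const Real.pi).smul_const q
    · simp [hpi0, p]
    · simp [hpi0, q]
    · beta_reduce
      rw [hg t ht]
      abel
  have hg1 : invLap d g = z + (affL d p + affR d q) := by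
    refine Lp.ext (hKg.trans ?_)
    filter_upwards [Lp.coeFn_add z (affL d p + affR d q), hzu, coeFn_aff p q] with t a b c
    rw [a, Pi.add_apply, b, c]
  have hg2 : g = -y - γ ^ 2 • z := by
    refine Lp.ext ?_
    filter_upwards [hy, hzu, Lp.coeFn_sub (-y) (γ ^ 2 • z), Lp.coeFn_neg y,
      Lp.coeFn_smul (γ ^ 2) z] with t a b c e f
    rw [c, Pi.sub_apply, e, f, Pi.neg_apply, Pi.smul_apply, a, b, smul_neg]
    abel
  have hQ : relForm d γ m⁻¹ z = invLap d (-y) := by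
    rw [relForm_apply, hL, hR, ← hb0, ← hbpi, map_smul, map_smul, ← smul_add, smul_smul,
      inv_mul_cancel₀ hm.ne', one_smul, add_right_comm, ← hg1, hg2, ← map_smul, ← map_add]
    congr 1
    abel
  rw [green_apply, ← hQ, relInv_relForm hb, hxz]

/-- The computation of `green_of_isLbar` is run backwards: `z = Q⁻¹ K w` is the prospective `-u''`,
`p = w - γ² z` the prospective fourth derivative, and the identity for `z` returns the boundary
conditions. -/
lemma isLbar_green {T m : ℝ} (hT : 0 < T) (hm : 0 < m) {d : ℕ} (w : L2 d Real.pi) :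
    IsLbar T m d (green d (T / (Real.pi * m)) m⁻¹ w) (-w) := by
  have hpi0 := Real.pi_pos.ne'
  have hb : 0 ≤ m⁻¹ := by positivity
  set γ := T / (Real.pi * m) with hγ
  rw [IsLbar, mass_coefficient hT hm, ← hγ]
  set z := relInv d γ m⁻¹ (invLap d w) with hz
  have hQ : relForm d γ m⁻¹ z = invLap d w := relForm_relInv hb _
  set p : L2 d Real.pi := w - γ ^ 2 • z with hp
  set cL : E d := m⁻¹ • (affL d).adjoint z with hcL
  set cR : E d := m⁻¹ • (affR d).adjoint z with hcR
  have hzp : z = invLap d p - (affL d cL + affR d cR) := by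
    rw [hp, map_sub, ← hQ, relForm_apply, hcL, hcR, map_smul, map_smul, map_smul, smul_add]
    abel
  obtain ⟨U, U', hU, U0, Upi, hU', hrepU⟩ := exists_invLap_rep p
  obtain ⟨X, X', hX, X0, Xpi, hX', hrepX⟩ := exists_invLap_rep z
  set Z : ℝ → E d := fun t => U t - (((Real.pi - t) / Real.pi) • cL + (t / Real.pi) • cR) with hZ
  set k : E d := (-1 / Real.pi) • cL + (1 / Real.pi) • cR with hk
  have hZd : ∀ t, HasDerivAt Z (U' t - k) t := fun t => by
    refine (hU t).sub (HasDerivAt.add ?_ ?_)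
    · exact (((hasDerivAt_id t).const_sub Real.pi).div_const Real.pi).smul_const cL
    · exact ((hasDerivAt_id t).div_const Real.pi).smul_const cR
  have hzZ : z =ᵐ[leb Real.pi] Z := by
    filter_upwards [Lp.coeFn_sub (invLap d p) (affL d cL + affR d cR), hrepU, coeFn_aff cL cR]
      with t a b c
    rw [hzp, a, Pi.sub_apply, b, c]
  -- The representative must be `C³` on the whole line, so `p` is extended by zero and `u` is
  -- obtained by repeated integration. The constants of integration are those dictated by `U`, `Z`
  -- and `X` on `[0, π]`.
  have hpint : Integrable (indicator (Icc 0 Real.pi) p) volume :=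
    (integrable_indicator_iff measurableSet_Icc).2 (integrable_L2 p)
  set u3 : ℝ → E d := fun t => k - U' 0 + ∫ s in (0 : ℝ)..t, indicator (Icc 0 Real.pi) p s with hu3
  have hc3 : Continuous u3 := continuous_const.add
    (intervalIntegral.continuous_primitive (fun a b => hpint.intervalIntegrable) 0)
  set u2 : ℝ → E d := fun t => -Z 0 + ∫ s in (0 : ℝ)..t, u3 s with hu2
  have hd2 : ∀ t, HasDerivAt u2 (u3 t) t := fun t =>
    (hc3.integral_hasStrictDerivAt 0 t).hasDerivAt.const_add _
  have hc2 : Continuous u2 := continuous_iff_continuousAt.2 fun t => (hd2 t).continuousAt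
  set u1 : ℝ → E d := fun t => X' 0 + ∫ s in (0 : ℝ)..t, u2 s with hu1
  have hd1 : ∀ t, HasDerivAt u1 (u2 t) t := fun t =>
    (hc2.integral_hasStrictDerivAt 0 t).hasDerivAt.const_add _
  have hc1 : Continuous u1 := continuous_iff_continuousAt.2 fun t => (hd1 t).continuousAt
  set u : ℝ → E d := fun t => ∫ s in (0 : ℝ)..t, u1 s with hu
  have hd0 : ∀ t, HasDerivAt u (u1 t) t := fun t =>
    (hc1.integral_hasStrictDerivAt 0 t).hasDerivAt
  have hi1 : iteratedDeriv 1 u = u1 := by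
    rw [iteratedDeriv_one]
    exact funext fun t => (hd0 t).deriv
  have hi2 : iteratedDeriv 2 u = u2 := by
    rw [iteratedDeriv_succ, hi1]
    exact funext fun t => (hd1 t).deriv
  have hi3 : iteratedDeriv 3 u = u3 := by
    rw [iteratedDeriv_succ, hi2]
    exact funext fun t => (hd2 t).deriv
  have hcd : ContDiff ℝ 3 u := by
    refine (contDiff_nat_iff_iteratedDeriv (n := 3)).2 ⟨fun j hj => ?_, fun j hj => ?_⟩
    · interval_cases j
      · rw [iteratedDeriv_zero]
        exact continuous_iff_continuousAt.2 fun t => (hd0 t).continuousAt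
      · rwa [hi1]
      · rwa [hi2]
      · rwa [hi3]
    · interval_cases j
      · rw [iteratedDeriv_zero]
        exact fun t => (hd0 t).differentiableAt
      · rw [hi1]
        exact fun t => (hd1 t).differentiableAt
      · rw [hi2]
        exact fun t => (hd2 t).differentiableAt
  have hind : ∀ t ∈ Icc 0 Real.pi, ∫ s in (0 : ℝ)..t, indicator (Icc 0 Real.pi) p s
      = ∫ s in (0 : ℝ)..t, p s := fun t ht => by
    refine intervalIntegral.integral_congr fun s hs => ?_
    rw [uIcc_of_le ht.1] at hs
    exact indicator_of_mem (Icc_subset_Icc le_rfl ht.2 hs) _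
  have e3 : ∀ t ∈ Icc 0 Real.pi, u3 t = k - U' t := fun t ht => by
    rw [hu3, hU' t ht]
    beta_reduce
    rw [hind t ht]
    abel
  have e2 : ∀ t ∈ Icc 0 Real.pi, u2 t = -Z t :=
    eqOn_of_hasDerivAt (fun t _ => hd2 t) (fun t _ => (hZd t).neg)
      (fun t ht => by rw [e3 t ht]; abel) (by simp [hu2])
  have hZc : Continuous Z := continuous_iff_continuousAt.2 fun t => (hZd t).continuousAt
  have e1 : ∀ t ∈ Icc 0 Real.pi, u1 t = X' t := fun t ht => by
    rw [hX' t ht, integral_L2_congr hzZ ht, hu1, sub_eq_add_neg, ← intervalIntegral.integral_neg]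
    beta_reduce
    congr 1
    refine intervalIntegral.integral_congr fun s hs => ?_
    rw [uIcc_of_le ht.1] at hs
    exact e2 s (Icc_subset_Icc le_rfl ht.2 hs)
  have e0 : ∀ t ∈ Icc 0 Real.pi, u t = X t :=
    eqOn_of_hasDerivAt (fun t _ => hd0 t) (fun t _ => hX t) e1 (by simp [hu, X0])
  have m0 : (0 : ℝ) ∈ Icc 0 Real.pi := ⟨le_rfl, Real.pi_pos.le⟩
  have mpi : Real.pi ∈ Icc 0 Real.pi := ⟨Real.pi_pos.le, le_rfl⟩
  have h0 : u 0 = 0 := by rw [e0 0 m0, X0]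
  have hpi : u Real.pi = 0 := by rw [e0 _ mpi, Xpi]
  have hzu : z =ᵐ[leb Real.pi] fun t => -u2 t := by
    filter_upwards [hzZ, ae_restrict_mem measurableSet_Icc] with t a b
    rw [a, e2 t b, neg_neg]
  have hL := adjoint_affL_neg_deriv2 hd0 hd1 hc2 h0 hpi hzu
  have hR := adjoint_affR_neg_deriv2 hd0 hd1 hc2 h0 hpi hzu
  refine ⟨u, p, hcd, fun t ht => ?_, ?_, h0, hpi, ?_, ?_, ?_⟩
  · rw [hi3, ← hind t ht, hu3]
    simp
  · filter_upwards [hrepX, ae_restrict_mem measurableSet_Icc] with t a b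
    rw [e0 t b]
    exact a
  · rw [hi2, hi1, e2 0 m0, ← hL, hZ]
    simp [U0, hpi0, hcL, hm.ne']
  · rw [hi2, hi1, e2 _ mpi, ← hR, hZ]
    simp [Upi, hpi0, hcR, hm.ne']
  · rw [hi2]
    filter_upwards [Lp.coeFn_neg w, Lp.coeFn_sub w (γ ^ 2 • z), Lp.coeFn_smul (γ ^ 2) z, hzu]
      with t a b c e
    rw [a, hp, b, Pi.sub_apply, c, Pi.smul_apply, e, Pi.neg_apply, smul_neg]
    abel

theorem isLbar_iff {T m : ℝ} (hT : 0 < T) (hm : 0 < m) {d : ℕ} {x y : L2 d Real.pi} :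
    IsLbar T m d x y ↔ x = green d (T / (Real.pi * m)) m⁻¹ (-y) := by
  refine ⟨green_of_isLbar hT hm, fun h => ?_⟩
  rw [h]
  simpa using isLbar_green hT hm (-y)

/-! ### Spectral decomposition and equivalence of the fractional powers. -/

lemma isCompactOperator_invLap (d : ℕ) : IsCompactOperator (invLap d) := by
  set P : ℕ → L2 d Real.pi →L[ℝ] L2 d Real.pi := fun n =>
    (((n : ℝ) + 1) ^ 2)⁻¹ • (tens d (isCompleteOrtho_sinFun.memLp n)
      ∘L (tens d (isCompleteOrtho_sinFun.memLp n)).adjoint) with hP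
  have hnorm : ∀ n, ‖tens d (isCompleteOrtho_sinFun.memLp n)‖ ≤ 1 := fun n =>
    ContinuousLinearMap.opNorm_le_bound _ zero_le_one fun v => by
      rw [one_mul]
      exact ((isCompleteOrtho_sinFun.comp d n).norm_map v).le
  have hPn : ∀ n, ‖P n‖ ≤ (((n : ℝ) + 1)⁻¹) ^ 2 := fun n => by
    rw [hP]
    beta_reduce
    rw [norm_smul, Real.norm_of_nonneg (by positivity), inv_pow]
    refine mul_le_of_le_one_right (by positivity) ?_
    refine (ContinuousLinearMap.opNorm_comp_le _ _).trans ?_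
    rw [LinearIsometryEquiv.norm_map]
    exact mul_le_one₀ (hnorm n) (norm_nonneg _) (hnorm n)
  -- The finite-rank spectral pieces have summable norms, so the operator is a norm limit of
  -- finite-rank operators.
  have hsum := (Summable.of_norm_bounded summable_inv_sq hPn).hasSum
  have heq : ∑' n, P n = invLap d := by
    ext1 x
    have h1 : HasSum (fun n => P n x) ((∑' n, P n) x) :=
      hsum.mapL (ContinuousLinearMap.apply ℝ (L2 d Real.pi) x)
    refine h1.unique ?_
    convert isCompleteOrtho_sinFun.hasSum_tens (invLap d x) using 2 with n
    have h2 := sinIso_invLap x n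
    rw [sinIso] at h2
    rw [h2, map_smul, isCompleteOrtho_sinFun.iso_apply, ← adjoint_tens
      (isCompleteOrtho_sinFun.memLp n)]
    rfl
  rw [heq] at hsum
  refine isCompactOperator_of_tendsto hsum (Filter.Eventually.of_forall fun F => ?_)
  induction F using Finset.induction_on with
  | empty => simpa using isCompactOperator_zero
  | insert n F hn ih =>
    rw [Finset.sum_insert hn]
    refine IsCompactOperator.add ?_ ih
    refine IsCompactOperator.smul (S := ℝ) ?_ _
    have h1 : IsCompactOperator (tens d (isCompleteOrtho_sinFun.memLp n)).adjoint :=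
      isCompactOperator_of_locallyCompactSpace_dom
        (tens d (isCompleteOrtho_sinFun.memLp n)).adjoint
    exact h1.clm_comp (tens d (isCompleteOrtho_sinFun.memLp n))

section HilbertSum

variable {ι : Type*} {G : ι → Type*} [∀ i, NormedAddCommGroup (G i)]
  [∀ i, InnerProductSpace ℝ (G i)] {H : Type*} [NormedAddCommGroup H] [InnerProductSpace ℝ H]
  [CompleteSpace H] {V : ∀ i, G i →ₗᵢ[ℝ] H} (hV : IsHilbertSum ℝ G V)

lemma inner_linearIsometryEquiv (x : H) {i : ι} (w : G i) :
    inner ℝ w (hV.linearIsometryEquiv x i) = inner ℝ (V i w) x := by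
  classical
  rw [← hV.linearIsometryEquiv_symm_apply_single w, ← hV.linearIsometryEquiv.inner_map_map,
    LinearIsometryEquiv.apply_symm_apply, lp.inner_single_left]

lemma linearIsometryEquiv_apply_of_eigen {A : H →L[ℝ] H}
    (hA : ∀ x y, inner ℝ (A x) y = inner ℝ x (A y)) {c : ι → ℝ}
    (hc : ∀ i w, A (V i w) = c i • V i w) (x : H) (i : ι) :
    hV.linearIsometryEquiv (A x) i = c i • hV.linearIsometryEquiv x i := by
  refine ext_inner_left ℝ fun w => ?_
  rw [inner_linearIsometryEquiv, real_inner_smul_right, inner_linearIsometryEquiv, ← hA, hc,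
    real_inner_smul_left]

lemma hasSum_inner_of_eigen {A : H →L[ℝ] H}
    (hA : ∀ x y, inner ℝ (A x) y = inner ℝ x (A y)) {c : ι → ℝ}
    (hc : ∀ i w, A (V i w) = c i • V i w) (x : H) :
    HasSum (fun i => c i * ‖hV.linearIsometryEquiv x i‖ ^ 2) (inner ℝ (A x) x) := by
  rw [← hV.linearIsometryEquiv.inner_map_map]
  refine (lp.hasSum_inner (𝕜 := ℝ) (hV.linearIsometryEquiv (A x))
    (hV.linearIsometryEquiv x)).congr_fun fun i => ?_
  rw [linearIsometryEquiv_apply_of_eigen hV hA hc, real_inner_smul_left,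
    real_inner_self_eq_norm_sq]

end HilbertSum

section Spectral

lemma green_injective {d : ℕ} {γ b : ℝ} (hb : 0 ≤ b) : Function.Injective (green d γ b) := by
  intro x y hxy
  have h1 := invLap_injective d hxy
  have h2 := congrArg (relForm d γ b) h1
  change relForm d γ b (relInv d γ b (invLap d x)) = relForm d γ b (relInv d γ b (invLap d y)) at h2
  rw [relForm_relInv hb, relForm_relInv hb] at h2
  exact invLap_injective d h2

lemma isCompactOperator_green (d : ℕ) (γ b : ℝ) : IsCompactOperator (green d γ b) :=
  ((isCompactOperator_invLap d).comp_clm (relInv d γ b ∘L invLap d) :)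

/-- The eigenspace of the Green operator to the eigenvalue `μ⁻¹`. -/
def greenSpace (d : ℕ) (γ b μ : ℝ) : Submodule ℝ (L2 d Real.pi) :=
  Module.End.eigenspace (green d γ b : L2 d Real.pi →ₗ[ℝ] L2 d Real.pi) μ⁻¹

lemma mem_greenSpace {d : ℕ} {γ b μ : ℝ} {x : L2 d Real.pi} :
    x ∈ greenSpace d γ b μ ↔ green d γ b x = μ⁻¹ • x := by
  rw [greenSpace, Module.End.mem_eigenspace_iff]
  rfl

lemma isClosed_greenSpace (d : ℕ) (γ b μ : ℝ) :
    IsClosed (greenSpace d γ b μ : Set (L2 d Real.pi)) := by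
  have : (greenSpace d γ b μ : Set (L2 d Real.pi)) = {x | green d γ b x = μ⁻¹ • x} := by
    ext x
    exact mem_greenSpace
  rw [this]
  exact isClosed_eq (green d γ b).continuous (continuous_const_smul _)

instance (d : ℕ) (γ b μ : ℝ) : CompleteSpace (greenSpace d γ b μ) :=
  (isClosed_greenSpace d γ b μ).completeSpace_coe

lemma eigenspace_eq_greenSpace {T m : ℝ} (hT : 0 < T) (hm : 0 < m) (d : ℕ) (μ : ℝ) :
    eigenspace T m d μ = greenSpace d (T / (Real.pi * m)) m⁻¹ μ := by
  ext x
  change IsLbar T m d x (-(μ • x)) ↔ _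
  rw [isLbar_iff hT hm, mem_greenSpace, neg_neg, map_smul]
  -- At `μ = 0` the convention `0⁻¹ = 0` makes the right side the kernel of the Green operator; both
  -- sides are trivial.
  rcases eq_or_ne μ 0 with rfl | hμ
  · rw [zero_smul, inv_zero, zero_smul, ← map_zero (green d (T / (Real.pi * m)) m⁻¹)]
    have hb : 0 ≤ m⁻¹ := by positivity
    rw [(green_injective hb).eq_iff, map_zero]
  · rw [eq_comm, eq_inv_smul_iff₀ hμ]

lemma isHilbertSum_greenSpace (d : ℕ) (γ : ℝ) {b : ℝ} (hb : 0 ≤ b) :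
    IsHilbertSum ℝ (fun μ => greenSpace d γ b μ) fun μ => (greenSpace d γ b μ).subtypeₗᵢ := by
  have hs : (green d γ b : L2 d Real.pi →ₗ[ℝ] L2 d Real.pi).IsSymmetric := green_symmetric hb
  refine IsHilbertSum.mkInternal _ ?_ ?_
  · exact hs.orthogonalFamily_eigenspaces.comp inv_injective
  · have h1 := ContinuousLinearMap.orthogonalComplement_iSup_eigenspaces_eq_bot
      (isCompactOperator_green d γ b) hs
    have h2 : ⨆ μ, greenSpace d γ b μ
        = ⨆ μ, Module.End.eigenspace (green d γ b : L2 d Real.pi →ₗ[ℝ] L2 d Real.pi) μ :=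
      inv_surjective.iSup_comp
        (g := Module.End.eigenspace (green d γ b : L2 d Real.pi →ₗ[ℝ] L2 d Real.pi))
    rw [h2, Submodule.topologicalClosure_eq_top_iff.2 h1]

variable {d : ℕ} {γ b : ℝ} (hb : 0 ≤ b)

/-- The spectral decomposition. -/
def eigIso (d : ℕ) (γ : ℝ) {b : ℝ} (hb : 0 ≤ b) :
    L2 d Real.pi ≃ₗᵢ[ℝ] lp (fun μ => greenSpace d γ b μ) 2 :=
  (isHilbertSum_greenSpace d γ hb).linearIsometryEquiv

lemma inner_eigIso (x : L2 d Real.pi) {μ : ℝ} (w : greenSpace d γ b μ) :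
    inner ℝ w (eigIso d γ hb x μ) = inner ℝ (w : L2 d Real.pi) x :=
  inner_linearIsometryEquiv (isHilbertSum_greenSpace d γ hb) x w

/-- The Green operator is positive and injective, so it has no eigenvalue `μ⁻¹ ≤ 0`. Hence the value
of a weight at `μ ≤ 0` is irrelevant and `posPart` may be used to keep all weights positive. -/
lemma eigIso_eq_zero (x : L2 d Real.pi) {μ : ℝ} (hμ : μ ≤ 0) : eigIso d γ hb x μ = 0 := by
  set w := eigIso d γ hb x μ with hw
  have h1 := le_inner_green (γ := γ) hb (w : L2 d Real.pi)
  rw [mem_greenSpace.1 w.2, real_inner_smul_left, real_inner_self_eq_norm_sq] at h1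
  have h2 : invLap d (w : L2 d Real.pi) = 0 := by
    rw [← norm_eq_zero, ← sq_eq_zero_iff]
    refine le_antisymm (h1.trans ?_) (sq_nonneg _)
    refine mul_nonpos_of_nonneg_of_nonpos (sq_nonneg _) ?_
    exact mul_nonpos_of_nonpos_of_nonneg (inv_nonpos.2 hμ) (sq_nonneg _)
  have h3 : (w : L2 d Real.pi) = 0 := invLap_injective d (by rw [h2, map_zero])
  exact_mod_cast h3

lemma eigenproj_eq {T m : ℝ} (hT : 0 < T) (hm : 0 < m) (x : L2 d Real.pi) (μ : ℝ) :
    eigenproj T m d μ x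
      = eigIso d (T / (Real.pi * m)) (inv_nonneg.2 hm.le) x μ := by
  set γ := T / (Real.pi * m)
  have hcl : (eigenspace T m d μ).topologicalClosure = greenSpace d γ m⁻¹ μ := by
    rw [eigenspace_eq_greenSpace hT hm]
    exact (isClosed_greenSpace d γ m⁻¹ μ).submodule_topologicalClosure_eq
  rw [eigenproj]
  refine Submodule.eq_starProjection_of_mem_of_inner_eq_zero ?_ fun w hw => ?_
  · rw [hcl]
    exact Subtype.property _
  · rw [hcl] at hw
    rw [inner_sub_left, real_inner_comm, real_inner_comm w, sub_eq_zero]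
    rw [← inner_eigIso (inv_nonneg.2 hm.le) x ⟨w, hw⟩]
    rfl

/-- The eigenvalue weights: positive everywhere, equal to `μ` at positive `μ`. -/
def posPart (μ : ℝ) : ℝ := if 0 < μ then μ else 1

lemma posPart_pos (μ : ℝ) : 0 < posPart μ := by
  unfold posPart
  split_ifs with h
  exacts [h, one_pos]

lemma energy_eigIso_congr {v w : ℝ → ℝ} (h : ∀ μ, 0 < μ → v μ = w μ) (x : L2 d Real.pi) :
    energy (eigIso d γ hb) v x = energy (eigIso d γ hb) w x := by
  refine tsum_congr fun μ => ?_
  rcases lt_or_ge 0 μ with hμ | hμ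
  · rw [h μ hμ]
  · rw [eigIso_eq_zero hb x hμ]
    simp

lemma energy_posPart_inv (x : L2 d Real.pi) :
    energy (eigIso d γ hb) (fun μ => (posPart μ)⁻¹) x
      = ENNReal.ofReal (inner ℝ (green d γ b x) x) := by
  have h1 : HasSum (fun μ => (posPart μ)⁻¹ * ‖eigIso d γ hb x μ‖ ^ 2)
      (inner ℝ (green d γ b x) x) := by
    refine (hasSum_inner_of_eigen (isHilbertSum_greenSpace d γ hb) (green_symmetric hb)
      (c := fun μ => μ⁻¹) (fun μ w => mem_greenSpace.1 w.2) x).congr_fun fun μ => ?_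
    rcases lt_or_ge 0 μ with hμ | hμ
    · rw [posPart, if_pos hμ]
      rfl
    · have h3 := eigIso_eq_zero (γ := γ) hb x hμ
      rw [eigIso] at h3
      rw [eigIso, h3]
      simp
  rw [← h1.tsum_eq, ENNReal.ofReal_tsum_of_nonneg (fun μ => ?_) h1.summable]
  · rfl
  · have := posPart_pos μ
    positivity

lemma energy_sinIso_invLap (x : L2 d Real.pi) :
    energy (sinIso d) (fun n => (((n : ℝ) + 1) ^ 4)⁻¹) x = ENNReal.ofReal (‖invLap d x‖ ^ 2) := by
  rw [← energy_one (sinIso d)]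
  refine tsum_congr fun n => ?_
  rw [sinIso_invLap, norm_smul, Real.norm_of_nonneg (by positivity)]
  congr 1
  field_simp

/-- `∑_μ μ^{2α} ‖P_μ x‖²`. -/
def powEnergy (T m : ℝ) (d : ℕ) (α : ℝ) (x : L2 d Real.pi) : ℝ≥0∞ :=
  ∑' μ, ENNReal.ofReal (‖powComponents T m d α x μ‖ ^ 2)

/-- `∑_n n^{2 s} ‖x_n‖²` for the sine coefficients `x_n`. -/
def sinEnergy (d : ℕ) (s : ℝ) (x : L2 d Real.pi) : ℝ≥0∞ :=
  energy (sinIso d) (fun n => ((n : ℝ) + 1) ^ (2 * s)) x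

lemma powEnergy_eq {T m : ℝ} (hT : 0 < T) (hm : 0 < m) (α : ℝ) (x : L2 d Real.pi) :
    powEnergy T m d α x = energy (eigIso d (T / (Real.pi * m)) (inv_nonneg.2 hm.le))
      (fun μ => posPart μ ^ (2 * α)) x := by
  rw [energy_eigIso_congr _ (w := fun μ => (μ ^ α) ^ 2)]
  · refine tsum_congr fun μ => ?_
    change ENNReal.ofReal (‖(μ ^ α) • eigenproj T m d μ x‖ ^ 2) = _
    rw [norm_smul, mul_pow, Real.norm_eq_abs, sq_abs, eigenproj_eq hT hm]
    rfl
  · intro μ hμ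
    rw [posPart, if_pos hμ, mul_comm, Real.rpow_mul hμ.le, Real.rpow_ofNat]

/-- The fractional powers of the fourth order operator and of the Dirichlet Laplacian have
equivalent norms. -/
theorem powEnergy_equiv {T m : ℝ} (hT : 0 < T) (hm : 0 < m) (d : ℕ) {α : ℝ}
    (hα : α ∈ Icc (-(1 / 2)) (1 / 2)) : ∃ C : ℝ, 0 < C ∧ ∀ x : L2 d Real.pi,
      powEnergy T m d α x ≤ ENNReal.ofReal C * sinEnergy d (4 * α) x ∧
      sinEnergy d (4 * α) x ≤ ENNReal.ofReal C * powEnergy T m d α x := by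
  set γ := T / (Real.pi * m) with hγ
  have hb : 0 ≤ m⁻¹ := inv_nonneg.2 hm.le
  set C : ℝ := (‖relForm d γ m⁻¹‖ + 1) ^ 2 with hC
  have hC1 : 1 ≤ C := one_le_pow₀ (by linarith [norm_nonneg (relForm d γ m⁻¹)])
  have hC0 : 0 < C := by linarith
  have hv : ∀ μ, 0 ≤ (posPart μ)⁻¹ := fun μ => (inv_pos.2 (posPart_pos μ)).le
  have hu : ∀ n : ℕ, 0 ≤ (((n : ℝ) + 1) ^ 4)⁻¹ := fun n => by positivity
  have b1 : ∀ z, energy (eigIso d γ hb) (fun μ => (posPart μ)⁻¹) z ≤ ENNReal.ofReal C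
      * energy (sinIso d) (fun n => (((n : ℝ) + 1) ^ 4)⁻¹) z := fun z => by
    rw [energy_posPart_inv, energy_sinIso_invLap, ← ENNReal.ofReal_mul hC0.le]
    refine ENNReal.ofReal_le_ofReal ((inner_green_le hb z).trans ?_)
    exact le_mul_of_one_le_left (sq_nonneg _) hC1
  have b2 : ∀ z, energy (sinIso d) (fun n => (((n : ℝ) + 1) ^ 4)⁻¹) z ≤ ENNReal.ofReal C
      * energy (eigIso d γ hb) (fun μ => (posPart μ)⁻¹) z := fun z => by
    rw [energy_posPart_inv, energy_sinIso_invLap, ← ENNReal.ofReal_mul hC0.le]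
    exact ENNReal.ofReal_le_ofReal (le_inner_green hb z)
  have w1 : ∀ θ : ℝ, (fun μ => (posPart μ)⁻¹ ^ θ) = fun μ => posPart μ ^ (-θ) := fun θ =>
    funext fun μ => by rw [Real.inv_rpow (posPart_pos μ).le, Real.rpow_neg (posPart_pos μ).le]
  have w2 : ∀ θ : ℝ, (fun n : ℕ => ((((n : ℝ) + 1) ^ 4)⁻¹) ^ θ)
      = fun n : ℕ => ((n : ℝ) + 1) ^ (-(4 * θ)) := fun θ => funext fun n => by
    rw [Real.inv_rpow (by positivity), Real.rpow_neg (by positivity), ← Real.rpow_natCast,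
      ← Real.rpow_mul (by positivity)]
    norm_num
  have w3 : ∀ θ : ℝ, (fun μ => (posPart μ ^ (-θ))⁻¹) = fun μ => posPart μ ^ θ := fun θ =>
    funext fun μ => by rw [Real.rpow_neg (posPart_pos μ).le, inv_inv]
  have w4 : ∀ θ : ℝ, (fun n : ℕ => (((n : ℝ) + 1) ^ (-θ))⁻¹)
      = fun n : ℕ => ((n : ℝ) + 1) ^ θ := fun θ => funext fun n => by
    rw [Real.rpow_neg (by positivity), inv_inv]
  refine ⟨C, hC0, fun x => ?_⟩
  rw [powEnergy_eq hT hm, sinEnergy]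
  -- For `α ≤ 0`, `(-L̄)^(2α)` is the power `-2α ∈ [0, 1]` of the inverse, and the Heinz inequality
  -- applies directly. For `α > 0` the estimates for `-α` are inverted, which exchanges the two
  -- directions.
  rcases le_or_gt α 0 with h0 | h0
  · have hθ : -(2 * α) ∈ Icc (0 : ℝ) 1 := ⟨by linarith, by linarith [hα.1]⟩
    have c1 := energy_rpow_le (sinIso d) (eigIso d γ hb) hu hv hC1 b1 hθ x
    have c2 := energy_rpow_le (eigIso d γ hb) (sinIso d) hv hu hC1 b2 hθ x
    rw [w1, w2] at c1 c2
    rw [show -(4 * -(2 * α)) = 2 * (4 * α) by ring, neg_neg] at c1 c2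
    exact ⟨c1, c2⟩
  · have hθ : 2 * α ∈ Icc (0 : ℝ) 1 := ⟨by linarith, by linarith [hα.2]⟩
    have c1 := energy_rpow_le (sinIso d) (eigIso d γ hb) hu hv hC1 b1 hθ
    have c2 := energy_rpow_le (eigIso d γ hb) (sinIso d) hv hu hC1 b2 hθ
    rw [w1, w2] at c1 c2
    have hp1 : ∀ μ, 0 < posPart μ ^ (-(2 * α)) := fun μ => Real.rpow_pos_of_pos (posPart_pos μ) _
    have hp2 : ∀ n : ℕ, 0 < ((n : ℝ) + 1) ^ (-(4 * (2 * α))) := fun n => by positivity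
    have e1 := energy_inv_le (sinIso d) (eigIso d γ hb) hp2 hp1 hC0 c2 x
    have e2 := energy_inv_le (eigIso d γ hb) (sinIso d) hp1 hp2 hC0 c1 x
    rw [w3, w4] at e1 e2
    rw [show 4 * (2 * α) = 2 * (4 * α) by ring] at e1 e2
    exact ⟨e1, e2⟩

end Spectral

/-! ### The Schur test and homogeneous kernels. -/

section Schur

/-- The Schur test, for finite sections of a kernel. -/
lemma schur_finite {K : ℕ → ℕ → ℝ} {w x : ℕ → ℝ} {A : ℝ} (hK : ∀ n j, 0 ≤ K n j)
    (hw : ∀ n, 0 < w n) (hA : 0 ≤ A)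
    (h1 : ∀ n (J : Finset ℕ), ∑ j ∈ J, K n j * w j ≤ A * w n)
    (h2 : ∀ j (F : Finset ℕ), ∑ n ∈ F, K n j * w n ≤ A * w j) (F J : Finset ℕ) :
    ∑ n ∈ F, (∑ j ∈ J, K n j * x j) ^ 2 ≤ A ^ 2 * ∑ j ∈ J, x j ^ 2 := by
  -- Cauchy-Schwarz for the factorisation of `(K x)²` as `(K w) * (K x² / w)`.
  have hstep : ∀ n, (∑ j ∈ J, K n j * x j) ^ 2
      ≤ A * w n * ∑ j ∈ J, K n j * (x j ^ 2 / w j) := fun n => by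
    refine (Finset.sum_sq_le_sum_mul_sum_of_sq_le_mul J (f := fun j => K n j * w j)
      (g := fun j => K n j * (x j ^ 2 / w j)) (fun j _ => mul_nonneg (hK n j) (hw j).le)
      (fun j _ => ?_) fun j _ => ?_).trans ?_
    · have := hK n j
      have := hw j
      positivity
    · have := hw j
      refine le_of_eq ?_
      field_simp
    · refine mul_le_mul_of_nonneg_right (h1 n J) (Finset.sum_nonneg fun j _ => ?_)
      have := hK n j
      have := hw j
      positivity
  calc ∑ n ∈ F, (∑ j ∈ J, K n j * x j) ^ 2
      ≤ ∑ n ∈ F, A * w n * ∑ j ∈ J, K n j * (x j ^ 2 / w j) := Finset.sum_le_sum fun n _ => hstep n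
    _ = ∑ j ∈ J, A * (x j ^ 2 / w j) * ∑ n ∈ F, K n j * w n := by
        simp only [Finset.mul_sum]
        rw [Finset.sum_comm]
        refine Finset.sum_congr rfl fun j _ => Finset.sum_congr rfl fun n _ => ?_
        ring
    _ ≤ ∑ j ∈ J, A * (x j ^ 2 / w j) * (A * w j) := by
        refine Finset.sum_le_sum fun j _ => mul_le_mul_of_nonneg_left (h2 j F) ?_
        have := hw j
        positivity
    _ = A ^ 2 * ∑ j ∈ J, x j ^ 2 := by
        rw [Finset.mul_sum]
        refine Finset.sum_congr rfl fun j _ => ?_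
        have := hw j
        field_simp

/-- The Schur test. -/
lemma schur_test {V : Type*} [NormedAddCommGroup V] [InnerProductSpace ℝ V] [CompleteSpace V]
    {K L : ℕ → ℕ → ℝ} {w : ℕ → ℝ} {A : ℝ} (hLK : ∀ n j, |L n j| ≤ K n j)
    (hw : ∀ n, 0 < w n) (hA : 0 ≤ A)
    (h1 : ∀ n (J : Finset ℕ), ∑ j ∈ J, K n j * w j ≤ A * w n)
    (h2 : ∀ j (F : Finset ℕ), ∑ n ∈ F, K n j * w n ≤ A * w j) (c : lp (fun _ : ℕ => V) 2) :
    ∃ r : lp (fun _ : ℕ => V) 2, ‖r‖ ≤ A * ‖c‖ ∧ ∀ n, HasSum (fun j => L n j • c j) (r n) := by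
  have hK : ∀ n j, 0 ≤ K n j := fun n j => (abs_nonneg _).trans (hLK n j)
  have hc := hasSum_norm_sq c
  have hfin : ∀ F J : Finset ℕ, ∑ n ∈ F, (∑ j ∈ J, K n j * ‖c j‖) ^ 2 ≤ (A * ‖c‖) ^ 2 := by
    intro F J
    refine (schur_finite (x := fun j => ‖c j‖) hK hw hA h1 h2 F J).trans ?_
    rw [mul_pow]
    gcongr
    exact sum_le_hasSum J (fun j _ => sq_nonneg _) hc
  have hAc : 0 ≤ A * ‖c‖ := by positivity
  have hs : ∀ n, Summable fun j => K n j * ‖c j‖ := fun n => by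
    refine summable_of_sum_le (c := A * ‖c‖)
      (fun j => mul_nonneg (hK n j) (norm_nonneg _)) fun J => ?_
    have := hfin {n} J
    rw [Finset.sum_singleton] at this
    exact (le_abs_self _).trans (abs_le_of_sq_le_sq this hAc)
  have hnorm : ∀ n j, ‖L n j • c j‖ ≤ K n j * ‖c j‖ := fun n j => by
    rw [norm_smul]
    exact mul_le_mul_of_nonneg_right (hLK n j) (norm_nonneg _)
  have hsum : ∀ n, Summable fun j => L n j • c j := fun n =>
    Summable.of_norm_bounded (hs n) (hnorm n)
  have hr : ∀ F : Finset ℕ, ∑ n ∈ F, ‖∑' j, L n j • c j‖ ^ 2 ≤ (A * ‖c‖) ^ 2 := by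
    intro F
    have hlim : Filter.Tendsto (fun J : Finset ℕ => ∑ n ∈ F, (∑ j ∈ J, K n j * ‖c j‖) ^ 2)
        Filter.atTop (nhds (∑ n ∈ F, (∑' j, K n j * ‖c j‖) ^ 2)) :=
      tendsto_finsetSum _ fun n _ => (hs n).hasSum.pow 2
    refine le_trans (Finset.sum_le_sum fun n _ => ?_)
      (le_of_tendsto hlim (Filter.Eventually.of_forall fun J => hfin F J))
    gcongr
    exact tsum_of_norm_bounded (hs n).hasSum (hnorm n)
  have hsumr : Summable fun n => ‖∑' j, L n j • c j‖ ^ 2 :=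
    summable_of_sum_le (fun n => sq_nonneg _) hr
  refine ⟨⟨fun n => ∑' j, L n j • c j, memℓp_gen (by simpa using hsumr)⟩, ?_,
    fun n => (hsum n).hasSum⟩
  refine (sq_le_sq₀ (norm_nonneg _) hAc).1 ?_
  rw [← (hasSum_norm_sq _).tsum_eq]
  exact hsumr.tsum_le_of_sum_le hr

/-- Bernoulli's inequality for exponents in `[0, 1]`. It serves as a discrete substitute for
integral comparison: power sums are bounded by telescoping. -/
lemma rpow_sub_rpow_ge {q a : ℝ} (hq : 1 ≤ q) (ha0 : 0 ≤ a) (ha1 : a ≤ 1) :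
    (q - 1) ^ a ≤ q ^ a * (1 - a / q) := by
  have hq0 : 0 < q := by linarith
  have h1 : -1 ≤ -(1 / q) := by
    rw [neg_le_neg_iff, div_le_one hq0]
    exact hq
  have h2 := rpow_one_add_le_one_add_mul_self h1 ha0 ha1
  have h3 : q - 1 = q * (1 + -(1 / q)) := by
    field_simp
    ring
  rw [h3, Real.mul_rpow hq0.le (by linarith)]
  refine mul_le_mul_of_nonneg_left (h2.trans (le_of_eq ?_)) (by positivity)
  ring

lemma sum_range_rpow_le {a : ℝ} (ha0 : 0 ≤ a) (ha1 : a < 1) (m : ℕ) :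
    ∑ j ∈ Finset.range m, ((j : ℝ) + 1) ^ (-a) ≤ (1 - a)⁻¹ * (m : ℝ) ^ (1 - a) := by
  have h1a : 0 < 1 - a := by linarith
  induction m with
  | zero => simp [Real.zero_rpow h1a.ne']
  | succ m ih =>
    rw [Finset.sum_range_succ]
    have h := rpow_sub_rpow_ge (q := (m : ℝ) + 1) (by linarith [m.cast_nonneg (α := ℝ)]) h1a.le
      (by linarith)
    rw [add_sub_cancel_right] at h
    have hm : (0 : ℝ) < (m : ℝ) + 1 := by positivity
    have h2 : ((m : ℝ) + 1) ^ (1 - a) * (1 - (1 - a) / ((m : ℝ) + 1))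
        = ((m : ℝ) + 1) ^ (1 - a) - (1 - a) * ((m : ℝ) + 1) ^ (-a) := by
      rw [show -a = 1 - a - 1 by ring, Real.rpow_sub_one hm.ne']
      ring
    rw [h2] at h
    have h3 : (1 - a)⁻¹ * (m : ℝ) ^ (1 - a)
        ≤ (1 - a)⁻¹ * (((m : ℝ) + 1) ^ (1 - a) - (1 - a) * ((m : ℝ) + 1) ^ (-a)) := by gcongr
    rw [mul_sub, inv_mul_cancel_left₀ h1a.ne'] at h3
    push_cast
    linarith

lemma sum_Ico_rpow_le {c : ℝ} (hc0 : 0 < c) (hc1 : c ≤ 1) (n m : ℕ) :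
    ∑ j ∈ Finset.Ico (n + 1) m, ((j : ℝ) + 1) ^ (-(c + 1)) ≤ c⁻¹ * ((n : ℝ) + 1) ^ (-c) := by
  -- The subtracted `m ^ (-c)` is the tail that makes the induction telescope.
  suffices h : ∀ m : ℕ, n + 1 ≤ m → ∑ j ∈ Finset.Ico (n + 1) m, ((j : ℝ) + 1) ^ (-(c + 1))
      ≤ c⁻¹ * (((n : ℝ) + 1) ^ (-c) - (m : ℝ) ^ (-c)) by
    rcases le_or_gt (n + 1) m with hm | hm
    · refine (h m hm).trans ?_
      gcongr
      have : (0 : ℝ) ≤ (m : ℝ) ^ (-c) := by positivity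
      linarith
    · rw [Finset.Ico_eq_empty_of_le hm.le, Finset.sum_empty]
      positivity
  intro m hm
  induction m, hm using Nat.le_induction with
  | base => simp
  | succ m hm ih =>
    rw [Finset.sum_Ico_succ_top hm]
    have hm1 : (1 : ℝ) ≤ m := by
      have : 1 ≤ m := by omega
      exact_mod_cast this
    have hm0 : (0 : ℝ) < m := by linarith
    have hq0 : (0 : ℝ) < (m : ℝ) + 1 := by linarith
    have h := rpow_sub_rpow_ge (q := (m : ℝ) + 1) (by linarith) hc0.le hc1
    rw [add_sub_cancel_right] at h
    have key : ((m : ℝ) + 1) ^ (-c) * (1 + c / ((m : ℝ) + 1)) ≤ (m : ℝ) ^ (-c) := by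
      rw [Real.rpow_neg hq0.le, Real.rpow_neg hm0.le, ← div_eq_inv_mul,
        le_inv_comm₀ (by positivity) (by positivity), inv_div]
      refine h.trans ?_
      rw [le_div_iff₀ (by positivity), mul_assoc]
      refine mul_le_of_le_one_right (by positivity) ?_
      nlinarith [sq_nonneg (c / ((m : ℝ) + 1))]
    have h2 : ((m : ℝ) + 1) ^ (-c) * (1 + c / ((m : ℝ) + 1))
        = ((m : ℝ) + 1) ^ (-c) + c * ((m : ℝ) + 1) ^ (-(c + 1)) := by
      rw [show -(c + 1) = -c - 1 by ring, Real.rpow_sub_one hq0.ne']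
      ring
    rw [h2] at key
    have h3 : c⁻¹ * (((m : ℝ) + 1) ^ (-c) + c * ((m : ℝ) + 1) ^ (-(c + 1)))
        ≤ c⁻¹ * (m : ℝ) ^ (-c) := by gcongr
    rw [mul_add, inv_mul_cancel_left₀ hc0.ne'] at h3
    push_cast
    linarith

/-- A symmetric homogeneous kernel of degree `-1`. -/
def homKernel (ρ p q : ℝ) : ℝ := max p q ^ (ρ - 1) * min p q ^ (-ρ)

lemma homKernel_comm (ρ p q : ℝ) : homKernel ρ p q = homKernel ρ q p := by
  rw [homKernel, homKernel, max_comm, min_comm]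

/-- The Schur weight is `(j + 1)^(-1/2)`, the critical power for degree `-1`. Below `n` the sum
behaves like `∑ j^(-ρ - 1/2)` and above `n` like `∑ j^(ρ - 3/2)`; `ρ < 1/2` is what controls both by
the same power of `n + 1`. -/
lemma sum_homKernel_le {ρ : ℝ} (h0 : 0 ≤ ρ) (h1 : ρ < 1 / 2) (n : ℕ) (J : Finset ℕ) :
    ∑ j ∈ J, homKernel ρ ((n : ℝ) + 1) ((j : ℝ) + 1) * ((j : ℝ) + 1) ^ (-(1 / 2) : ℝ)
      ≤ 2 * (1 / 2 - ρ)⁻¹ * ((n : ℝ) + 1) ^ (-(1 / 2) : ℝ) := by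
  have hn : (0 : ℝ) < (n : ℝ) + 1 := by positivity
  have hδ : 0 < 1 / 2 - ρ := by linarith
  rw [← Finset.sum_filter_add_sum_filter_not J (fun j => j ≤ n)]
  have e1 : ∑ j ∈ J with j ≤ n, homKernel ρ ((n : ℝ) + 1) ((j : ℝ) + 1)
      * ((j : ℝ) + 1) ^ (-(1 / 2) : ℝ) ≤ (1 / 2 - ρ)⁻¹ * ((n : ℝ) + 1) ^ (-(1 / 2) : ℝ) := by
    calc _ = ∑ j ∈ J with j ≤ n, ((n : ℝ) + 1) ^ (ρ - 1) * ((j : ℝ) + 1) ^ (-(ρ + 1 / 2)) := by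
          refine Finset.sum_congr rfl fun j hj => ?_
          have hjn : (j : ℝ) ≤ n := by exact_mod_cast (Finset.mem_filter.1 hj).2
          rw [homKernel, max_eq_left (by linarith), min_eq_right (by linarith), mul_assoc,
            ← Real.rpow_add (by positivity)]
          ring_nf
      _ ≤ ∑ j ∈ Finset.range (n + 1), ((n : ℝ) + 1) ^ (ρ - 1) * ((j : ℝ) + 1) ^ (-(ρ + 1 / 2)) := by
          refine Finset.sum_le_sum_of_subset_of_nonneg (fun j hj => ?_) fun j _ _ => by positivity
          rw [Finset.mem_range]
          have := (Finset.mem_filter.1 hj).2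
          omega
      _ ≤ ((n : ℝ) + 1) ^ (ρ - 1) * ((1 - (ρ + 1 / 2))⁻¹ * ((n : ℝ) + 1) ^ (1 - (ρ + 1 / 2))) := by
          rw [← Finset.mul_sum]
          have := sum_range_rpow_le (a := ρ + 1 / 2) (by linarith) (by linarith) (n + 1)
          push_cast at this
          gcongr
      _ = _ := by
          rw [mul_left_comm, ← Real.rpow_add hn]
          ring_nf
  have e2 : ∑ j ∈ J with ¬ j ≤ n, homKernel ρ ((n : ℝ) + 1) ((j : ℝ) + 1)
      * ((j : ℝ) + 1) ^ (-(1 / 2) : ℝ) ≤ (1 / 2 - ρ)⁻¹ * ((n : ℝ) + 1) ^ (-(1 / 2) : ℝ) := by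
    calc _ = ∑ j ∈ J with ¬ j ≤ n, ((n : ℝ) + 1) ^ (-ρ) * ((j : ℝ) + 1) ^ (-(1 / 2 - ρ + 1)) := by
          refine Finset.sum_congr rfl fun j hj => ?_
          have hjn : (n : ℝ) ≤ j := by
            have := (Finset.mem_filter.1 hj).2
            push Not at this
            exact_mod_cast this.le
          rw [homKernel, max_eq_right (by linarith), min_eq_left (by linarith), mul_right_comm,
            ← Real.rpow_add (by positivity), mul_comm]
          ring_nf
      _ ≤ ∑ j ∈ Finset.Ico (n + 1) (J.sup id + 1),
            ((n : ℝ) + 1) ^ (-ρ) * ((j : ℝ) + 1) ^ (-(1 / 2 - ρ + 1)) := by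
          refine Finset.sum_le_sum_of_subset_of_nonneg (fun j hj => ?_) fun j _ _ => by positivity
          rw [Finset.mem_Ico]
          have h3 := Finset.mem_filter.1 hj
          have h4 := Finset.le_sup (f := id) h3.1
          simp only [id] at h4
          omega
      _ ≤ ((n : ℝ) + 1) ^ (-ρ) * ((1 / 2 - ρ)⁻¹ * ((n : ℝ) + 1) ^ (-(1 / 2 - ρ))) := by
          rw [← Finset.mul_sum]
          have := sum_Ico_rpow_le hδ (by linarith) n (J.sup id + 1)
          gcongr
      _ = _ := by
          rw [mul_left_comm, ← Real.rpow_add hn]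
          ring_nf
  linarith

/-- Used with `y = p / q`: the factor `1 - 1 / y` cancels the singularity of `p / (p² - q²)` at `p =
q`, and `y ^ ρ` records the growth. -/
lemma abs_rpow_sub_one_le {y σ ρ : ℝ} (hy : 1 ≤ y) (h1 : -2 ≤ σ) (h2 : σ ≤ 1) (h0 : 0 ≤ ρ)
    (hρ : σ ≤ ρ) : |y ^ σ - 1| ≤ 2 * ((1 - 1 / y) * y ^ ρ) := by
  have hy0 : 0 < y := by linarith
  have hy1 : 0 ≤ 1 - 1 / y := by
    rw [sub_nonneg, div_le_one hy0]
    exact hy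
  have hyρ : 1 ≤ y ^ ρ := Real.one_le_rpow hy h0
  rcases le_or_gt 0 σ with hσ | hσ
  · rw [abs_of_nonneg (by linarith [Real.one_le_rpow hy hσ])]
    have e : y ^ σ * (1 / y) ≤ 1 := by
      rw [mul_one_div, div_le_one hy0]
      calc y ^ σ ≤ y ^ (1 : ℝ) := Real.rpow_le_rpow_of_exponent_le hy h2
        _ = y := Real.rpow_one y
    have e2 : y ^ σ ≤ y ^ ρ := Real.rpow_le_rpow_of_exponent_le hy hρ
    nlinarith
  · rw [abs_of_nonpos (by linarith [Real.rpow_le_one_of_one_le_of_nonpos hy hσ.le])]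
    have e : (1 / y) ^ 2 ≤ y ^ σ := by
      calc (1 / y) ^ 2 = y ^ (-2 : ℝ) := by
            rw [Real.rpow_neg hy0.le]
            norm_num
        _ ≤ y ^ σ := Real.rpow_le_rpow_of_exponent_le hy h1
    have e3 : 1 / y ≤ 1 := by linarith
    nlinarith [mul_nonneg hy1 (sub_nonneg.2 hyρ)]

/-- The counterpart for `p < q`, with `y = q / p`. The kernel decays one power faster on this side,
whence the condition `-σ - 1 ≤ ρ` in place of `σ ≤ ρ`. -/
lemma abs_rpow_neg_sub_one_le {y σ ρ : ℝ} (hy : 1 ≤ y) (h1 : -2 ≤ σ) (h2 : σ ≤ 1) (h0 : 0 ≤ ρ)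
    (hρ : -σ - 1 ≤ ρ) : |y ^ (-σ) - 1| ≤ 2 * ((y - 1) * y ^ ρ) := by
  have hy0 : 0 < y := by linarith
  have hyρ : 1 ≤ y ^ ρ := Real.one_le_rpow hy h0
  have hy1 : 0 ≤ y - 1 := by linarith
  rcases le_or_gt 0 σ with hσ | hσ
  · rw [abs_of_nonpos (by
      linarith [Real.rpow_le_one_of_one_le_of_nonpos hy (neg_nonpos.2 hσ)])]
    have e : 1 / y ≤ y ^ (-σ) := by
      calc 1 / y = y ^ (-1 : ℝ) := by rw [Real.rpow_neg_one, one_div]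
        _ ≤ _ := Real.rpow_le_rpow_of_exponent_le hy (by linarith)
    have e2 : 1 - 1 / y ≤ y - 1 := by
      rw [sub_le_sub_iff]
      have : y + 1 / y - 2 = (y - 1) ^ 2 / y := by
        field_simp
        ring
      have h3 : 0 ≤ (y - 1) ^ 2 / y := by positivity
      linarith
    nlinarith [mul_nonneg hy1 (sub_nonneg.2 hyρ)]
  · rw [abs_of_nonneg (by linarith [Real.one_le_rpow hy (neg_pos.2 hσ).le])]
    have e : y ^ (-σ) ≤ y ^ ρ * y := by
      rw [← Real.rpow_add_one hy0.ne']
      exact Real.rpow_le_rpow_of_exponent_le hy (by linarith)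
    rcases le_or_gt (-σ) 1 with h3 | h3
    · have e3 : y ^ (-σ) ≤ y := by
        calc y ^ (-σ) ≤ y ^ (1 : ℝ) := Real.rpow_le_rpow_of_exponent_le hy h3
          _ = y := Real.rpow_one y
      nlinarith [mul_nonneg hy1 (sub_nonneg.2 hyρ)]
    · have e4 : y ^ (-σ) = y ^ (-σ - 1) * y := by
        rw [← Real.rpow_add_one hy0.ne']
        ring_nf
      have e5 : y ^ (-σ - 1) ≤ y := by
        calc y ^ (-σ - 1) ≤ y ^ (1 : ℝ) := Real.rpow_le_rpow_of_exponent_le hy (by linarith)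
          _ = y := Real.rpow_one y
      have e6 : y ^ (-σ - 1) ≤ y ^ ρ := Real.rpow_le_rpow_of_exponent_le hy hρ
      rw [e4]
      nlinarith [mul_nonneg hy1 (sub_nonneg.2 hyρ), mul_nonneg hy1 (sub_nonneg.2 e6)]

/-- The commutator kernel is dominated by a homogeneous kernel. -/
lemma kernel_le_homKernel {p q σ ρ : ℝ} (hp : 0 < p) (hq : 0 < q) (hpq : p ≠ q)
    (h1 : -2 ≤ σ) (h2 : σ ≤ 1) (h0 : 0 ≤ ρ) (hρ : σ ≤ ρ) (hρ' : -σ - 1 ≤ ρ) :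
    p / |p ^ 2 - q ^ 2| * |(p / q) ^ σ - 1| ≤ 2 * homKernel ρ p q := by
  rcases lt_or_gt_of_ne hpq with h | h
  · have hy : 1 ≤ q / p := by rw [le_div_iff₀ hp]; linarith
    have hb := abs_rpow_neg_sub_one_le hy h1 h2 h0 hρ'
    rw [Real.rpow_neg (by positivity), ← Real.inv_rpow (by positivity), inv_div] at hb
    rw [homKernel, max_eq_right h.le, min_eq_left h.le, abs_sub_comm,
      abs_of_pos (by nlinarith : 0 < q ^ 2 - p ^ 2)]
    calc p / (q ^ 2 - p ^ 2) * |(p / q) ^ σ - 1|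
        ≤ p / (q * (q - p)) * (2 * ((q / p - 1) * (q / p) ^ ρ)) := by
          have : 0 < q - p := by linarith
          gcongr
          nlinarith
      _ = 2 * (q ^ (ρ - 1) * p ^ (-ρ)) := by
          have : q - p ≠ 0 := by linarith
          rw [Real.div_rpow hq.le hp.le, Real.rpow_sub_one hq.ne', Real.rpow_neg hp.le]
          field_simp
  · have hy : 1 ≤ p / q := by rw [le_div_iff₀ hq]; linarith
    have hb := abs_rpow_sub_one_le hy h1 h2 h0 hρ
    rw [homKernel, max_eq_left h.le, min_eq_right h.le,
      abs_of_pos (by nlinarith : 0 < p ^ 2 - q ^ 2)]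
    calc p / (p ^ 2 - q ^ 2) * |(p / q) ^ σ - 1|
        ≤ p / (p * (p - q)) * (2 * ((1 - 1 / (p / q)) * (p / q) ^ ρ)) := by
          have : 0 < p - q := by linarith
          gcongr
          nlinarith
      _ = 2 * (p ^ (ρ - 1) * q ^ (-ρ)) := by
          have : p - q ≠ 0 := by linarith
          rw [Real.div_rpow hp.le hq.le, Real.rpow_sub_one hp.ne', Real.rpow_neg hq.le]
          field_simp

end Schur

/-! ### From cosine series to sine series. -/

/-- The matrix of sine coefficients of cosines. -/
def sinCos (n k : ℕ) : ℝ := ∫ t, sinFun n t * cosFun k t ∂(leb Real.pi)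

lemma hasSum_sinCos {d : ℕ} (x : L2 d Real.pi) (n : ℕ) :
    HasSum (fun k => sinCos n k • cosIso d x k) (sinIso d x n) := by
  have := isCompleteOrtho_cosFun.hasSum_integral_smul (isCompleteOrtho_sinFun.memLp n) x
  rwa [← isCompleteOrtho_sinFun.iso_apply] at this

lemma sinCos_eq (n k : ℕ) : sinCos n k = √(2 / Real.pi) * √((if k = 0 then 1 else 2) / Real.pi)
    * ∫ t, Real.sin (((n + 1 : ℕ) : ℤ) * t) * Real.cos ((k : ℤ) * t) ∂(leb Real.pi) := by
  rw [sinCos, ← integral_const_mul]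
  refine integral_congr_ae (ae_of_all _ fun t => ?_)
  simp only [sinFun, cosFun]
  ring

lemma sinCos_self (n : ℕ) : sinCos n (n + 1) = 0 := by
  rw [sinCos_eq, integral_sin_mul_cos_self, mul_zero]

lemma sinCos_of_ne {n k : ℕ} (h : n + 1 ≠ k) : sinCos n k
    = √(2 / Real.pi) * √((if k = 0 then 1 else 2) / Real.pi)
      * (((n : ℝ) + 1) * (1 - (-1) ^ (n + 1 + k)) / (((n : ℝ) + 1) ^ 2 - (k : ℝ) ^ 2)) := by
  rw [sinCos_eq, integral_sin_mul_cos]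
  · congr 1
    push_cast
    congr 3
  · intro h2
    refine h ?_
    have : (n + 1) ^ 2 = k ^ 2 := by exact_mod_cast h2
    exact Nat.pow_left_injective two_ne_zero this

/-- On the diagonal both sides vanish, the right one by the convention for division by zero. -/
lemma abs_sinCos_le (n j : ℕ) : |sinCos n (j + 1)|
    ≤ 2 * (((n : ℝ) + 1) / |((n : ℝ) + 1) ^ 2 - ((j : ℝ) + 1) ^ 2|) := by
  rcases eq_or_ne n j with rfl | h
  · rw [sinCos_self]
    simp
  · rw [sinCos_of_ne (by omega), if_neg (by omega), Real.mul_self_sqrt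
      (by have := Real.pi_pos; positivity), abs_mul, abs_div (_ * _), abs_mul (_ + _)]
    push_cast
    have h1 : |(1 : ℝ) - (-1) ^ (n + 1 + (j + 1))| ≤ 2 := by
      rcases neg_one_pow_eq_or ℝ (n + 1 + (j + 1)) with h | h <;> rw [h] <;> norm_num
    have h2 : |2 / Real.pi| ≤ 1 := by
      rw [abs_of_nonneg (by have := Real.pi_pos; positivity), div_le_one Real.pi_pos]
      exact Real.two_le_pi
    have h3 : |(n : ℝ) + 1| = n + 1 := abs_of_nonneg (by positivity)
    rw [h3]
    calc _ ≤ 1 * (((n : ℝ) + 1) * 2 / |((n : ℝ) + 1) ^ 2 - ((j : ℝ) + 1) ^ 2|) := by gcongr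
      _ = _ := by ring

/-- Cosine to sine conversion, as an identity between boundary values. -/
lemma sinCos_mul (n k : ℕ) : sinCos n k * (1 - ((k : ℝ) / ((n : ℝ) + 1)) ^ 2)
    = √(2 / Real.pi) / ((n : ℝ) + 1) * (cosFun k 0 - (-1) ^ (n + 1) * cosFun k Real.pi) := by
  have h0 : cosFun k 0 = √((if k = 0 then 1 else 2) / Real.pi) := by simp [cosFun]
  have hpi : cosFun k Real.pi = √((if k = 0 then 1 else 2) / Real.pi) * (-1) ^ k := by
    rw [cosFun, Real.cos_int_mul_pi]
    simp
  have hn : (n : ℝ) + 1 ≠ 0 := by positivity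
  rw [h0, hpi]
  rcases eq_or_ne (n + 1) k with rfl | h
  · rw [sinCos_self, mul_left_comm, ← mul_pow]
    simp
  · have hne : ((n : ℝ) + 1) ^ 2 - (k : ℝ) ^ 2 ≠ 0 := by
      intro h2
      refine h ?_
      have : (((n + 1) ^ 2 : ℕ) : ℝ) = ((k ^ 2 : ℕ) : ℝ) := by
        push_cast
        linarith
      exact Nat.pow_left_injective two_ne_zero (by exact_mod_cast this)
    rw [sinCos_of_ne h, pow_add]
    field_simp

/-- The weighted conversion from cosine to sine coefficients is bounded. -/
lemma exists_weighted_sinCos (d : ℕ) {σ : ℝ} (h1 : -(3 / 2) < σ) (h2 : σ < 1 / 2) :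
    ∃ A : ℝ, 0 ≤ A ∧ ∀ c : lp (fun _ : ℕ => E d) 2, ∃ r : lp (fun _ : ℕ => E d) 2,
      ‖r‖ ≤ A * ‖c‖ ∧ ∀ n, HasSum (fun j =>
        (sinCos n (j + 1) * (((n : ℝ) + 1) / ((j : ℝ) + 1)) ^ σ) • c j) (r n) := by
  -- The least `ρ` allowed by the kernel bound; it is below `1/2` precisely because `-3/2 < σ <
  -- 1/2`.
  obtain ⟨ρ, h0, hρ, hρ1, hρ2⟩ : ∃ ρ : ℝ, 0 ≤ ρ ∧ ρ < 1 / 2 ∧ σ ≤ ρ ∧ -σ - 1 ≤ ρ :=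
    ⟨max 0 (max σ (-σ - 1)), le_max_left _ _, by
      rw [max_lt_iff, max_lt_iff]
      exact ⟨by norm_num, h2, by linarith⟩,
      (le_max_left _ _).trans (le_max_right _ _), (le_max_right _ _).trans (le_max_right _ _)⟩
  set K : ℕ → ℕ → ℝ := fun n j => 4 * homKernel ρ ((n : ℝ) + 1) ((j : ℝ) + 1) with hK
  -- The weighted matrix minus the unweighted one. The latter converts between orthonormal bases and
  -- needs no estimate, so the Schur test is applied only to `L`, whose singularity at the diagonal
  -- has been cancelled.
  set L : ℕ → ℕ → ℝ := fun n j =>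
    sinCos n (j + 1) * ((((n : ℝ) + 1) / ((j : ℝ) + 1)) ^ σ - 1) with hL
  set A : ℝ := 4 * (2 * (1 / 2 - ρ)⁻¹) with hA
  have hA0 : 0 ≤ A := by
    have : 0 < 1 / 2 - ρ := by linarith
    positivity
  have hLK : ∀ n j, |L n j| ≤ K n j := by
    intro n j
    rcases eq_or_ne n j with rfl | hnj
    · rw [hL]
      beta_reduce
      rw [sinCos_self, zero_mul, abs_zero, hK]
      unfold homKernel
      positivity
    · have hne : (n : ℝ) + 1 ≠ (j : ℝ) + 1 := by
        intro h
        exact hnj (by exact_mod_cast add_right_cancel h)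
      have hk := kernel_le_homKernel (p := (n : ℝ) + 1) (q := (j : ℝ) + 1) (σ := σ) (ρ := ρ)
        (by positivity) (by positivity) hne (by linarith) (by linarith) h0 hρ1 hρ2
      rw [hL]
      beta_reduce
      rw [abs_mul]
      calc _ ≤ 2 * (((n : ℝ) + 1) / |((n : ℝ) + 1) ^ 2 - ((j : ℝ) + 1) ^ 2|)
            * |(((n : ℝ) + 1) / ((j : ℝ) + 1)) ^ σ - 1| := by
            gcongr
            exact abs_sinCos_le n j
        _ ≤ _ := by
            rw [mul_assoc]
            have : K n j = 2 * (2 * homKernel ρ ((n : ℝ) + 1) ((j : ℝ) + 1)) := by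
              rw [hK]
              ring
            rw [this]
            gcongr
  have hS1 : ∀ n (J : Finset ℕ), ∑ j ∈ J, K n j * ((j : ℝ) + 1) ^ (-(1 / 2) : ℝ)
      ≤ A * ((n : ℝ) + 1) ^ (-(1 / 2) : ℝ) := fun n J => by
    have h3 := mul_le_mul_of_nonneg_left (sum_homKernel_le h0 hρ n J) (by norm_num : (0 : ℝ) ≤ 4)
    rw [Finset.mul_sum] at h3
    refine le_trans (le_of_eq ?_) (h3.trans (le_of_eq ?_))
    · refine Finset.sum_congr rfl fun j _ => ?_
      rw [hK]
      ring
    · rw [hA]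
      ring
  have hS2 : ∀ j (F : Finset ℕ), ∑ n ∈ F, K n j * ((n : ℝ) + 1) ^ (-(1 / 2) : ℝ)
      ≤ A * ((j : ℝ) + 1) ^ (-(1 / 2) : ℝ) := fun j F => by
    refine le_trans (le_of_eq ?_) (hS1 j F)
    refine Finset.sum_congr rfl fun n _ => ?_
    rw [hK]
    beta_reduce
    rw [homKernel_comm]
  refine ⟨1 + A, by linarith, fun c => ?_⟩
  obtain ⟨r, hr, hrs⟩ := schur_test (w := fun n : ℕ => ((n : ℝ) + 1) ^ (-(1 / 2) : ℝ)) hLK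
    (fun n => by positivity) hA0 hS1 hS2 c
  have hc := hasSum_norm_sq c
  -- The sequence `c` is indexed by the nonconstant modes; a zero is inserted as the coefficient of
  -- the constant.
  set e : ℕ → E d := fun k => Nat.casesOn k 0 fun j => c j with he
  have hes : HasSum (fun k => ‖e k‖ ^ 2) (‖c‖ ^ 2) := by
    rw [← hasSum_nat_add_iff' 1]
    simpa [he] using hc
  set e' : lp (fun _ : ℕ => E d) 2 := ⟨e, memℓp_gen (by simpa using hes.summable)⟩ with he'
  have hen : ‖e'‖ = ‖c‖ := by
    rw [← sq_eq_sq₀ (norm_nonneg _) (norm_nonneg _)]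
    exact (hasSum_norm_sq e').unique hes
  set y := (cosIso d).symm e' with hy
  have hyn : ‖sinIso d y‖ = ‖c‖ := by
    rw [LinearIsometryEquiv.norm_map, hy, LinearIsometryEquiv.norm_map, hen]
  refine ⟨sinIso d y + r, ?_, fun n => ?_⟩
  · refine (norm_add_le _ _).trans ?_
    rw [hyn]
    linarith
  · have h3 := hasSum_sinCos y n
    have hye : cosIso d y = e' := by rw [hy, LinearIsometryEquiv.apply_symm_apply]
    rw [hye, ← hasSum_nat_add_iff' 1] at h3
    have h4 := h3.add (hrs n)
    have h5 : sinIso d y n - ∑ i ∈ Finset.range 1, sinCos n i • e' i + r n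
        = (sinIso d y + r) n := by
      rw [Finset.sum_range_one, show e' 0 = 0 from rfl, smul_zero, sub_zero]
      rfl
    rw [h5] at h4
    refine h4.congr_fun fun j => ?_
    rw [show e' (j + 1) = c j from rfl, hL, ← add_smul]
    congr 1
    ring

/-- `∑_k (1 + k²)^s ‖x_k‖²` for the cosine coefficients `x_k`. -/
def cosEnergy (d : ℕ) (s : ℝ) (x : L2 d Real.pi) : ℝ≥0∞ :=
  energy (cosIso d) (fun k => (1 + (k : ℝ) ^ 2) ^ s) x

lemma exists_weighted_cos {d : ℕ} {s : ℝ} (hs : 0 ≤ s) {x : L2 d Real.pi}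
    (hx : cosEnergy d s x ≠ ⊤) : ∃ c : lp (fun _ : ℕ => E d) 2,
      (∀ j : ℕ, c j = ((j : ℝ) + 1) ^ s • cosIso d x (j + 1)) ∧
      ENNReal.ofReal (‖c‖ ^ 2) + ENNReal.ofReal (‖cosIso d x 0‖ ^ 2) ≤ cosEnergy d s x := by
  obtain ⟨h1, h2⟩ := energy_ne_top (fun k => by positivity) hx
  have hle : ∀ j : ℕ, ‖((j : ℝ) + 1) ^ s • cosIso d x (j + 1)‖ ^ 2
      ≤ (1 + ((j + 1 : ℕ) : ℝ) ^ 2) ^ s * ‖cosIso d x (j + 1)‖ ^ 2 := fun j => by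
    rw [norm_smul, mul_pow, Real.norm_of_nonneg (by positivity), ← Real.rpow_natCast,
      ← Real.rpow_mul (by positivity), mul_comm s, Real.rpow_mul (by positivity),
      Real.rpow_natCast]
    push_cast
    gcongr
    linarith
  have hs1 : Summable fun j : ℕ => ‖((j : ℝ) + 1) ^ s • cosIso d x (j + 1)‖ ^ 2 :=
    Summable.of_nonneg_of_le (fun j => sq_nonneg _) hle ((summable_nat_add_iff 1).2 h1)
  refine ⟨⟨fun j => ((j : ℝ) + 1) ^ s • cosIso d x (j + 1), memℓp_gen (by simpa using hs1)⟩,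
    fun j => rfl, ?_⟩
  rw [cosEnergy, h2, ← ENNReal.ofReal_add (sq_nonneg _) (sq_nonneg _), ← (hasSum_norm_sq _).tsum_eq,
    h1.tsum_eq_zero_add, add_comm]
  refine ENNReal.ofReal_le_ofReal (add_le_add (by simp) ?_)
  exact hs1.tsum_le_tsum hle ((summable_nat_add_iff 1).2 h1)

lemma sinEnergy_eq_of_coeff {d : ℕ} {s : ℝ} {x : L2 d Real.pi} {r : lp (fun _ : ℕ => E d) 2}
    (h : ∀ n : ℕ, ((n : ℝ) + 1) ^ s • sinIso d x n = r n) :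
    sinEnergy d s x = ENNReal.ofReal (‖r‖ ^ 2) := by
  rw [← tsum_ofReal_norm_sq]
  refine tsum_congr fun n => ?_
  have hw : ((n : ℝ) + 1) ^ (2 * s) = (((n : ℝ) + 1) ^ s) ^ 2 := by
    rw [mul_comm, Real.rpow_mul (by positivity), Real.rpow_ofNat]
  rw [← h, norm_smul, mul_pow, Real.norm_of_nonneg (by positivity), ← hw]

lemma summable_rpow_sq {τ : ℝ} (hτ : τ < -(1 / 2)) :
    Summable fun n : ℕ => (((n : ℝ) + 1) ^ τ) ^ 2 := by
  have := (summable_nat_add_iff 1).2 (Real.summable_nat_rpow.2 (show 2 * τ < -1 by linarith))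
  refine this.congr fun n => ?_
  push_cast
  rw [mul_comm, Real.rpow_mul (by positivity), Real.rpow_ofNat]

/-- Below regularity `1/2`, cosine series are sine series of the same regularity. -/
theorem sinEnergy_le_cosEnergy_of_lt (d : ℕ) {s : ℝ} (h0 : 0 ≤ s) (h1 : s < 1 / 2) :
    ∃ C : ℝ, 0 < C ∧ ∀ x : L2 d Real.pi,
      sinEnergy d s x ≤ ENNReal.ofReal C * cosEnergy d s x := by
  obtain ⟨A, hA, hT⟩ := exists_weighted_sinCos d (σ := s) (by linarith) h1
  -- The constant mode is treated apart: its sine coefficients decay like `1 / (n + 1)`, so with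
  -- weight `(n + 1)^s` they are square summable because `s < 1/2`.
  have hz : ∀ n : ℕ, |((n : ℝ) + 1) ^ s * sinCos n 0| ≤ 2 * ((n : ℝ) + 1) ^ (s - 1) := fun n => by
    rw [abs_mul, abs_of_nonneg (by positivity), Real.rpow_sub_one (by positivity),
      sinCos_of_ne (by omega), abs_mul]
    have e1 : |√(2 / Real.pi) * √((if (0 : ℕ) = 0 then 1 else 2) / Real.pi)| ≤ 1 := by
      refine abs_sqrt_mul_le_one le_rfl ?_
      rw [← mul_one (√_)]
      exact abs_sqrt_mul_le_one (by norm_num) (by norm_num)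
    have e2 : |((n : ℝ) + 1) * (1 - (-1) ^ (n + 1 + 0)) / (((n : ℝ) + 1) ^ 2 - ((0 : ℕ) : ℝ) ^ 2)|
        ≤ 2 / ((n : ℝ) + 1) := by
      have h3 : |(1 : ℝ) - (-1) ^ (n + 1 + 0)| ≤ 2 := by
        rcases neg_one_pow_eq_or ℝ (n + 1 + 0) with h | h <;> rw [h] <;> norm_num
      have h4 : ((n : ℝ) + 1) * (1 - (-1) ^ (n + 1 + 0)) / (((n : ℝ) + 1) ^ 2 - ((0 : ℕ) : ℝ) ^ 2)
          = (1 - (-1) ^ (n + 1 + 0)) / ((n : ℝ) + 1) := by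
        push_cast
        field_simp
        simp
        ring
      rw [h4, abs_div, abs_of_nonneg (by positivity : 0 ≤ (n : ℝ) + 1)]
      gcongr
    calc _ ≤ ((n : ℝ) + 1) ^ s * (1 * (2 / ((n : ℝ) + 1))) := by gcongr
      _ = _ := by ring
  have hzs : Summable fun n : ℕ => (2 * ((n : ℝ) + 1) ^ (s - 1)) ^ 2 := by
    simp only [mul_pow]
    exact (summable_rpow_sq (by linarith)).mul_left _
  set D : ℝ := ∑' n : ℕ, (2 * ((n : ℝ) + 1) ^ (s - 1)) ^ 2 with hD
  have hD0 : 0 ≤ D := tsum_nonneg fun n => sq_nonneg _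
  refine ⟨2 * D + 2 * A ^ 2 + 1, by positivity, fun x => ?_⟩
  rcases eq_or_ne (cosEnergy d s x) ⊤ with htop | htop
  · rw [htop, ENNReal.mul_top (by simp; positivity)]
    exact le_top
  obtain ⟨c, hc, hce⟩ := exists_weighted_cos h0 htop
  obtain ⟨r, hr, hrs⟩ := hT c
  have hz2 : ∀ n : ℕ, ‖(((n : ℝ) + 1) ^ s * sinCos n 0) • cosIso d x 0‖ ^ 2
      ≤ (2 * ((n : ℝ) + 1) ^ (s - 1)) ^ 2 * ‖cosIso d x 0‖ ^ 2 := fun n => by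
    rw [norm_smul, mul_pow]
    gcongr
    exact hz n
  have hzs2 : Summable fun n : ℕ => ‖(((n : ℝ) + 1) ^ s * sinCos n 0) • cosIso d x 0‖ ^ 2 :=
    Summable.of_nonneg_of_le (fun n => sq_nonneg _) hz2 (hzs.mul_right _)
  set w : lp (fun _ : ℕ => E d) 2 :=
    ⟨fun n => (((n : ℝ) + 1) ^ s * sinCos n 0) • cosIso d x 0, memℓp_gen (by simpa using hzs2)⟩
    with hw
  have hwn : ‖w‖ ^ 2 ≤ D * ‖cosIso d x 0‖ ^ 2 := by
    rw [← (hasSum_norm_sq w).tsum_eq, hD, ← tsum_mul_right]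
    exact hzs2.tsum_le_tsum hz2 (hzs.mul_right _)
  have hcoef : ∀ n : ℕ, ((n : ℝ) + 1) ^ s • sinIso d x n = (w + r) n := by
    intro n
    have h3 := (hasSum_sinCos x n).const_smul (((n : ℝ) + 1) ^ s)
    rw [← hasSum_nat_add_iff' 1, Finset.sum_range_one] at h3
    have h4 := (hrs n).unique (h3.congr_fun fun j => by
      rw [hc, smul_smul, smul_smul, Real.div_rpow (by positivity) (by positivity)]
      congr 1
      have : (0 : ℝ) < ((j : ℝ) + 1) ^ s := by positivity
      field_simp)
    change _ = (((n : ℝ) + 1) ^ s * sinCos n 0) • cosIso d x 0 + r n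
    rw [h4, smul_smul]
    abel
  rw [sinEnergy_eq_of_coeff hcoef]
  refine le_trans ?_ (mul_le_mul_right hce _)
  rw [← ENNReal.ofReal_add (sq_nonneg _) (sq_nonneg _), ← ENNReal.ofReal_mul (by positivity)]
  refine ENNReal.ofReal_le_ofReal ?_
  have h5 : ‖w + r‖ ^ 2 ≤ 2 * ‖w‖ ^ 2 + 2 * ‖r‖ ^ 2 := by
    have h6 := norm_add_le w r
    have h7 : ‖w + r‖ ^ 2 ≤ (‖w‖ + ‖r‖) ^ 2 := by gcongr
    nlinarith [sq_nonneg (‖w‖ - ‖r‖)]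
  have h8 : ‖r‖ ^ 2 ≤ A ^ 2 * ‖c‖ ^ 2 := by
    rw [← mul_pow]
    gcongr
  nlinarith [mul_nonneg hD0 (sq_nonneg ‖c‖), mul_nonneg (sq_nonneg A) (sq_nonneg ‖cosIso d x 0‖),
    sq_nonneg ‖c‖, sq_nonneg ‖cosIso d x 0‖]

lemma eqOn_of_ae_eq {d : ℕ} {f g : ℝ → E d} (hf : ContinuousOn f (Icc 0 Real.pi))
    (hg : ContinuousOn g (Icc 0 Real.pi)) (h : f =ᵐ[leb Real.pi] g) :
    EqOn f g (Icc 0 Real.pi) :=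
  Measure.eqOn_Icc_of_ae_eq volume Real.pi_pos.ne h hf hg

/-- A lower bound on the weights makes the coefficients absolutely summable. -/
lemma summable_norm_of_weighted {d : ℕ} {s : ℝ} (hs : 1 / 2 < s) {a : ℕ → E d}
    {c : lp (fun _ : ℕ => E d) 2} (h : ∀ n : ℕ, c n = ((n : ℝ) + 1) ^ s • a n) :
    Summable fun n => ‖a n‖ := by
  refine (summable_mul_of_sq (summable_rpow_sq (τ := -s) (by linarith))
    (hasSum_norm_sq c).summable (fun n => by positivity) fun n => norm_nonneg _).congr fun n => ?_
  rw [h, norm_smul, Real.norm_of_nonneg (by positivity), ← mul_assoc,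
    ← Real.rpow_add (by positivity)]
  simp

lemma summable_norm_cosIso {d : ℕ} {s : ℝ} (hs : 1 / 2 < s) {x : L2 d Real.pi}
    (hx : cosEnergy d s x ≠ ⊤) : Summable fun k => ‖cosIso d x k‖ := by
  obtain ⟨c, hc, -⟩ := exists_weighted_cos (by linarith) hx
  exact (summable_nat_add_iff 1).1 (summable_norm_of_weighted hs hc)

/-- Above regularity `1/2`, cosine series that vanish at the boundary are sine series of the same
regularity. -/
theorem sinEnergy_le_cosEnergy_of_gt (d : ℕ) {s : ℝ} (h0 : 1 / 2 < s) (h1 : s ≤ 2) :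
    ∃ C : ℝ, 0 < C ∧ ∀ (x : L2 d Real.pi) (u : ℝ → E d), ContinuousOn u (Icc 0 Real.pi) →
      u 0 = 0 → u Real.pi = 0 → x =ᵐ[leb Real.pi] u →
      sinEnergy d s x ≤ ENNReal.ofReal C * cosEnergy d s x := by
  obtain ⟨A, hA, hT⟩ := exists_weighted_sinCos d (σ := s - 2) (by linarith) (by linarith)
  refine ⟨A ^ 2 + 1, by positivity, fun x u hu hu0 hupi hxu => ?_⟩
  rcases eq_or_ne (cosEnergy d s x) ⊤ with htop | htop
  · rw [htop, ENNReal.mul_top (by simp; positivity)]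
    exact le_top
  obtain ⟨c, hc, hce⟩ := exists_weighted_cos (by linarith) htop
  obtain ⟨r, hr, hrs⟩ := hT c
  have hsum := summable_norm_cosIso h0 htop
  have heq := eqOn_of_ae_eq hu (isCompleteOrtho_cosFun.continuous_tsum hsum).continuousOn
    (hxu.symm.trans (isCompleteOrtho_cosFun.ae_eq_tsum hsum))
  have hb0 : HasSum (fun k => cosFun k 0 • cosIso d x k) 0 := by
    have h2 := (isCompleteOrtho_cosFun.summable_smul hsum 0).hasSum
    have h3 := heq ⟨le_rfl, Real.pi_pos.le⟩
    rw [hu0] at h3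
    rw [h3]
    exact h2
  have hbpi : HasSum (fun k => cosFun k Real.pi • cosIso d x k) 0 := by
    have h2 := (isCompleteOrtho_cosFun.summable_smul hsum Real.pi).hasSum
    have h3 := heq ⟨Real.pi_pos.le, le_rfl⟩
    rw [hupi] at h3
    rw [h3]
    exact h2
  have hcoef : ∀ n : ℕ, ((n : ℝ) + 1) ^ s • sinIso d x n = r n := by
    intro n
    have hn : (0 : ℝ) < (n : ℝ) + 1 := by positivity
    -- By `sinCos_mul` this sum is a combination of the boundary values of `u`, which vanish.
    have h2 : HasSum (fun k : ℕ => (sinCos n k * (1 - ((k : ℝ) / ((n : ℝ) + 1)) ^ 2))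
        • cosIso d x k) 0 := by
      have h3 := (hb0.sub (hbpi.const_smul ((-1 : ℝ) ^ (n + 1)))).const_smul
        (√(2 / Real.pi) / ((n : ℝ) + 1))
      simp only [smul_zero, sub_zero] at h3
      refine h3.congr_fun fun k => ?_
      rw [sinCos_mul, smul_smul, ← sub_smul, smul_smul]
    -- Subtracting the relation replaces `sinCos n k` by `sinCos n k * (k / (n + 1))²`. This removes
    -- the constant mode and turns the weight of order `s` into one of order `s - 2`.
    have h4 := ((hasSum_sinCos x n).sub h2).const_smul (((n : ℝ) + 1) ^ s)
    rw [sub_zero, ← hasSum_nat_add_iff' 1, Finset.sum_range_one] at h4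
    have h5 := (hrs n).unique (h4.congr_fun fun j => by
      rw [hc, ← sub_smul, smul_smul, smul_smul, Real.div_rpow hn.le (by positivity)]
      congr 1
      have hj : (0 : ℝ) < (j : ℝ) + 1 := by positivity
      rw [Real.rpow_sub hn, Real.rpow_sub hj, Real.rpow_two, Real.rpow_two]
      have : (0 : ℝ) < ((j : ℝ) + 1) ^ s := by positivity
      push_cast
      field_simp
      ring)
    rw [h5]
    simp
  rw [sinEnergy_eq_of_coeff hcoef]
  refine le_trans ?_ (mul_le_mul_right hce _)
  rw [← ENNReal.ofReal_add (sq_nonneg _) (sq_nonneg _), ← ENNReal.ofReal_mul (by positivity)]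
  refine ENNReal.ofReal_le_ofReal ?_
  have h8 : ‖r‖ ^ 2 ≤ A ^ 2 * ‖c‖ ^ 2 := by
    rw [← mul_pow]
    gcongr
  nlinarith [mul_nonneg (sq_nonneg A) (sq_nonneg ‖cosIso d x 0‖),
    sq_nonneg ‖c‖, sq_nonneg ‖cosIso d x 0‖]

/-! ### Even and odd parts, even and odd extensions. -/

lemma two_pi_nonneg : 0 ≤ 2 * Real.pi := by positivity

lemma leb_pi_le : leb Real.pi ≤ leb (2 * Real.pi) :=
  Measure.restrict_mono (Icc_subset_Icc le_rfl (by linarith [Real.pi_pos])) le_rfl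

lemma coeFn_restr {d : ℕ} (F : L2 d (2 * Real.pi)) : restr d F =ᵐ[leb Real.pi] F :=
  ((Lp.memLp F).mono_measure leb_pi_le).coeFn_toLp

lemma integral_fold {V : Type*} [NormedAddCommGroup V] [NormedSpace ℝ V] {f : ℝ → V}
    (hf : Integrable f (leb (2 * Real.pi))) :
    ∫ t, f t ∂(leb (2 * Real.pi)) = ∫ t, (f t + f (2 * Real.pi - t)) ∂(leb Real.pi) := by
  have hpi := Real.pi_pos
  have hi : ∀ a b : ℝ, 0 ≤ a → a ≤ b → b ≤ 2 * Real.pi → IntervalIntegrable f volume a b := by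
    intro a b ha hab hb
    rw [intervalIntegrable_iff_integrableOn_Icc_of_le hab]
    exact IntegrableOn.mono_set hf (Icc_subset_Icc ha hb)
  have h1 := hi 0 Real.pi le_rfl hpi.le (by linarith)
  have h2 := hi Real.pi (2 * Real.pi) hpi.le (by linarith) le_rfl
  have h3 : IntervalIntegrable (fun t => f (2 * Real.pi - t)) volume 0 Real.pi := by
    have := h2.comp_sub_left (2 * Real.pi)
    rw [sub_self, show 2 * Real.pi - Real.pi = Real.pi by ring] at this
    exact this.symm
  rw [integral_leb two_pi_nonneg, integral_leb hpi.le, intervalIntegral.integral_add h1 h3,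
    intervalIntegral.integral_comp_sub_left f, sub_zero,
    show 2 * Real.pi - Real.pi = Real.pi by ring,
    intervalIntegral.integral_add_adjacent_intervals h1 h2]

lemma memLp_reflect {d : ℕ} {F : ℝ → E d} (hF : MemLp F 2 (leb (2 * Real.pi))) :
    MemLp (fun t => F (2 * Real.pi - t)) 2 (leb (2 * Real.pi)) := by
  have h := (volume.measurePreserving_sub_left (2 * Real.pi)).restrict_preimage
    (s := Icc 0 (2 * Real.pi)) measurableSet_Icc
  have hset : (fun t => 2 * Real.pi - t) ⁻¹' Icc 0 (2 * Real.pi) = Icc 0 (2 * Real.pi) := by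
    ext t
    simp only [mem_preimage, mem_Icc]
    constructor <;> rintro ⟨a, b⟩ <;> constructor <;> linarith
  rw [hset] at h
  exact hF.comp_measurePreserving h

/-- Even (`ε = 1`) and odd (`ε = -1`) parts. -/
lemma exists_fold {d : ℕ} (ε : ℝ) (F : L2 d (2 * Real.pi)) : ∃ g : L2 d Real.pi,
    (g =ᵐ[leb Real.pi] fun t => (2⁻¹ : ℝ) • (F t + ε • F (2 * Real.pi - t))) ∧
    ∀ ψ : ℝ → ℝ, Continuous ψ → (∀ t, ψ (2 * Real.pi - t) = ε * ψ t) →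
      ∫ t, ψ t • g t ∂(leb Real.pi) = (2⁻¹ : ℝ) • ∫ t, ψ t • F t ∂(leb (2 * Real.pi)) := by
  have hm : MemLp (fun t => (2⁻¹ : ℝ) • (F t + ε • F (2 * Real.pi - t))) 2 (leb Real.pi) :=
    MemLp.const_smul (f := fun t => F t + ε • F (2 * Real.pi - t))
      (((Lp.memLp F).mono_measure leb_pi_le).add
        (((memLp_reflect (Lp.memLp F)).mono_measure leb_pi_le).const_smul ε)) (2⁻¹ : ℝ)
  refine ⟨hm.toLp _, hm.coeFn_toLp, fun ψ hψ hε => ?_⟩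
  rw [integral_fold (integrable_smul (memLp_of_continuous hψ _) (Lp.memLp F)), ← integral_smul]
  refine integral_congr_ae ?_
  filter_upwards [hm.coeFn_toLp] with t ht
  rw [ht, hε, smul_comm (ψ t), smul_add, smul_smul (ψ t), mul_comm (ψ t)]

/-- Even (`ε = 1`) and odd (`ε = -1`) extensions. -/
lemma exists_extension {d : ℕ} (ε : ℝ) (x : L2 d Real.pi) : ∃ F : L2 d (2 * Real.pi),
    restr d F = x ∧ ∀ (ψ : ℝ → ℝ) (c : ℝ), Continuous ψ → (∀ t, ψ (2 * Real.pi - t) = c * ψ t) →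
      ∫ t, ψ t • F t ∂(leb (2 * Real.pi)) = (1 + c * ε) • ∫ t, ψ t • x t ∂(leb Real.pi) := by
  have hpi := Real.pi_pos
  set y : ℝ → E d := indicator (Icc 0 Real.pi) x with hy
  have hym : MemLp y 2 (leb (2 * Real.pi)) := by
    have : MemLp y 2 volume := (memLp_indicator_iff_restrict measurableSet_Icc).2 (Lp.memLp x)
    exact this.mono_measure Measure.restrict_le_self
  have hm : MemLp (fun t => y t + ε • y (2 * Real.pi - t)) 2 (leb (2 * Real.pi)) :=
    hym.add ((memLp_reflect hym).const_smul ε)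
  have hval : ∀ᵐ t ∂(leb Real.pi), y t = x t ∧ y (2 * Real.pi - t) = 0 := by
    filter_upwards [ae_restrict_mem measurableSet_Icc,
      ae_restrict_of_ae (Measure.ae_ne volume Real.pi)] with t ht hne
    refine ⟨indicator_of_mem ht _, indicator_of_notMem (fun h => hne ?_) _⟩
    linarith [ht.2, h.2]
  refine ⟨hm.toLp _, ?_, fun ψ c hψ hc => ?_⟩
  · ext1
    filter_upwards [coeFn_restr (hm.toLp _), ae_mono leb_pi_le hm.coeFn_toLp, hval] with t a b c
    rw [a, b, c.1, c.2, smul_zero, add_zero]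
  · have e1 : ∫ t, ψ t • hm.toLp _ t ∂(leb (2 * Real.pi))
        = ∫ t, ψ t • (y t + ε • y (2 * Real.pi - t)) ∂(leb (2 * Real.pi)) := by
      refine integral_congr_ae ?_
      filter_upwards [hm.coeFn_toLp] with t ht
      rw [ht]
    rw [e1, integral_fold (integrable_smul (memLp_of_continuous hψ _) hm), ← integral_smul]
    refine integral_congr_ae ?_
    filter_upwards [hval] with t ht
    rw [sub_sub_cancel, ht.1, ht.2, hc, smul_zero, add_zero, zero_add, smul_smul, smul_smul,
      ← add_smul]
    congr 1
    ring

lemma cos_reflect (n : ℤ) (t : ℝ) : Real.cos (n * (2 * Real.pi - t)) = 1 * Real.cos (n * t) := by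
  rw [mul_sub, Real.cos_int_mul_two_pi_sub, one_mul]

lemma sin_reflect (n : ℤ) (t : ℝ) : Real.sin (n * (2 * Real.pi - t)) = -1 * Real.sin (n * t) := by
  rw [mul_sub, Real.sin_int_mul_two_pi_sub]
  ring

/-- The squared norm of the periodic Sobolev space. -/
def perEnergy (d : ℕ) (s : ℝ) (F : L2 d (2 * Real.pi)) : ℝ≥0∞ :=
  ∑' n, ENNReal.ofReal (‖weightedCoeff d s F n‖ ^ 2)

lemma norm_trigCoeff_sq (d : ℕ) (n : ℤ) (F : L2 d (2 * Real.pi)) :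
    ‖trigCoeff d n F‖ ^ 2 = ‖∫ t, Real.cos (n * t) • F t ∂(leb (2 * Real.pi))‖ ^ 2
      + ‖∫ t, Real.sin (n * t) • F t ∂(leb (2 * Real.pi))‖ ^ 2 :=
  WithLp.prod_norm_sq_eq_of_L2 (α := E d) (β := E d) _

lemma norm_weightedCoeff_sq (d : ℕ) (s : ℝ) (F : L2 d (2 * Real.pi)) (n : ℤ) :
    ‖weightedCoeff d s F n‖ ^ 2 = (1 + (n : ℝ) ^ 2) ^ s / (2 * Real.pi)
      * (‖∫ t, Real.cos (n * t) • F t ∂(leb (2 * Real.pi))‖ ^ 2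
        + ‖∫ t, Real.sin (n * t) • F t ∂(leb (2 * Real.pi))‖ ^ 2) := by
  have h1 : weightedCoeff d s F n
      = ((1 + (n : ℝ) ^ 2) ^ (s / 2) / √(2 * Real.pi)) • trigCoeff d n F := rfl
  have h2 : ((1 + (n : ℝ) ^ 2) ^ (s / 2) / √(2 * Real.pi)) ^ 2
      = (1 + (n : ℝ) ^ 2) ^ s / (2 * Real.pi) := by
    rw [div_pow, Real.sq_sqrt two_pi_nonneg, ← Real.rpow_mul_natCast (by positivity)]
    norm_num
  rw [h1, norm_smul, mul_pow, Real.norm_of_nonneg (by positivity), h2, norm_trigCoeff_sq]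

/-- The even part of a periodic Sobolev function. -/
lemma cosEnergy_fold_le {d : ℕ} {s : ℝ} {F : L2 d (2 * Real.pi)} {g : L2 d Real.pi}
    (hg : ∀ ψ : ℝ → ℝ, Continuous ψ → (∀ t, ψ (2 * Real.pi - t) = 1 * ψ t) →
      ∫ t, ψ t • g t ∂(leb Real.pi) = (2⁻¹ : ℝ) • ∫ t, ψ t • F t ∂(leb (2 * Real.pi))) :
    cosEnergy d s g ≤ perEnergy d s F := by
  have hpi := Real.pi_pos
  refine le_trans (ENNReal.tsum_le_tsum fun k => ?_)
    (ENNReal.tsum_comp_le_tsum_of_injective (Nat.cast_injective (R := ℤ))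
      fun n => ENNReal.ofReal (‖weightedCoeff d s F n‖ ^ 2))
  refine ENNReal.ofReal_le_ofReal ?_
  rw [norm_weightedCoeff_sq]
  have h1 : cosIso d g k = (√((if k = 0 then 1 else 2) / Real.pi) * 2⁻¹)
      • ∫ t, Real.cos ((k : ℤ) * t) • F t ∂(leb (2 * Real.pi)) := by
    have h2 := hg (fun t => Real.cos ((k : ℤ) * t)) (by fun_prop) (cos_reflect k)
    rw [cosIso, isCompleteOrtho_cosFun.iso_apply]
    simp only [cosFun, mul_smul]
    rw [integral_smul, h2]
  have h3 : ‖√((if k = 0 then 1 else 2) / Real.pi) * 2⁻¹‖ ^ 2 ≤ 1 / (2 * Real.pi) := by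
    rw [Real.norm_eq_abs, sq_abs, mul_pow, Real.sq_sqrt (by split_ifs <;> positivity)]
    have : (if k = 0 then (1 : ℝ) else 2) ≤ 2 := by split_ifs <;> norm_num
    calc _ ≤ 2 / Real.pi * (2⁻¹ : ℝ) ^ 2 := by gcongr
      _ = _ := by
        field_simp
  rw [h1, norm_smul, mul_pow]
  push_cast at *
  calc _ ≤ (1 + (k : ℝ) ^ 2) ^ s * (1 / (2 * Real.pi)
        * ‖∫ t, Real.cos ((k : ℝ) * t) • F t ∂(leb (2 * Real.pi))‖ ^ 2) := by gcongr
    _ ≤ (1 + (k : ℝ) ^ 2) ^ s * (1 / (2 * Real.pi)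
        * (‖∫ t, Real.cos ((k : ℝ) * t) • F t ∂(leb (2 * Real.pi))‖ ^ 2
          + ‖∫ t, Real.sin ((k : ℝ) * t) • F t ∂(leb (2 * Real.pi))‖ ^ 2)) := by
        gcongr
        exact le_add_of_nonneg_right (sq_nonneg _)
    _ = _ := by ring

/-- The odd part of a periodic Sobolev function. -/
lemma sinEnergy_fold_le {d : ℕ} {s : ℝ} (hs : 0 ≤ s) {F : L2 d (2 * Real.pi)} {g : L2 d Real.pi}
    (hg : ∀ ψ : ℝ → ℝ, Continuous ψ → (∀ t, ψ (2 * Real.pi - t) = -1 * ψ t) →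
      ∫ t, ψ t • g t ∂(leb Real.pi) = (2⁻¹ : ℝ) • ∫ t, ψ t • F t ∂(leb (2 * Real.pi))) :
    sinEnergy d s g ≤ perEnergy d s F := by
  have hpi := Real.pi_pos
  have hinj : Function.Injective fun n : ℕ => ((n + 1 : ℕ) : ℤ) := fun a b h => by
    simpa using h
  refine le_trans (ENNReal.tsum_le_tsum fun n => ?_)
    (ENNReal.tsum_comp_le_tsum_of_injective hinj
      fun n => ENNReal.ofReal (‖weightedCoeff d s F n‖ ^ 2))
  refine ENNReal.ofReal_le_ofReal ?_
  rw [norm_weightedCoeff_sq]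
  have h1 : sinIso d g n = (√(2 / Real.pi) * 2⁻¹)
      • ∫ t, Real.sin (((n + 1 : ℕ) : ℤ) * t) • F t ∂(leb (2 * Real.pi)) := by
    have h2 := hg (fun t => Real.sin (((n + 1 : ℕ) : ℤ) * t)) (by fun_prop) (sin_reflect _)
    rw [sinIso, isCompleteOrtho_sinFun.iso_apply]
    simp only [sinFun, mul_smul]
    rw [integral_smul, h2]
  have h3 : ‖√(2 / Real.pi) * 2⁻¹‖ ^ 2 = 1 / (2 * Real.pi) := by
    rw [Real.norm_eq_abs, sq_abs, mul_pow, Real.sq_sqrt (by positivity)]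
    field_simp
  have h4 : ((n : ℝ) + 1) ^ (2 * s) ≤ (1 + ((n : ℝ) + 1) ^ 2) ^ s := by
    rw [Real.rpow_mul (by positivity), Real.rpow_two]
    exact Real.rpow_le_rpow (by positivity) (by linarith) hs
  rw [h1, norm_smul, mul_pow, h3]
  push_cast
  calc _ ≤ (1 + ((n : ℝ) + 1) ^ 2) ^ s * (1 / (2 * Real.pi)
        * (‖∫ t, Real.cos (((n : ℝ) + 1) * t) • F t ∂(leb (2 * Real.pi))‖ ^ 2
          + ‖∫ t, Real.sin (((n : ℝ) + 1) * t) • F t ∂(leb (2 * Real.pi))‖ ^ 2)) := by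
        gcongr
        exact le_add_of_nonneg_left (sq_nonneg _)
    _ = _ := by ring

/-- The term at `0` is counted twice on the right, which is harmless for an upper bound. -/
lemma tsum_int_le {f : ℤ → ℝ≥0∞} (h : ∀ n : ℤ, f (-n) = f n) : ∑' n, f n ≤ 2 * ∑' n : ℕ, f n := by
  rw [tsum_of_nat_of_neg_add_one ENNReal.summable ENNReal.summable, two_mul]
  refine add_le_add le_rfl ?_
  have h1 : ∀ n : ℕ, f (-((n : ℤ) + 1)) = f ((n + 1 : ℕ) : ℤ) := fun n => by
    rw [h]
    push_cast
    rfl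
  simp only [h1]
  exact ENNReal.tsum_comp_le_tsum_of_injective (add_left_injective 1) fun n : ℕ => f n

lemma weightedCoeff_neg (d : ℕ) (s : ℝ) (F : L2 d (2 * Real.pi)) (n : ℤ) :
    ENNReal.ofReal (‖weightedCoeff d s F (-n)‖ ^ 2)
      = ENNReal.ofReal (‖weightedCoeff d s F n‖ ^ 2) := by
  simp only [norm_weightedCoeff_sq, Int.cast_neg, neg_mul, Real.cos_neg, Real.sin_neg, neg_smul,
    integral_neg, norm_neg, neg_sq]

lemma exists_odd_extension {d : ℕ} {s : ℝ} (hs : 0 ≤ s) (x : L2 d Real.pi) :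
    ∃ F : L2 d (2 * Real.pi), restr d F = x ∧
      perEnergy d s F ≤ ENNReal.ofReal (2 * 2 ^ s) * sinEnergy d s x := by
  have hpi := Real.pi_pos
  obtain ⟨F, hF, hψ⟩ := exists_extension (-1) x
  refine ⟨F, hF, (tsum_int_le (weightedCoeff_neg d s F)).trans ?_⟩
  have hc : ∀ n : ℤ, ∫ t, Real.cos (n * t) • F t ∂(leb (2 * Real.pi)) = 0 := fun n => by
    rw [hψ _ 1 (by fun_prop) (cos_reflect n)]
    norm_num
  have hsn : ∀ n : ℤ, ∫ t, Real.sin (n * t) • F t ∂(leb (2 * Real.pi))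
      = (2 : ℝ) • ∫ t, Real.sin (n * t) • x t ∂(leb Real.pi) := fun n => by
    rw [hψ _ (-1) (by fun_prop) (sin_reflect n)]
    norm_num
  have h0 : ENNReal.ofReal (‖weightedCoeff d s F ((0 : ℕ) : ℤ)‖ ^ 2) = 0 := by
    rw [norm_weightedCoeff_sq, hc, hsn]
    simp
  rw [tsum_eq_zero_add' ENNReal.summable, h0, zero_add, ENNReal.ofReal_mul (by norm_num), mul_assoc,
    show ENNReal.ofReal 2 = 2 by simp]
  gcongr
  rw [sinEnergy, energy, ← ENNReal.tsum_mul_left]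
  refine ENNReal.tsum_le_tsum fun n => ?_
  rw [← ENNReal.ofReal_mul (by positivity)]
  refine ENNReal.ofReal_le_ofReal ?_
  rw [norm_weightedCoeff_sq, hc, hsn]
  have h1 : sinIso d x n = √(2 / Real.pi)
      • ∫ t, Real.sin (((n + 1 : ℕ) : ℤ) * t) • x t ∂(leb Real.pi) := by
    rw [sinIso, isCompleteOrtho_sinFun.iso_apply]
    simp only [sinFun, mul_smul]
    rw [integral_smul]
  have h4 : (1 + ((n : ℝ) + 1) ^ 2) ^ s ≤ 2 ^ s * ((n : ℝ) + 1) ^ (2 * s) := by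
    rw [Real.rpow_mul (by positivity), Real.rpow_two, ← Real.mul_rpow (by norm_num) (by positivity)]
    refine Real.rpow_le_rpow (by positivity) ?_ hs
    nlinarith [n.cast_nonneg (α := ℝ)]
  rw [h1, norm_smul, norm_smul, mul_pow, mul_pow, Real.norm_of_nonneg (Real.sqrt_nonneg _),
    Real.sq_sqrt (by positivity)]
  push_cast
  set I := ‖∫ t, Real.sin (((n : ℝ) + 1) * t) • x t ∂(leb Real.pi)‖ ^ 2
  have hI : 0 ≤ I := sq_nonneg _
  calc _ = (1 + ((n : ℝ) + 1) ^ 2) ^ s * (2 / Real.pi * I) := by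
        simp
        field_simp
    _ ≤ 2 ^ s * ((n : ℝ) + 1) ^ (2 * s) * (2 / Real.pi * I) := by gcongr
    _ = _ := by ring

lemma exists_even_extension {d : ℕ} {s : ℝ} (x : L2 d Real.pi) :
    ∃ F : L2 d (2 * Real.pi), restr d F = x ∧
      perEnergy d s F ≤ 4 * cosEnergy d s x := by
  have hpi := Real.pi_pos
  obtain ⟨F, hF, hψ⟩ := exists_extension 1 x
  refine ⟨F, hF, (tsum_int_le (weightedCoeff_neg d s F)).trans ?_⟩
  have hc : ∀ n : ℤ, ∫ t, Real.cos (n * t) • F t ∂(leb (2 * Real.pi))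
      = (2 : ℝ) • ∫ t, Real.cos (n * t) • x t ∂(leb Real.pi) := fun n => by
    rw [hψ _ 1 (by fun_prop) (cos_reflect n)]
    norm_num
  have hsn : ∀ n : ℤ, ∫ t, Real.sin (n * t) • F t ∂(leb (2 * Real.pi)) = 0 := fun n => by
    rw [hψ _ (-1) (by fun_prop) (sin_reflect n)]
    norm_num
  rw [show (4 : ℝ≥0∞) = 2 * 2 by norm_num, mul_assoc]
  gcongr
  rw [cosEnergy, energy, ← ENNReal.tsum_mul_left]
  refine ENNReal.tsum_le_tsum fun k => ?_
  have h3 : ∀ y : ℝ, (2 : ℝ≥0∞) * ENNReal.ofReal y = ENNReal.ofReal (2 * y) := fun y => by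
    rw [ENNReal.ofReal_mul (by norm_num)]
    simp
  rw [h3]
  refine ENNReal.ofReal_le_ofReal ?_
  rw [norm_weightedCoeff_sq, hc, hsn]
  have h1 : cosIso d x k = √((if k = 0 then 1 else 2) / Real.pi)
      • ∫ t, Real.cos ((k : ℤ) * t) • x t ∂(leb Real.pi) := by
    rw [cosIso, isCompleteOrtho_cosFun.iso_apply]
    simp only [cosFun, mul_smul]
    rw [integral_smul]
  have h2 : 1 / Real.pi ≤ (if k = 0 then 1 else 2) / Real.pi := by
    gcongr
    split_ifs <;> norm_num
  rw [h1, norm_smul, norm_smul, mul_pow, mul_pow, Real.norm_of_nonneg (Real.sqrt_nonneg _),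
    Real.sq_sqrt (by split_ifs <;> positivity)]
  push_cast
  set I := ‖∫ t, Real.cos ((k : ℝ) * t) • x t ∂(leb Real.pi)‖ ^ 2
  have hI : 0 ≤ I := sq_nonneg _
  calc _ = 2 * ((1 + (k : ℝ) ^ 2) ^ s * (1 / Real.pi * I)) := by
        simp
        field_simp
    _ ≤ 2 * ((1 + (k : ℝ) ^ 2) ^ s * ((if k = 0 then 1 else 2) / Real.pi * I)) := by gcongr

/-! ### Sobolev functions on `[0, π]` and their sine coefficients. -/

lemma energy_add_le {ι H : Type*} {G : ι → Type*} [∀ i, NormedAddCommGroup (G i)]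
    [∀ i, InnerProductSpace ℝ (G i)] [NormedAddCommGroup H] [InnerProductSpace ℝ H]
    (U : H ≃ₗᵢ[ℝ] lp G 2) {w : ι → ℝ} (hw : ∀ i, 0 ≤ w i) (x y : H) :
    energy U w (x + y) ≤ 2 * (energy U w x + energy U w y) := by
  simp only [energy]
  rw [← ENNReal.tsum_add, ← ENNReal.tsum_mul_left]
  refine ENNReal.tsum_le_tsum fun i => ?_
  have h2 : ∀ y : ℝ, (2 : ℝ≥0∞) * ENNReal.ofReal y = ENNReal.ofReal (2 * y) := fun y => by
    rw [ENNReal.ofReal_mul (by norm_num)]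
    simp
  have hwi := hw i
  rw [← ENNReal.ofReal_add (by positivity) (by positivity), h2]
  refine ENNReal.ofReal_le_ofReal ?_
  have h3 : ‖U (x + y) i‖ ≤ ‖U x i‖ + ‖U y i‖ := by
    rw [map_add, lp.coeFn_add, Pi.add_apply]
    exact norm_add_le _ _
  have h4 : ‖U (x + y) i‖ ^ 2 ≤ 2 * (‖U x i‖ ^ 2 + ‖U y i‖ ^ 2) :=
    (pow_le_pow_left₀ (norm_nonneg _) h3 2).trans (add_sq_le)
  calc _ ≤ w i * (2 * (‖U x i‖ ^ 2 + ‖U y i‖ ^ 2)) := by gcongr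
    _ = _ := by ring

lemma sinEnergy_add_le {d : ℕ} {s : ℝ} (x y : L2 d Real.pi) :
    sinEnergy d s (x + y) ≤ 2 * (sinEnergy d s x + sinEnergy d s y) :=
  energy_add_le _ (fun n => by positivity) x y

lemma memℓp_two_of_tsum_ne_top {ι : Type*} {G : ι → Type*} [∀ i, NormedAddCommGroup (G i)]
    {v : ∀ i, G i} (h : ∑' i, ENNReal.ofReal (‖v i‖ ^ 2) ≠ ⊤) : Memℓp v 2 := by
  refine (memℓp_gen_iff (by norm_num : 0 < (2 : ℝ≥0∞).toReal)).2 ?_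
  refine (ENNReal.summable_toReal h).congr fun i => ?_
  rw [ENNReal.toReal_ofReal (sq_nonneg _)]
  simp

/-- The quotient norm is an infimum over extensions, so estimates are first obtained for every `N`
above the norm and then pass to the limit. -/
lemma le_ofReal_mul_sq {A : ℝ≥0∞} {C r : ℝ}
    (h : ∀ N : ℝ, r < N → A ≤ ENNReal.ofReal (C * N ^ 2)) : A ≤ ENNReal.ofReal (C * r ^ 2) := by
  have hc : Continuous fun N : ℝ => ENNReal.ofReal (C * N ^ 2) :=
    ENNReal.continuous_ofReal.comp (by fun_prop)
  refine ge_of_tendsto (hc.continuousAt.tendsto.mono_left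
    (nhdsWithin_le_nhds (s := Ioi r))) ?_
  filter_upwards [self_mem_nhdsWithin] with N hN using h N hN

lemma PerSobolev.ofReal_norm_sq {d : ℕ} {s : ℝ} (F : PerSobolev d s) :
    ENNReal.ofReal (‖F‖ ^ 2) = perEnergy d s F.1 :=
  (tsum_ofReal_norm_sq (PerSobolev.coeffs F)).symm

namespace Sobolev

variable {d : ℕ} {s : ℝ}

lemma exists_of_extension {F : L2 d (2 * Real.pi)} {x : L2 d Real.pi} (hF : restr d F = x)
    (h : perEnergy d s F ≠ ⊤) :
    ∃ f : Sobolev d s, f.toL2 = x ∧ ENNReal.ofReal (‖f‖ ^ 2) ≤ perEnergy d s F := by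
  let G : PerSobolev d s := ⟨F, memℓp_two_of_tsum_ne_top h⟩
  have hG : PerSobolev.r d s G ∈ LinearMap.range (PerSobolev.r d s) := ⟨G, rfl⟩
  refine ⟨⟨PerSobolev.r d s G, hG⟩, hF, ?_⟩
  rw [show perEnergy d s F = ENNReal.ofReal (‖G‖ ^ 2) from (PerSobolev.ofReal_norm_sq G).symm]
  refine ENNReal.ofReal_le_ofReal (pow_le_pow_left₀ (norm_nonneg _) ?_ 2)
  have h1 : toQuotient (⟨PerSobolev.r d s G, hG⟩ : Sobolev d s) = Submodule.Quotient.mk G :=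
    (PerSobolev.r d s).quotKerEquivRange_symm_apply_image G hG
  calc _ = ‖toQuotient (⟨PerSobolev.r d s G, hG⟩ : Sobolev d s)‖ := rfl
    _ ≤ ‖G‖ := by
      rw [h1]
      exact Submodule.Quotient.norm_mk_le _ G

lemma exists_extension_of_lt (f : Sobolev d s) {N : ℝ} (hN : ‖f‖ < N) :
    ∃ F : L2 d (2 * Real.pi), restr d F = f.toL2 ∧ perEnergy d s F ≤ ENNReal.ofReal (N ^ 2) := by
  obtain ⟨G, hG, hlt⟩ := QuotientAddGroup.exists_norm_mk_lt (toQuotient f) (sub_pos.2 hN)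
  refine ⟨G.1, ?_, ?_⟩
  · have h1 : toQuotient.symm (toQuotient f) = f := toQuotient.symm_apply_apply f
    have h2 : toQuotient.symm (Submodule.Quotient.mk G : PerSobolev d s ⧸ _) = f := by
      rw [← h1, ← hG]
      rfl
    rw [← h2]
    rfl
  · rw [← PerSobolev.ofReal_norm_sq]
    refine ENNReal.ofReal_le_ofReal (pow_le_pow_left₀ (norm_nonneg _) ?_ 2)
    calc _ ≤ ‖toQuotient f‖ + (N - ‖f‖) := hlt.le
      _ = N := add_sub_cancel _ _

/-- A Sobolev function is the sum of a cosine series and a sine series. -/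
lemma exists_cos_add_sin (hs : 0 ≤ s) (f : Sobolev d s) {N : ℝ} (hN : ‖f‖ < N) :
    ∃ g h : L2 d Real.pi, f.toL2 = g + h ∧ cosEnergy d s g ≤ ENNReal.ofReal (N ^ 2) ∧
      sinEnergy d s h ≤ ENNReal.ofReal (N ^ 2) := by
  obtain ⟨F, hF, hle⟩ := f.exists_extension_of_lt hN
  obtain ⟨g, hg, hgψ⟩ := exists_fold 1 F
  obtain ⟨h, hh, hhψ⟩ := exists_fold (-1) F
  refine ⟨g, h, ?_, (cosEnergy_fold_le hgψ).trans hle, (sinEnergy_fold_le hs hhψ).trans hle⟩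
  rw [← hF]
  ext1
  filter_upwards [hg, hh, coeFn_restr F, Lp.coeFn_add g h] with t a b c e
  rw [c, e, Pi.add_apply, a, b, ← smul_add, one_smul, neg_one_smul, add_add_add_comm,
    add_neg_cancel, add_zero, ← two_smul ℝ, smul_smul]
  norm_num

lemma exists_of_sinEnergy (hs : 0 ≤ s) {x : L2 d Real.pi} (hx : sinEnergy d s x ≠ ⊤) :
    ∃ f : Sobolev d s, f.toL2 = x ∧
      ENNReal.ofReal (‖f‖ ^ 2) ≤ ENNReal.ofReal (2 * 2 ^ s) * sinEnergy d s x := by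
  obtain ⟨F, hF, hle⟩ := exists_odd_extension hs x
  obtain ⟨f, hf, hfn⟩ := exists_of_extension hF
    (ne_top_of_le_ne_top (ENNReal.mul_ne_top ENNReal.ofReal_ne_top hx) hle)
  exact ⟨f, hf, hfn.trans hle⟩

lemma exists_of_cosEnergy {x : L2 d Real.pi} (hx : cosEnergy d s x ≠ ⊤) :
    ∃ f : Sobolev d s, f.toL2 = x := by
  obtain ⟨F, hF, hle⟩ := exists_even_extension (s := s) x
  obtain ⟨f, hf, -⟩ := exists_of_extension hF
    (ne_top_of_le_ne_top (ENNReal.mul_ne_top (by norm_num) hx) hle)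
  exact ⟨f, hf⟩

end Sobolev

lemma exists_weighted_sin {d : ℕ} {s : ℝ} {x : L2 d Real.pi} (hx : sinEnergy d s x ≠ ⊤) :
    ∃ c : lp (fun _ : ℕ => E d) 2, (∀ n : ℕ, c n = ((n : ℝ) + 1) ^ s • sinIso d x n) ∧
      ENNReal.ofReal (‖c‖ ^ 2) = sinEnergy d s x := by
  have h1 : ∀ n : ℕ, ENNReal.ofReal (‖((n : ℝ) + 1) ^ s • sinIso d x n‖ ^ 2)
      = ENNReal.ofReal (((n : ℝ) + 1) ^ (2 * s) * ‖sinIso d x n‖ ^ 2) := fun n => by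
    rw [norm_smul, mul_pow, Real.norm_of_nonneg (by positivity), mul_comm 2 s,
      Real.rpow_mul (by positivity), Real.rpow_ofNat]
  have h2 : ∑' n : ℕ, ENNReal.ofReal (‖((n : ℝ) + 1) ^ s • sinIso d x n‖ ^ 2) ≠ ⊤ := by
    simp only [h1]
    exact hx
  refine ⟨⟨_, memℓp_two_of_tsum_ne_top h2⟩, fun n => rfl, ?_⟩
  exact (sinEnergy_eq_of_coeff fun n => rfl).symm

lemma summable_norm_sinIso {d : ℕ} {s : ℝ} (hs : 1 / 2 < s) {x : L2 d Real.pi}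
    (hx : sinEnergy d s x ≠ ⊤) : Summable fun n => ‖sinIso d x n‖ := by
  obtain ⟨c, hc, -⟩ := exists_weighted_sin hx
  exact summable_norm_of_weighted hs hc

/-- Sine series of regularity above `1/2` are continuous and vanish at the boundary. -/
lemma exists_continuous_of_sinEnergy {d : ℕ} {s : ℝ} (hs : 1 / 2 < s) {x : L2 d Real.pi}
    (hx : sinEnergy d s x ≠ ⊤) :
    ∃ u : ℝ → E d, Continuous u ∧ u 0 = 0 ∧ u Real.pi = 0 ∧ x =ᵐ[leb Real.pi] u := by
  have hsum := summable_norm_sinIso hs hx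
  refine ⟨_, isCompleteOrtho_sinFun.continuous_tsum hsum, ?_, ?_,
    isCompleteOrtho_sinFun.ae_eq_tsum hsum⟩
  · have : ∀ n, sinFun n 0 = 0 := fun n => by simp [sinFun]
    simp [this]
  · have : ∀ n, sinFun n Real.pi = 0 := fun n => by
      rw [sinFun, Real.sin_int_mul_pi, mul_zero]
    simp [this]

theorem Sobolev.sinEnergy_le_of_lt (d : ℕ) {s : ℝ} (h0 : 0 ≤ s) (h1 : s < 1 / 2) :
    ∃ C : ℝ, 0 < C ∧ ∀ f : Sobolev d s, sinEnergy d s f.toL2 ≤ ENNReal.ofReal (C * ‖f‖ ^ 2) := by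
  obtain ⟨C, hC, hle⟩ := sinEnergy_le_cosEnergy_of_lt d h0 h1
  refine ⟨2 * (C + 1), by positivity, fun f => le_ofReal_mul_sq fun N hN => ?_⟩
  obtain ⟨g, h, hf, hg, hh⟩ := f.exists_cos_add_sin h0 hN
  rw [hf]
  calc _ ≤ 2 * (sinEnergy d s g + sinEnergy d s h) := sinEnergy_add_le g h
    _ ≤ 2 * (ENNReal.ofReal C * ENNReal.ofReal (N ^ 2) + ENNReal.ofReal (N ^ 2)) := by
      gcongr
      exact (hle g).trans (by gcongr)
    _ = _ := by
      rw [ENNReal.ofReal_mul (by positivity), ENNReal.ofReal_mul (by norm_num),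
        ENNReal.ofReal_add hC.le (by norm_num), ENNReal.ofReal_one, ENNReal.ofReal_ofNat]
      ring

theorem Sobolev.sinEnergy_le_of_gt (d : ℕ) {s : ℝ} (h0 : 1 / 2 < s) (h1 : s ≤ 2) :
    ∃ C : ℝ, 0 < C ∧ ∀ f ∈ sobolevC0 d s, sinEnergy d s f.toL2 ≤ ENNReal.ofReal (C * ‖f‖ ^ 2) := by
  obtain ⟨C, hC, hle⟩ := sinEnergy_le_cosEnergy_of_gt d h0 h1
  refine ⟨2 * (C + 1), by positivity, fun f ⟨u, hu, hu0, hupi, hfu⟩ =>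
    le_ofReal_mul_sq fun N hN => ?_⟩
  obtain ⟨g, h, hf, hg, hh⟩ := f.exists_cos_add_sin (by linarith) hN
  -- The sine part vanishes at the boundary by itself, hence so does the cosine part `u - v`, and
  -- the conversion estimate applies to it.
  obtain ⟨v, hv, hv0, hvpi, hhv⟩ := exists_continuous_of_sinEnergy h0
    (ne_top_of_le_ne_top ENNReal.ofReal_ne_top hh)
  have hg1 : g =ᵐ[leb Real.pi] u - v := by
    rw [hf] at hfu
    filter_upwards [hfu, hhv, Lp.coeFn_add g h] with t a b c
    rw [Pi.sub_apply, ← a, ← b, c, Pi.add_apply, add_sub_cancel_right]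
  have hg2 := hle g (u - v) (hu.sub hv.continuousOn) (by simp [hu0, hv0]) (by simp [hupi, hvpi]) hg1
  rw [hf]
  calc _ ≤ 2 * (sinEnergy d s g + sinEnergy d s h) := sinEnergy_add_le g h
    _ ≤ 2 * (ENNReal.ofReal C * ENNReal.ofReal (N ^ 2) + ENNReal.ofReal (N ^ 2)) := by
      gcongr
      exact hg2.trans (by gcongr)
    _ = _ := by
      rw [ENNReal.ofReal_mul (by positivity), ENNReal.ofReal_mul (by norm_num),
        ENNReal.ofReal_add hC.le (by norm_num), ENNReal.ofReal_one, ENNReal.ofReal_ofNat]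
      ring

/-! ### Isomorphisms with the sequence space. -/

/-- Square summable sequences in `ℝ^d`. -/
abbrev Seq (d : ℕ) : Type := lp (fun _ : ℕ => E d) 2

/-- A space that is normed by its weighted sine coefficients. -/
theorem exists_weighted_equiv {X : Type*} [SeminormedAddCommGroup X] [NormedSpace ℝ X] {d : ℕ}
    (ι : X →ₗ[ℝ] L2 d Real.pi) (hι : Function.Injective ι) {s A B : ℝ} (hs : 0 ≤ s) (hA : 0 ≤ A)
    (hB : 0 ≤ B) (h1 : ∀ x, sinEnergy d s (ι x) ≤ ENNReal.ofReal (A * ‖x‖ ^ 2))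
    (h2 : ∀ y, sinEnergy d s y ≠ ⊤ → ∃ x, ι x = y ∧
      ENNReal.ofReal (‖x‖ ^ 2) ≤ ENNReal.ofReal B * sinEnergy d s y) :
    ∃ e : X ≃L[ℝ] Seq d, ∀ x (n : ℕ), e x n = ((n : ℝ) + 1) ^ s • sinIso d (ι x) n := by
  have htop : ∀ x, sinEnergy d s (ι x) ≠ ⊤ := fun x =>
    ne_top_of_le_ne_top ENNReal.ofReal_ne_top (h1 x)
  choose c hc hcn using fun x => exists_weighted_sin (htop x)
  have hinj : Function.Injective c := fun x y hxy => hι <| isCompleteOrtho_sinFun.ext fun n => by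
    have h3 : ((n : ℝ) + 1) ^ s • sinIso d (ι x) n = ((n : ℝ) + 1) ^ s • sinIso d (ι y) n := by
      rw [← hc, ← hc, hxy]
    have hn : ((n : ℝ) + 1) ^ s ≠ 0 := by positivity
    exact smul_right_injective _ hn h3
  have hsurj : Function.Surjective c := fun b => by
    -- Since `0 ≤ s`, dividing by the weights keeps a sequence in `ℓ²`, so the preimage is an honest
    -- `L²` function.
    have hw : ∀ n : ℕ, |((n : ℝ) + 1) ^ (-s)| ≤ 1 := fun n => by
      rw [abs_of_nonneg (by positivity)]
      exact Real.rpow_le_one_of_one_le_of_nonpos (by linarith [n.cast_nonneg (α := ℝ)])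
        (by linarith)
    let a : Seq d := ⟨_, memℓp_two_smul hw b⟩
    have hab : ∀ n : ℕ, ((n : ℝ) + 1) ^ s • sinIso d ((sinIso d).symm a) n = b n := fun n => by
      rw [LinearIsometryEquiv.apply_symm_apply]
      change ((n : ℝ) + 1) ^ s • ((n : ℝ) + 1) ^ (-s) • b n = b n
      rw [smul_smul, ← Real.rpow_add (by positivity), add_neg_cancel, Real.rpow_zero, one_smul]
    obtain ⟨x, hx, -⟩ := h2 ((sinIso d).symm a) (by
      rw [sinEnergy_eq_of_coeff hab]
      exact ENNReal.ofReal_ne_top)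
    refine ⟨x, lp.ext (funext fun n => ?_)⟩
    rw [hc, hx, hab]
  let L : X →ₗ[ℝ] Seq d :=
    { toFun := c
      map_add' := fun x y => lp.ext (funext fun n => by
        rw [lp.coeFn_add, Pi.add_apply, hc, hc, hc, map_add, map_add, lp.coeFn_add, Pi.add_apply,
          smul_add])
      map_smul' := fun k x => lp.ext (funext fun n => by
        rw [lp.coeFn_smul, Pi.smul_apply, hc, hc, map_smul, map_smul, lp.coeFn_smul, Pi.smul_apply,
          smul_comm, RingHom.id_apply]) }
  have hle1 : ∀ x, ‖c x‖ ≤ √A * ‖x‖ := fun x => by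
    have h3 := h1 x
    rw [← hcn, ENNReal.ofReal_le_ofReal_iff (by positivity)] at h3
    rw [← Real.sqrt_sq (norm_nonneg x), ← Real.sqrt_mul hA]
    exact Real.le_sqrt_of_sq_le h3
  have hle2 : ∀ x, ‖x‖ ≤ √B * ‖c x‖ := fun x => by
    obtain ⟨x', hx', h3⟩ := h2 _ (htop x)
    rw [hι hx', ← hcn, ← ENNReal.ofReal_mul hB, ENNReal.ofReal_le_ofReal_iff (by positivity)] at h3
    rw [← Real.sqrt_sq (norm_nonneg (c x)), ← Real.sqrt_mul hB]
    exact Real.le_sqrt_of_sq_le h3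
  refine ⟨(LinearEquiv.ofBijective L ⟨hinj, hsurj⟩).toContinuousLinearEquivOfBounds (√A) (√B)
    hle1 fun y => ?_, hc⟩
  refine (hle2 _).trans_eq ?_
  congr 2
  exact (LinearEquiv.ofBijective L ⟨hinj, hsurj⟩).apply_symm_apply y

/-- Spaces with equivalent weighted sine coefficients are isomorphic. -/
lemma map_symm_eq {X Y : Type*} [SeminormedAddCommGroup X] [NormedSpace ℝ X]
    [SeminormedAddCommGroup Y] [NormedSpace ℝ Y] {d : ℕ} {ι : X → L2 d Real.pi}
    {κ : Y → L2 d Real.pi} {s : ℝ} {e : X ≃L[ℝ] Seq d} {f : Y ≃L[ℝ] Seq d}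
    (he : ∀ x (n : ℕ), e x n = ((n : ℝ) + 1) ^ s • sinIso d (ι x) n)
    (hf : ∀ y (n : ℕ), f y n = ((n : ℝ) + 1) ^ s • sinIso d (κ y) n) (x : X) :
    κ ((e.trans f.symm) x) = ι x := by
  refine isCompleteOrtho_sinFun.ext fun n => ?_
  have hn : ((n : ℝ) + 1) ^ s ≠ 0 := by positivity
  refine smul_right_injective _ hn ?_
  beta_reduce
  refine (hf _ n).symm.trans (Eq.trans ?_ (he x n))
  rw [ContinuousLinearEquiv.trans_apply, ContinuousLinearEquiv.apply_symm_apply]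

lemma PowDomain.ofReal_norm_sq {T m : ℝ} {d : ℕ} {α : ℝ} (x : PowDomain T m d α) :
    ENNReal.ofReal (‖x‖ ^ 2) = powEnergy T m d α x.toL2 :=
  (tsum_ofReal_norm_sq (PowDomain.pow x)).symm

/-- The inclusion of the domain of a fractional power. -/
def PowDomain.incl (T m : ℝ) (d : ℕ) (α : ℝ) : PowDomain T m d α →ₗ[ℝ] L2 d Real.pi :=
  (powSubmodule T m d α).subtype

/-- The inclusion of a Sobolev space. -/
def Sobolev.incl (d : ℕ) (s : ℝ) : Sobolev d s →ₗ[ℝ] L2 d Real.pi :=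
  (LinearMap.range (PerSobolev.r d s)).subtype

lemma Sobolev.incl_injective (d : ℕ) (s : ℝ) : Function.Injective (Sobolev.incl d s) :=
  Subtype.val_injective

lemma PowDomain.exists_equiv {T m : ℝ} (hT : 0 < T) (hm : 0 < m) (d : ℕ) {α : ℝ} (h0 : 0 ≤ α)
    (h1 : α ≤ 1 / 2) : ∃ e : PowDomain T m d α ≃L[ℝ] Seq d,
      ∀ x (n : ℕ), e x n = ((n : ℝ) + 1) ^ (4 * α) • sinIso d x.toL2 n := by
  obtain ⟨C, hC, h⟩ := powEnergy_equiv hT hm d (α := α) ⟨by linarith, h1⟩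
  refine exists_weighted_equiv (PowDomain.incl T m d α) Subtype.val_injective (by linarith) hC.le
    hC.le (fun x => ?_) fun y hy => ?_
  · rw [ENNReal.ofReal_mul hC.le, PowDomain.ofReal_norm_sq]
    exact (h x.toL2).2
  · refine ⟨⟨y, memℓp_two_of_tsum_ne_top (ne_top_of_le_ne_top
      (ENNReal.mul_ne_top ENNReal.ofReal_ne_top hy) (h y).1)⟩, rfl, ?_⟩
    exact (PowDomain.ofReal_norm_sq _).trans_le (h y).1

lemma Sobolev.exists_equiv (d : ℕ) {s : ℝ} (h0 : 0 ≤ s) (h1 : s < 1 / 2) :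
    ∃ e : Sobolev d s ≃L[ℝ] Seq d,
      ∀ f (n : ℕ), e f n = ((n : ℝ) + 1) ^ s • sinIso d f.toL2 n := by
  obtain ⟨C, hC, h⟩ := Sobolev.sinEnergy_le_of_lt d h0 h1
  exact exists_weighted_equiv (Sobolev.incl d s) (Sobolev.incl_injective d s) h0 hC.le
    (by positivity) h fun y hy => Sobolev.exists_of_sinEnergy h0 hy

lemma sobolevC0.exists_equiv (d : ℕ) {s : ℝ} (h0 : 1 / 2 < s) (h1 : s ≤ 2) :
    ∃ e : sobolevC0 d s ≃L[ℝ] Seq d,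
      ∀ f (n : ℕ), e f n = ((n : ℝ) + 1) ^ s • sinIso d f.1.toL2 n := by
  obtain ⟨C, hC, h⟩ := Sobolev.sinEnergy_le_of_gt d h0 h1
  refine exists_weighted_equiv (B := 2 * 2 ^ s) (Sobolev.incl d s ∘ₗ (sobolevC0 d s).subtype)
    ((Sobolev.incl_injective d s).comp Subtype.val_injective) (by linarith) hC.le
    (by positivity) (fun f => h f.1 f.2) fun y hy => ?_
  obtain ⟨f, hf, hle⟩ := Sobolev.exists_of_sinEnergy (by linarith) hy
  obtain ⟨u, hu, hu0, hupi, hyu⟩ := exists_continuous_of_sinEnergy h0 hy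
  exact ⟨⟨f, u, hu.continuousOn, hu0, hupi, hf ▸ hyu⟩, hf, hle⟩

/-! ### Negative orders and duality. -/

lemma sinEnergy_le_of_nonpos {d : ℕ} {s : ℝ} (hs : s ≤ 0) (x : L2 d Real.pi) :
    sinEnergy d s x ≤ ENNReal.ofReal (‖x‖ ^ 2) := by
  rw [← energy_one (sinIso d)]
  refine ENNReal.tsum_le_tsum fun n => ENNReal.ofReal_le_ofReal ?_
  refine mul_le_mul_of_nonneg_right ?_ (sq_nonneg _)
  exact Real.rpow_le_one_of_one_le_of_nonpos (by linarith [n.cast_nonneg (α := ℝ)]) (by linarith)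

lemma le_mul_of_ofReal_sq_le {a b C : ℝ} (hb : 0 ≤ b) (hC : 0 ≤ C)
    (h : ENNReal.ofReal (a ^ 2) ≤ ENNReal.ofReal C * ENNReal.ofReal (b ^ 2)) : a ≤ √C * b := by
  rw [← ENNReal.ofReal_mul hC, ENNReal.ofReal_le_ofReal_iff (by positivity)] at h
  rw [← Real.sqrt_sq hb, ← Real.sqrt_mul hC]
  exact Real.le_sqrt_of_sq_le h

lemma abs_weight_le_one {σ : ℝ} (hσ : σ ≤ 0) (n : ℕ) : |((n : ℝ) + 1) ^ σ| ≤ 1 := by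
  rw [abs_of_nonneg (by positivity)]
  exact Real.rpow_le_one_of_one_le_of_nonpos (by linarith [n.cast_nonneg (α := ℝ)]) hσ

section Negative

variable {T m : ℝ} {d : ℕ} {α : ℝ}

/-- Nonpositive powers are bounded on `L²`, so their domain is everything and its completion is the
one meant in the theorem. -/
lemma PowDomain.exists_toL2 (hT : 0 < T) (hm : 0 < m) (h0 : -(1 / 2) ≤ α) (h1 : α ≤ 0)
    (y : L2 d Real.pi) : ∃ x : PowDomain T m d α, x.toL2 = y := by
  obtain ⟨C, hC, h⟩ := powEnergy_equiv hT hm d (α := α) ⟨h0, by linarith⟩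
  have hy : powEnergy T m d α y ≠ ⊤ := ne_top_of_le_ne_top
    (ENNReal.mul_ne_top ENNReal.ofReal_ne_top (ne_top_of_le_ne_top ENNReal.ofReal_ne_top
      (sinEnergy_le_of_nonpos (by linarith) y))) (h y).1
  exact ⟨⟨y, memℓp_two_of_tsum_ne_top hy⟩, rfl⟩

/-- The completions are normed by their weighted sine coefficients. -/
lemma InterpNeg.exists_equiv (hT : 0 < T) (hm : 0 < m) (h0 : -(1 / 2) ≤ α) (h1 : α ≤ 0) :
    ∃ e : InterpNeg T m d α ≃L[ℝ] Seq d, ∀ (x : PowDomain T m d α) (n : ℕ),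
      e (x : InterpNeg T m d α) n = ((n : ℝ) + 1) ^ (4 * α) • sinIso d x.toL2 n := by
  obtain ⟨C, hC, h⟩ := powEnergy_equiv hT hm d (α := α) ⟨h0, by linarith⟩
  let D := diag (fun _ : ℕ => E d) (fun n : ℕ => ((n : ℝ) + 1) ^ (4 * α)) 1
    (abs_weight_le_one (by linarith))
  let e₂ : PowDomain T m d α →ₗ[ℝ] Seq d :=
    D.toLinearMap ∘ₗ (sinIso d).toLinearEquiv.toLinearMap ∘ₗ PowDomain.incl T m d α
  have he₂ : ∀ (x : PowDomain T m d α) (n : ℕ),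
      e₂ x n = ((n : ℝ) + 1) ^ (4 * α) • sinIso d x.toL2 n := fun x n =>
    diag_apply (abs_weight_le_one (by linarith)) (sinIso d x.toL2) n
  have hn : ∀ x : PowDomain T m d α,
      ENNReal.ofReal (‖e₂ x‖ ^ 2) = sinEnergy d (4 * α) x.toL2 := fun x =>
    (sinEnergy_eq_of_coeff fun n => (he₂ x n).symm).symm
  let e₁ : PowDomain T m d α →ₗ[ℝ] InterpNeg T m d α :=
    (UniformSpace.Completion.toComplL (𝕜 := ℝ) (E := PowDomain T m d α)).toLinearMap
  have hn1 : ∀ x : PowDomain T m d α, ‖e₁ x‖ = ‖x‖ := fun x =>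
    UniformSpace.Completion.norm_coe x
  have hd1 : DenseRange e₁ := UniformSpace.Completion.denseRange_coe
  have hd2 : DenseRange e₂ := by
    -- Density: the range contains the sequences with one nonzero entry, since dividing a single
    -- coefficient by its weight is always possible.
    have hs : ∀ (n : ℕ) (v : E d), lp.single 2 n v ∈ LinearMap.range e₂ := fun n v => by
      obtain ⟨x, hx⟩ := PowDomain.exists_toL2 (α := α) hT hm h0 h1
        ((sinIso d).symm (lp.single 2 n (((n : ℝ) + 1) ^ (-(4 * α)) • v)))
      refine ⟨x, lp.ext (funext fun k => ?_)⟩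
      rw [he₂, hx, LinearIsometryEquiv.apply_symm_apply]
      rcases eq_or_ne k n with rfl | hk
      · rw [lp.single_apply_self, lp.single_apply_self, smul_smul, ← Real.rpow_add (by positivity),
          add_neg_cancel, Real.rpow_zero, one_smul]
      · rw [lp.single_apply_ne _ _ _ hk, lp.single_apply_ne _ _ _ hk, smul_zero]
    intro c
    refine mem_closure_of_tendsto (lp.hasSum_single (by norm_num) c) (Filter.Eventually.of_forall
      fun t => ?_)
    exact (LinearMap.range e₂).sum_mem fun n _ => hs n _
  have hb1 : ∀ x, ‖e₂ (LinearEquiv.refl ℝ (PowDomain T m d α) x)‖ ≤ √C * ‖e₁ x‖ := fun x => by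
    refine le_mul_of_ofReal_sq_le (norm_nonneg _) hC.le ?_
    rw [hn1, PowDomain.ofReal_norm_sq]
    exact (hn x).trans_le (h x.toL2).2
  have hb2 : ∀ x, ‖e₁ ((LinearEquiv.refl ℝ (PowDomain T m d α)).symm x)‖ ≤ √C * ‖e₂ x‖ :=
    fun x => by
      refine le_mul_of_ofReal_sq_le (norm_nonneg _) hC.le ?_
      rw [hn1, hn, PowDomain.ofReal_norm_sq]
      exact (h x.toL2).1
  -- The same space is densely embedded in the completion and in `ℓ²` with equivalent norms, so the
  -- identity extends to an isomorphism.
  refine ⟨(LinearEquiv.refl ℝ (PowDomain T m d α)).extend e₁ e₂ hd1 ⟨_, hb1⟩ hd2 ⟨_, hb2⟩,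
    fun x n => ?_⟩
  rw [← he₂]
  exact congrArg (fun c : Seq d => c n)
    (LinearEquiv.extend_eq (LinearEquiv.refl ℝ (PowDomain T m d α)) e₁ e₂ hd1 ⟨_, hb1⟩
      hd2 ⟨_, hb2⟩ x)

end Negative

lemma inner_eq_of_weighted {d : ℕ} {σ τ : ℝ} (hστ : σ + τ = 0) {x y : L2 d Real.pi} {a b : Seq d}
    (ha : ∀ n : ℕ, a n = ((n : ℝ) + 1) ^ σ • sinIso d x n)
    (hb : ∀ n : ℕ, b n = ((n : ℝ) + 1) ^ τ • sinIso d y n) : inner ℝ a b = inner ℝ x y := by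
  refine (lp.hasSum_inner (𝕜 := ℝ) a b).unique
    ((isCompleteOrtho_sinFun.hasSum_inner_iso x y).congr_fun fun n => ?_)
  rw [ha, hb, real_inner_smul_left, real_inner_smul_right, ← mul_assoc,
    ← Real.rpow_add (by positivity), hστ, Real.rpow_zero, one_mul]
  rfl

/-- Duality between weighted spaces of opposite orders. -/
lemma exists_dual_equiv {T m : ℝ} (hT : 0 < T) (hm : 0 < m) {d : ℕ} {α : ℝ} (h0 : -(1 / 2) ≤ α)
    (h1 : α ≤ 0) {X : Type*} [SeminormedAddCommGroup X] [NormedSpace ℝ X] {ι : X → L2 d Real.pi}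
    (f : X ≃L[ℝ] Seq d)
    (hf : ∀ x (n : ℕ), f x n = ((n : ℝ) + 1) ^ (-(4 * α)) • sinIso d (ι x) n) :
    ∃ e : InterpNeg T m d α ≃L[ℝ] StrongDual ℝ X, ∀ (x : PowDomain T m d α) (z : X),
      e (x : InterpNeg T m d α) z = inner ℝ x.toL2 (ι z) := by
  obtain ⟨e, he⟩ := InterpNeg.exists_equiv (d := d) hT hm h0 h1
  -- Riesz representation in `ℓ²`; the opposite weights cancel in the inner product, so the pairing
  -- is that of `L²`.
  let R : Seq d ≃ₗᵢ[ℝ] StrongDual ℝ (Seq d) := InnerProductSpace.toDual ℝ (Seq d)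
  refine ⟨(e.trans R.toContinuousLinearEquiv).trans
    (f.symm.arrowCongr (ContinuousLinearEquiv.refl ℝ ℝ)), fun x z => ?_⟩
  exact inner_eq_of_weighted (a := e x) (b := f z) (by ring) (he x) (hf z)

/-! ### Boundary values and Dirac masses. -/

lemma tsum_norm_le_of_weighted {d : ℕ} {s : ℝ} (hs : 1 / 2 < s) {a : ℕ → E d} {c : Seq d}
    (h : ∀ n : ℕ, c n = ((n : ℝ) + 1) ^ s • a n) :
    ∑' n, ‖a n‖ ≤ √(∑' n : ℕ, (((n : ℝ) + 1) ^ (-s)) ^ 2) * ‖c‖ := by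
  have h1 : ∀ n : ℕ, ‖a n‖ = ((n : ℝ) + 1) ^ (-s) * ‖c n‖ := fun n => by
    rw [h, norm_smul, Real.norm_of_nonneg (by positivity), ← mul_assoc,
      ← Real.rpow_add (by positivity), neg_add_cancel, Real.rpow_zero, one_mul]
  simp only [h1]
  have h2 := Real.inner_le_Lp_mul_Lq_tsum_of_nonneg Real.HolderConjugate.two_two
    (f := fun n : ℕ => ((n : ℝ) + 1) ^ (-s)) (g := fun n => ‖c n‖) (fun n => by positivity)
    (fun n => norm_nonneg _) (by simpa using summable_rpow_sq (τ := -s) (by linarith))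
    (by simpa using (hasSum_norm_sq c).summable)
  simp only [Real.rpow_two, ← Real.sqrt_eq_rpow, (hasSum_norm_sq c).tsum_eq] at h2
  rwa [Real.sqrt_sq (norm_nonneg c)] at h2

lemma norm_le_of_ofReal_sq_le {a b : ℝ} (hb : 0 ≤ b)
    (h : ENNReal.ofReal (a ^ 2) ≤ ENNReal.ofReal (b ^ 2)) : a ≤ b := by
  rw [ENNReal.ofReal_le_ofReal_iff (by positivity)] at h
  exact le_of_sq_le_sq h hb

namespace Sobolev

variable {d : ℕ} {s : ℝ}

/-- Sobolev embedding. -/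
lemma exists_continuous_norm_le (d : ℕ) (hs : 1 / 2 < s) :
    ∃ C : ℝ, 0 ≤ C ∧ ∀ (f : Sobolev d s) (N : ℝ), ‖f‖ < N → ∃ u : ℝ → E d, Continuous u ∧
      f.toL2 =ᵐ[leb Real.pi] u ∧ ∀ t, ‖u t‖ ≤ C * N := by
  set A : ℝ := √(∑' n : ℕ, (((n : ℝ) + 1) ^ (-s)) ^ 2) with hA
  have hA0 : 0 ≤ A := Real.sqrt_nonneg _
  refine ⟨1 + A + A, by positivity, fun f N hN => ?_⟩
  have hN0 : 0 ≤ N := (norm_nonneg f).trans hN.le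
  obtain ⟨g, h, hf, hg, hh⟩ := f.exists_cos_add_sin (by linarith) hN
  have hgt := ne_top_of_le_ne_top ENNReal.ofReal_ne_top hg
  have hht := ne_top_of_le_ne_top ENNReal.ofReal_ne_top hh
  have hgs := summable_norm_cosIso hs hgt
  have hhs := summable_norm_sinIso hs hht
  obtain ⟨c, hc, hce⟩ := exists_weighted_cos (by linarith) hgt
  obtain ⟨b, hb, hbe⟩ := exists_weighted_sin hht
  have hcN : ‖c‖ ≤ N := norm_le_of_ofReal_sq_le hN0 (le_self_add.trans (hce.trans hg))
  have h0N : ‖cosIso d g 0‖ ≤ N :=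
    norm_le_of_ofReal_sq_le hN0 (le_add_self.trans (hce.trans hg))
  have hbN : ‖b‖ ≤ N := norm_le_of_ofReal_sq_le hN0 (hbe.trans_le hh)
  have hsum : ∀ {φ : ℕ → ℝ → ℝ} (hφ : IsCompleteOrtho φ) {a : ℕ → E d},
      (Summable fun n => ‖a n‖) → ∀ t, ‖∑' n, φ n t • a n‖ ≤ ∑' n, ‖a n‖ := fun hφ a ha t =>
    tsum_of_norm_bounded ha.hasSum fun n => by
      rw [norm_smul]
      exact mul_le_of_le_one_left (norm_nonneg _) (hφ.bound n t)
  refine ⟨_, (isCompleteOrtho_cosFun.continuous_tsum hgs).add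
    (isCompleteOrtho_sinFun.continuous_tsum hhs), ?_, fun t => ?_⟩
  · rw [hf]
    filter_upwards [isCompleteOrtho_cosFun.ae_eq_tsum hgs, isCompleteOrtho_sinFun.ae_eq_tsum hhs,
      Lp.coeFn_add g h] with t a b c
    rw [c, Pi.add_apply, a, b]
    rfl
  · have h3 : ∑' n, ‖cosIso d g n‖ ≤ N + A * N := by
      rw [hgs.tsum_eq_zero_add]
      refine add_le_add h0N ((tsum_norm_le_of_weighted hs hc).trans ?_)
      gcongr
    have h4 : ∑' n, ‖sinIso d h n‖ ≤ A * N := (tsum_norm_le_of_weighted hs hb).trans (by gcongr)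
    calc _ ≤ ∑' n, ‖cosIso d g n‖ + ∑' n, ‖sinIso d h n‖ :=
          (norm_add_le _ _).trans (add_le_add (hsum isCompleteOrtho_cosFun hgs t)
            (hsum isCompleteOrtho_sinFun hhs t))
      _ ≤ _ := by linarith

/-- Evaluation at a point. -/
lemma exists_eval (d : ℕ) (hs : 1 / 2 < s) {t : ℝ} (ht : t ∈ Icc 0 Real.pi) :
    ∃ L : Sobolev d s →L[ℝ] E d, ∀ (f : Sobolev d s) (u : ℝ → E d),
      ContinuousOn u (Icc 0 Real.pi) → f.toL2 =ᵐ[leb Real.pi] u → L f = u t := by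
  obtain ⟨C, hC, hb⟩ := exists_continuous_norm_le d hs
  choose v hv hfv hvn using fun f : Sobolev d s => hb f (‖f‖ + 1) (lt_add_one _)
  -- Continuous representatives agree on all of `[0, π]`, so the chosen one may be replaced by any
  -- other; linearity of evaluation and its norm bound both follow from this.
  have huniq : ∀ (f : Sobolev d s) (u : ℝ → E d), ContinuousOn u (Icc 0 Real.pi) →
      f.toL2 =ᵐ[leb Real.pi] u → v f t = u t := fun f u hu hfu =>
    eqOn_of_ae_eq (hv f).continuousOn hu ((hfv f).symm.trans hfu) ht
  let L : Sobolev d s →ₗ[ℝ] E d :=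
    { toFun := fun f => v f t
      map_add' := fun f g => huniq (f + g) (v f + v g) ((hv f).add (hv g)).continuousOn (by
        rw [toL2_add]
        filter_upwards [hfv f, hfv g, Lp.coeFn_add f.toL2 g.toL2] with t a b c
        rw [c, Pi.add_apply, Pi.add_apply, a, b])
      map_smul' := fun k f => huniq (k • f) (k • v f) ((hv f).const_smul k).continuousOn (by
        rw [toL2_smul]
        filter_upwards [hfv f, Lp.coeFn_smul k f.toL2] with t a c
        rw [c, Pi.smul_apply, Pi.smul_apply, a]) }
  refine ⟨L.mkContinuous C fun f => ?_, huniq⟩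
  change ‖v f t‖ ≤ C * ‖f‖
  have h1 : Filter.Tendsto (fun N : ℝ => C * N) (nhdsWithin ‖f‖ (Ioi ‖f‖)) (nhds (C * ‖f‖)) :=
    ((continuous_const.mul continuous_id).tendsto _).mono_left nhdsWithin_le_nhds
  refine ge_of_tendsto h1 ?_
  filter_upwards [self_mem_nhdsWithin] with N hN
  obtain ⟨w, hw, hfw, hwn⟩ := hb f N hN
  rw [huniq f w hw.continuousOn hfw]
  exact hwn t

lemma exists_of_cosFun (d : ℕ) (s : ℝ) (k : ℕ) (v : E d) :
    ∃ f : Sobolev d s, f.toL2 = tens d (isCompleteOrtho_cosFun.memLp k) v := by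
  refine exists_of_cosEnergy (s := s) ?_
  have h1 : cosIso d (tens d (isCompleteOrtho_cosFun.memLp k) v) = lp.single 2 k v := by
    rw [← isCompleteOrtho_cosFun.iso_symm_single]
    exact LinearIsometryEquiv.apply_symm_apply _ _
  rw [cosEnergy, energy, tsum_eq_single k]
  · exact ENNReal.ofReal_ne_top
  · intro j hj
    rw [h1, lp.single_apply_ne _ _ _ hj]
    simp

/-- The functions `t ↦ (a + b cos t) v`. -/
lemma exists_lift (d : ℕ) (s a b : ℝ) : ∃ K : E d →L[ℝ] Sobolev d s,
    ∀ v, (K v).toL2 =ᵐ[leb Real.pi] fun t => (a + b * Real.cos t) • v := by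
  choose f hf using exists_of_cosFun d s
  let K : ℕ → E d →ₗ[ℝ] Sobolev d s := fun k =>
    { toFun := f k
      map_add' := fun v w => incl_injective d s (by
        rw [map_add]
        refine (hf k (v + w)).trans ?_
        rw [map_add]
        exact (congrArg₂ _ (hf k v) (hf k w)).symm)
      map_smul' := fun c v => incl_injective d s (by
        rw [map_smul]
        refine (hf k (c • v)).trans ?_
        rw [map_smul]
        exact (congrArg _ (hf k v)).symm) }
  let M : E d →ₗ[ℝ] Sobolev d s :=
    -- The divisors undo the normalisation of the first two cosines.
    (a / √(1 / Real.pi)) • K 0 + (b / √(2 / Real.pi)) • K 1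
  refine ⟨⟨M, M.continuous_of_finiteDimensional⟩, fun v => ?_⟩
  have h1 : (M v).toL2 = (a / √(1 / Real.pi)) • tens d (isCompleteOrtho_cosFun.memLp 0) v
      + (b / √(2 / Real.pi)) • tens d (isCompleteOrtho_cosFun.memLp 1) v := by
    rw [← hf 0 v, ← hf 1 v]
    rfl
  change (M v).toL2 =ᵐ[leb Real.pi] _
  rw [h1]
  have hp : √(1 / Real.pi) ≠ 0 := by positivity
  have hq : √(2 / Real.pi) ≠ 0 := by positivity
  filter_upwards [Lp.coeFn_add ((a / √(1 / Real.pi)) • tens d (isCompleteOrtho_cosFun.memLp 0) v)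
      ((b / √(2 / Real.pi)) • tens d (isCompleteOrtho_cosFun.memLp 1) v),
    Lp.coeFn_smul (a / √(1 / Real.pi)) (tens d (isCompleteOrtho_cosFun.memLp 0) v),
    Lp.coeFn_smul (b / √(2 / Real.pi)) (tens d (isCompleteOrtho_cosFun.memLp 1) v),
    coeFn_tens (isCompleteOrtho_cosFun.memLp 0) v,
    coeFn_tens (isCompleteOrtho_cosFun.memLp 1) v] with t e1 e2 e3 e4 e5
  rw [e1, Pi.add_apply, e2, e3, Pi.smul_apply, Pi.smul_apply, e4, e5, smul_smul, smul_smul,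
    ← add_smul]
  congr 1
  simp only [cosFun]
  norm_num
  field_simp

end Sobolev

namespace Sobolev

variable {d : ℕ} {s : ℝ}

/-- The boundary values of a Sobolev function can be removed by a bounded projection. -/
lemma exists_boundary_decomposition (d : ℕ) (hs : 1 / 2 < s) :
    ∃ (P : Sobolev d s →L[ℝ] sobolevC0 d s) (K₀ K₁ : E d →L[ℝ] Sobolev d s)
      (L₀ L₁ : Sobolev d s →L[ℝ] E d),
      (∀ (f : Sobolev d s) (u : ℝ → E d), ContinuousOn u (Icc 0 Real.pi) →
        f.toL2 =ᵐ[leb Real.pi] u → L₀ f = u 0 ∧ L₁ f = u Real.pi) ∧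
      (∀ f, f = P f + (K₀ (L₀ f) + K₁ (L₁ f))) ∧ ∀ f : sobolevC0 d s, P f = f := by
  obtain ⟨L₀, hL₀⟩ := exists_eval d hs (t := 0) ⟨le_rfl, Real.pi_pos.le⟩
  obtain ⟨L₁, hL₁⟩ := exists_eval d hs (t := Real.pi) ⟨Real.pi_pos.le, le_rfl⟩
  -- The functions `(1 + cos t) / 2` and `(1 - cos t) / 2` take the values `1, 0` and `0, 1` at the
  -- two ends, and as cosine polynomials they lie in every Sobolev space.
  obtain ⟨K₀, hK₀⟩ := exists_lift d s (1 / 2) (1 / 2)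
  obtain ⟨K₁, hK₁⟩ := exists_lift d s (1 / 2) (-(1 / 2))
  obtain ⟨C, -, hb⟩ := exists_continuous_norm_le d hs
  let Q : Sobolev d s →L[ℝ] Sobolev d s :=
    ContinuousLinearMap.id ℝ _ - (K₀.comp L₀ + K₁.comp L₁)
  have hQ : ∀ f, Q f = f - (K₀ (L₀ f) + K₁ (L₁ f)) := fun f => rfl
  have hmem : ∀ f, Q f ∈ sobolevC0 d s := fun f => by
    obtain ⟨u, hu, hfu, -⟩ := hb f (‖f‖ + 1) (lt_add_one _)
    refine ⟨fun t => u t - ((1 / 2 + 1 / 2 * Real.cos t) • u 0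
      + (1 / 2 + -(1 / 2) * Real.cos t) • u Real.pi), ?_, ?_, ?_, ?_⟩
    · exact Continuous.continuousOn (by fun_prop)
    · norm_num
    · norm_num
    · have h1 : (Q f).toL2 = f.toL2 - ((K₀ (u 0)).toL2 + (K₁ (u Real.pi)).toL2) := by
        rw [hQ, hL₀ f u hu.continuousOn hfu, hL₁ f u hu.continuousOn hfu]
        rfl
      rw [h1]
      filter_upwards [hfu, hK₀ (u 0), hK₁ (u Real.pi),
        Lp.coeFn_sub f.toL2 ((K₀ (u 0)).toL2 + (K₁ (u Real.pi)).toL2),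
        Lp.coeFn_add (K₀ (u 0)).toL2 (K₁ (u Real.pi)).toL2] with t a b c e g
      rw [e, Pi.sub_apply, g, Pi.add_apply, a, b, c]
  refine ⟨Q.codRestrict (sobolevC0 d s) hmem, K₀, K₁, L₀, L₁,
    fun f u hu hfu => ⟨hL₀ f u hu hfu, hL₁ f u hu hfu⟩, fun f => ?_, fun f => ?_⟩
  · change f = Q f + (K₀ (L₀ f) + K₁ (L₁ f))
    rw [hQ, sub_add_cancel]
  · obtain ⟨f, u, hu, h0, h1, hfu⟩ := f
    refine Subtype.ext ?_
    change Q f = f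
    rw [hQ, hL₀ f u hu hfu, hL₁ f u hu hfu, h0, h1, map_zero, map_zero, add_zero, sub_zero]

end Sobolev

/-- Modulo point evaluations at the boundary, distributions are functionals on the Sobolev functions
that vanish at the boundary. -/
lemma SobolevNeg.exists_quotient_equiv (d : ℕ) {s : ℝ} (hs : 1 / 2 < -s) :
    ∃ e : (SobolevNeg d s ⧸ diracs d s) ≃L[ℝ] StrongDual ℝ (sobolevC0 d (-s)),
      ∀ (φ : SobolevNeg d s) (f : sobolevC0 d (-s)), e (Submodule.Quotient.mk φ) f = φ f := by
  obtain ⟨P, K₀, K₁, L₀, L₁, hL, hdec, hP⟩ := Sobolev.exists_boundary_decomposition d hs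
  let R : SobolevNeg d s →L[ℝ] StrongDual ℝ (sobolevC0 d (-s)) :=
    ContinuousLinearMap.precomp ℝ (sobolevC0 d (-s)).subtypeL
  have hR : ∀ φ f, R φ f = φ f := fun φ f => rfl
  -- Extension of functionals by the projection: a bounded right inverse of the restriction `R`.
  let S : StrongDual ℝ (sobolevC0 d (-s)) →L[ℝ] SobolevNeg d s :=
    ContinuousLinearMap.precomp ℝ P
  have hS : ∀ φ f, S φ f = φ (P f) := fun φ f => rfl
  have hker : diracs d s ≤ R.ker := by
    rintro φ ⟨v, w, h⟩
    refine LinearMap.mem_ker.2 (ContinuousLinearMap.ext fun f => ?_)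
    obtain ⟨u, hu, h0, h1, hfu⟩ := f.2
    refine (h f.1 u hu hfu).trans ?_
    rw [h0, h1, inner_zero_right, inner_zero_right, add_zero]
    rfl
  -- The difference is `φ` applied to the lifted boundary values, hence a functional of `f(0)` and
  -- `f(π)` alone; Riesz representation in `ℝ^d` supplies `v` and `w`.
  have hSR : ∀ φ, φ - S (R φ) ∈ diracs d s := fun φ => by
    refine ⟨(InnerProductSpace.toDual ℝ (E d)).symm (φ.comp K₀),
      (InnerProductSpace.toDual ℝ (E d)).symm (φ.comp K₁), fun f u hu hfu => ?_⟩
    rw [InnerProductSpace.toDual_symm_apply, InnerProductSpace.toDual_symm_apply, sub_apply,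
      hS, hR, ← (hL f u hu hfu).1, ← (hL f u hu hfu).2]
    conv_lhs => rw [hdec f]
    rw [map_add, map_add, ← hdec f, add_sub_cancel_left]
    rfl
  refine ⟨ContinuousLinearEquiv.equivOfInverse ((diracs d s).liftQL R hker)
    ((diracs d s).mkQL.comp S) (fun q => ?_) fun φ => ?_, fun φ f => rfl⟩
  · obtain ⟨φ, rfl⟩ := Submodule.Quotient.mk_surjective _ q
    change Submodule.Quotient.mk (S (R φ)) = Submodule.Quotient.mk φ
    refine ((Submodule.Quotient.eq _).2 ?_).symm
    exact hSR φ
  · change R (S φ) = φ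
    refine ContinuousLinearMap.ext fun f => ?_
    rw [hR, hS, hP]

/-- In nonnegative order all weights are at least `1`, so each of the cosine and sine parts is
bounded in `L²` by any `N` above the norm. This makes `L²` functions distributions. -/
lemma Sobolev.norm_toL2_le {d : ℕ} {s : ℝ} (hs : 0 ≤ s) (f : Sobolev d s) :
    ‖f.toL2‖ ≤ 2 * ‖f‖ := by
  suffices h : ‖f.toL2‖ / 2 ≤ ‖f‖ by linarith
  refine le_of_forall_gt_imp_ge_of_dense fun N hN => ?_
  have hN0 : 0 ≤ N := (norm_nonneg f).trans hN.le
  obtain ⟨g, h, hf, hg, hh⟩ := f.exists_cos_add_sin hs hN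
  have hgN : ‖g‖ ≤ N := norm_le_of_ofReal_sq_le hN0 <| by
    rw [← energy_one (cosIso d)]
    refine le_trans (ENNReal.tsum_le_tsum fun n => ENNReal.ofReal_le_ofReal ?_) hg
    refine mul_le_mul_of_nonneg_right ?_ (sq_nonneg _)
    exact Real.one_le_rpow (by nlinarith [sq_nonneg (n : ℝ)]) hs
  have hhN : ‖h‖ ≤ N := norm_le_of_ofReal_sq_le hN0 <| by
    rw [← energy_one (sinIso d)]
    refine le_trans (ENNReal.tsum_le_tsum fun n => ENNReal.ofReal_le_ofReal ?_) hh
    refine mul_le_mul_of_nonneg_right ?_ (sq_nonneg _)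
    exact Real.one_le_rpow (by linarith [n.cast_nonneg (α := ℝ)]) (by linarith)
  have := norm_add_le g h
  rw [hf]
  linarith

/-- Square integrable functions are distributions. -/
lemma SobolevNeg.exists_isFunction {d : ℕ} {s : ℝ} (hs : 0 ≤ -s) (y : L2 d Real.pi) :
    ∃ φ : SobolevNeg d s, φ.IsFunction y := by
  refine ⟨((innerₛₗ ℝ y).comp (Sobolev.incl d (-s))).mkContinuous (‖y‖ * 2) fun f => ?_,
    fun f => rfl⟩
  refine (norm_inner_le_norm y f.toL2).trans ?_
  rw [mul_assoc]
  exact mul_le_mul_of_nonneg_left (f.norm_toL2_le hs) (norm_nonneg y)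

end Interp

end

/-! ### The theorem. -/

theorem corollary3p6 (d : ℕ) (T m : ℝ) (hT : 0 < T) (hm : 0 < m) :
    -- `H_α = H^{4α}` for `α ∈ (-1/8, 1/8)`
    ((∀ α : ℝ, 0 ≤ α → α < 1 / 8 →
        ∃ e : Interp.PowDomain T m d α ≃L[ℝ] Interp.Sobolev d (4 * α),
          ∀ x, (e x).toL2 = x.toL2) ∧
      (∀ α : ℝ, -(1 / 8) < α → α < 0 →
        ∃ e : Interp.InterpNeg T m d α ≃L[ℝ] Interp.SobolevNeg d (4 * α),
          ∀ y : Interp.L2 d Real.pi, ∃ x : Interp.PowDomain T m d α, x.toL2 = y ∧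
            (e (x : Interp.InterpNeg T m d α)).IsFunction y)) ∧
    -- `H_α = H^{4α} ∩ C₀` for `α ∈ (1/8, 1/2]`
    (∀ α : ℝ, 1 / 8 < α → α ≤ 1 / 2 →
      ∃ e : Interp.PowDomain T m d α ≃L[ℝ] Interp.sobolevC0 d (4 * α),
        ∀ x, (e x).1.toL2 = x.toL2) ∧
    -- `H_α = H^{4α} / ∼` for `α ∈ [-1/2, -1/8)`
    (∀ α : ℝ, -(1 / 2) ≤ α → α < -(1 / 8) →
      ∃ e : Interp.InterpNeg T m d α ≃L[ℝ]
          (Interp.SobolevNeg d (4 * α) ⧸ Interp.diracs d (4 * α)),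
        ∀ y : Interp.L2 d Real.pi, ∃ x : Interp.PowDomain T m d α, x.toL2 = y ∧
          ∃ φ : Interp.SobolevNeg d (4 * α), φ.IsFunction y ∧
            e (x : Interp.InterpNeg T m d α) = Submodule.Quotient.mk φ) := by
  refine ⟨⟨fun α h0 h1 => ?_, fun α h0 h1 => ?_⟩, fun α h0 h1 => ?_, fun α h0 h1 => ?_⟩
  · obtain ⟨e, he⟩ := Interp.PowDomain.exists_equiv hT hm d h0 (by linarith)
    obtain ⟨f, hf⟩ := Interp.Sobolev.exists_equiv d (s := 4 * α) (by linarith) (by linarith)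
    -- Both isomorphisms onto `ℓ²` read off the same weighted sine coefficients, so their composite
    -- fixes the underlying `L²` function.
    exact ⟨e.trans f.symm, Interp.map_symm_eq he hf⟩
  · obtain ⟨f, hf⟩ := Interp.Sobolev.exists_equiv d (s := -(4 * α)) (by linarith) (by linarith)
    obtain ⟨e, he⟩ := Interp.exists_dual_equiv hT hm (α := α) (by linarith) h1.le f hf
    refine ⟨e, fun y => ?_⟩
    obtain ⟨x, hx⟩ := Interp.PowDomain.exists_toL2 (α := α) hT hm (by linarith) h1.le y
    exact ⟨x, hx, fun f => hx ▸ he x f⟩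
  · obtain ⟨e, he⟩ := Interp.PowDomain.exists_equiv hT hm d (α := α) (by linarith) h1
    obtain ⟨f, hf⟩ := Interp.sobolevC0.exists_equiv d (s := 4 * α) (by linarith) (by linarith)
    exact ⟨e.trans f.symm, Interp.map_symm_eq he hf⟩
  · obtain ⟨f, hf⟩ := Interp.sobolevC0.exists_equiv d (s := -(4 * α)) (by linarith) (by linarith)
    obtain ⟨e, he⟩ := Interp.exists_dual_equiv hT hm (α := α) h0 (by linarith) f hf
    obtain ⟨q, hq⟩ := Interp.SobolevNeg.exists_quotient_equiv d (s := 4 * α) (by linarith)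
    refine ⟨e.trans q.symm, fun y => ?_⟩
    obtain ⟨x, hx⟩ := Interp.PowDomain.exists_toL2 (α := α) hT hm h0 (by linarith) y
    obtain ⟨φ, hφ⟩ := Interp.SobolevNeg.exists_isFunction (s := 4 * α) (by linarith) y
    refine ⟨x, hx, φ, hφ, ?_⟩
    rw [ContinuousLinearEquiv.trans_apply, ContinuousLinearEquiv.symm_apply_eq]
    -- Equality in the quotient is tested on functions vanishing at the boundary, where both sides
    -- are the `L²` pairing with `y`.
    ext f
    rw [hq, he, hφ, hx]
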